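/- **Setting.** Let $f:\mathbb{R}^d\to\mathbb{R}$ be differentiable and bounded from below, with $\nabla f$ Lipschitz continuous with parameter $\mathsf L>0$, and let $\mathrm{crit}(f)=\{x:\nabla f(x)=0\}$. We say that $f$ satisfies the Łojasiewicz inequality at $p$ with exponent $\theta\in[\frac12,1)$ if there are $\mathsf C_f>0$, $\eta\in(0,\infty]$ and a neighborhood $U$ of $p$ with $\|\nabla f(x)\|\ge \mathsf C_f|f(x)-f(p)|^{\theta}$ for all $x\in U$ with $0<|f(x)-f(p)|<\eta$. Assume that at every $p\in\mathrm{crit}(f)$ it holds with some exponent $\theta=\theta(p)\in[\frac12,1)$. Let $\lambda\in[0,1)$, $\nu\ge0$, $\alpha>0$, $\beta\ge0$, $\gamma\in(\frac23,1]$ and $\alpha_k=\alpha/(k+\beta)^{\gamma}$. On a probability space $(\Omega,\mathcal F,\mathbb P)$, let the process $(x^k)_{k\ge0}$ be generated by SGDM: $x^0=x^1\in\mathbb{R}^d$ is deterministic and, for $k\ge1$, $$\tilde x^k=x^k+\nu(x^k-x^{k-1}),\qquad g^k=\nabla f(\tilde x^k)-e^k,\qquad x^{k+1}=x^k-\alpha_kg^k+\lambda(x^k-x^{k-1}),$$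 where, with $\mathcal F_k=\sigma(x^0,\dots,x^k)$, the (square-integrable) random errors satisfy $\mathbb E[e^k\mid\mathcal F_k]=0$ and $\mathbb E[\|e^k\|^2\mid\mathcal F_k]\le\sigma^2$ almost surely for all $k\ge1$, for some constant $\sigma$. Let $\mathcal X=\{\omega:\liminf_{k\to\infty}\|x^k(\omega)\|<\infty\}$. Let $\mathcal M(x,z)=f(z)+\frac{3\mathsf L}{1-\lambda}\|z-x\|^2$ on $\mathbb{R}^d\times\mathbb{R}^d$. We call $\mathsf C>0$ a Łojasiewicz constant of $\mathcal M$ at $p$ with exponent $\theta$ if there are $\eta\in(0,\infty]$ and a neighborhood $U$ of $p$ such that $\|\nabla\mathcal M(x,z)\|\ge\mathsf C|\mathcal M(x,z)-f(p)|^{\theta}$ for all $x,z\in U$ with $|f(x)-f(p)|<\eta$ and $|f(z)-f(p)|<\eta$. **Claim.** There is a random vector $x^*:\Omega\to\mathbb{R}^d$ (with values in $\mathrm{crit}(f)$ on all of $\Omega$ if $\mathrm{crit}(f)\neq\emptyset$) such that, for almost every $\omega\in\mathcal X$, $x^*(\omega)\in\mathrm{crit}(f)$ and $x^k(\omega)\to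 x^*(\omega)$. Moreover, there is an event $\mathcal R\in\mathcal F$, $\mathcal R\subseteq\mathcal X$, with $\mathbb P(\mathcal R)=\mathbb P(\mathcal X)$, such that for every $\omega\in\mathcal R$ the realizations $x^k=x^k(\omega)$ and $x^*=x^*(\omega)$ satisfy $x^*\in\mathrm{crit}(f)$, $x^k\to x^*$ and the following. (a) If $\gamma<1$, then for every $\theta\in[\frac12,1)$ with which $f$ satisfies the Łojasiewicz inequality at $x^*$, and for every $\varepsilon>0$, $$\|x^k-x^*\|=o\big(1/k^{\Phi(\gamma,\theta)-\varepsilon}\big),\quad |f(x^k)-f(x^*)|=o\big(1/k^{\Psi(\gamma,\theta)-\varepsilon}\big),\quad \|\nabla f(x^k)\|^2=o\big(1/k^{\Psi(\gamma,\theta)-\varepsilon}\big),$$ where $\Phi(\gamma,\theta)=\min\{\frac32\gamma-1,\frac{(1-\gamma)(1-\theta)}{2\theta-1}\}$ and $\Psi(\gamma,\theta)=\min\{2\gamma-1,\frac{1-\gamma}{2\theta-1}\}$, a fraction with denominator $2\theta-1=0$ being read as $+\infty$. (b) If $\gamma=1$ and $f$ satisfies the Łojasiewicz inequality at $x^*$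 with exponent $\theta=\frac12$, then $\mathcal M$ has a Łojasiewicz constant at $x^*$ with exponent $\frac12$, and for every such constant $\mathsf C>0$ with $\alpha>200/\mathsf C^2$ and every $\varepsilon>0$, $$\|x^k-x^*\|=o\big(\log(k)^{\frac12+\varepsilon}/\sqrt k\big),\quad |f(x^k)-f(x^*)|=o\big(\log(k)^{1+\varepsilon}/k\big),\quad \|\nabla f(x^k)\|^2=o\big(\log(k)^{1+\varepsilon}/k\big).$$ -/

import Mathlib

open MeasureTheory Filter Topology Asymptotics
open scoped ENNReal

noncomputable section

namespace SGDM

/-- The Euclidean space `ℝ^d`. -/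
abbrev Vec (d : ℕ) := EuclideanSpace ℝ (Fin d)

/-- The set `crit(f)` of critical (stationary) points of `f`. -/
def crit {d : ℕ} (f : Vec d → ℝ) : Set (Vec d) := {x | gradient f x = 0}

/-- `f` is differentiable, bounded from below, and its gradient is Lipschitz continuous with
parameter `L > 0`. -/
structure SmoothObjective {d : ℕ} (f : Vec d → ℝ) (L : ℝ) : Prop where
  L_pos : 0 < L
  bddBelow : ∃ fbar : ℝ, ∀ x, fbar ≤ f x
  differentiable : Differentiable ℝ f
  lipschitz : ∀ x y, ‖gradient f x - gradient f y‖ ≤ L * ‖x - y‖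

/-- The Łojasiewicz inequality for `f` at `p` with exponent `θ`. (Allowing `η = ∞` would not
change the notion, since `η` may always be decreased.) -/
def HasLojasiewiczAt {d : ℕ} (f : Vec d → ℝ) (p : Vec d) (θ : ℝ) : Prop :=
  ∃ C : ℝ, 0 < C ∧ ∃ η : ℝ, 0 < η ∧ ∃ U ∈ 𝓝 p, ∀ x ∈ U, 0 < |f x - f p| → |f x - f p| < η →
    C * |f x - f p| ^ θ ≤ ‖gradient f x‖

/-- `f` satisfies the Łojasiewicz inequality at every critical point, with an exponent in
`[1/2, 1)` that may depend on the point. -/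
def SatisfiesLojasiewicz {d : ℕ} (f : Vec d → ℝ) : Prop :=
  ∀ p ∈ crit f, ∃ θ : ℝ, 1 / 2 ≤ θ ∧ θ < 1 ∧ HasLojasiewiczAt f p θ

/-- The merit function `M(x, z) = f(z) + ζ ‖z - x‖²`, `ζ = 3 L / (1 - lam)`, on `ℝ^d × ℝ^d` with
its Euclidean norm. -/
def merit {d : ℕ} (f : Vec d → ℝ) (L lam : ℝ) (q : WithLp 2 (Vec d × Vec d)) : ℝ :=
  f q.snd + 3 * L / (1 - lam) * ‖q.snd - q.fst‖ ^ 2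

/-- The merit function satisfies the Łojasiewicz inequality at `(p, p)` with exponent `θ` and
constant `C`: on a neighbourhood, `‖∇M(x, z)‖ ≥ C |M(x, z) - f(p)|^θ`. -/
def MeritLojasiewiczAt {d : ℕ} (f : Vec d → ℝ) (L lam : ℝ) (p : Vec d) (θ C : ℝ) : Prop :=
  ∃ η : ℝ, 0 < η ∧ ∃ U ∈ 𝓝 p, ∀ x ∈ U, ∀ z ∈ U, |f x - f p| < η → |f z - f p| < η →
    C * |merit f L lam (WithLp.toLp 2 (x, z)) - f p| ^ θ ≤
      ‖gradient (merit f L lam) (WithLp.toLp 2 (x, z))‖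

/-- The stochastic process `x` is generated by SGDM with momentum parameters `lam`, `nu`, step
sizes `a 1, a 2, …`, deterministic initial point `x0 = x^0 = x^1` and errors `e^1, e^2, …`: for all
`k ≥ 1` (written `k + 1` below),
`x̃^k = x^k + nu (x^k - x^{k-1})`, `g^k = ∇f(x̃^k) - e^k`,
`x^{k+1} = x^k - a_k g^k + lam (x^k - x^{k-1})`. -/
structure IsSGDM {d : ℕ} {Ω : Type*} (f : Vec d → ℝ) (lam nu : ℝ) (a : ℕ → ℝ) (x0 : Vec d)
    (e x : ℕ → Ω → Vec d) : Prop where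
  init_zero : ∀ ω, x 0 ω = x0
  init_one : ∀ ω, x 1 ω = x0
  step : ∀ k ω, x (k + 2) ω = x (k + 1) ω
    - a (k + 1) • (gradient f (x (k + 1) ω + nu • (x (k + 1) ω - x k ω)) - e (k + 1) ω)
    + lam • (x (k + 1) ω - x k ω)

/-- The natural filtration `F_k = σ(x^0, …, x^k)`. -/
@[reducible] def naturalSigma {d : ℕ} {Ω : Type*} (x : ℕ → Ω → Vec d) (k : ℕ) : MeasurableSpace Ω :=
  ⨆ j ≤ k, MeasurableSpace.comap (x j) inferInstance

/-- The errors `e^k`, `k ≥ 1`, are random vectors with `E[e^k | F_k] = 0` and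
`E[‖e^k‖² | F_k] ≤ σ²` a.s., where `F_k` is the natural filtration of `x`. -/
structure NoiseCondition {d : ℕ} {Ω : Type*} [MeasurableSpace Ω] (μ : Measure Ω)
    (x e : ℕ → Ω → Vec d) (σ : ℝ) : Prop where
  measurable : ∀ k, 1 ≤ k → Measurable (e k)
  square_integrable : ∀ k, 1 ≤ k → MemLp (e k) 2 μ
  condExp_zero : ∀ k, 1 ≤ k → μ[e k | naturalSigma x k] =ᵐ[μ] 0
  condVar_le : ∀ k, 1 ≤ k →
    μ[fun ω => ‖e k ω‖ ^ 2 | naturalSigma x k] ≤ᵐ[μ] fun _ => σ ^ 2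

/-- The event `{ω : liminf_k ‖x^k(ω)‖ < ∞}` (the liminf is taken in `[0, ∞]`). -/
def liminfFinite {d : ℕ} {Ω : Type*} (x : ℕ → Ω → Vec d) : Set Ω :=
  {ω | liminf (fun k => ‖x k ω‖ₑ) atTop < ∞}

/-- `Φ(γ, θ) = min {3γ/2 - 1, (1-γ)(1-θ)/(2θ-1)}`, the second term being `+∞` if `θ = 1/2`. -/
def ratePhi (γ θ : ℝ) : ℝ :=
  if θ = 1 / 2 then 3 / 2 * γ - 1
  else min (3 / 2 * γ - 1) ((1 - γ) * (1 - θ) / (2 * θ - 1))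

/-- `Ψ(γ, θ) = min {2γ - 1, (1-γ)/(2θ-1)}`, the second term being `+∞` if `θ = 1/2`. -/
def ratePsi (γ θ : ℝ) : ℝ :=
  if θ = 1 / 2 then 2 * γ - 1
  else min (2 * γ - 1) ((1 - γ) / (2 * θ - 1))

end SGDM

end

/-! Put a_k = α_k/(1-λ), c' = λ/(1-λ) and z^k = x^k + c'(x^k - x^{k-1}). The momentum cancels in
z^{k+1} = z^k - a_k g^k, while x^k - x^{k-1} contracts with factor λ. The errors are removed
pathwise by two leaky sums driven by them, n_{k+1} = (1-κa_k)n_k + a_k e^k and m_{k+1} = λm_k +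
(1-λ)a_k e^k. The differences y^k = z^k - n_k and δ^k = x^k - x^{k-1} - m_k satisfy a recursion in
which only n and m occur as perturbations (`IsSGDM.trajectory`). A Robbins–Siegmund argument in
weighted squared norm shows that almost surely η_k = ‖n_k‖² + ‖m_k‖² satisfies k^r η_k → 0 and ∑ a_k
k^r η_k < ∞ for every r < 2γ-1, with a logarithmic refinement for γ = 1 (`ae_noiseRates`). This is
the only use of martingale theory; afterwards ω is fixed.

Deterministically, the energy f(y) + ‖δ‖² decreases by about a_k‖∇f(y)‖² + ‖δ‖² per step, up to
O(a_kη_k) (`energy_decrease`, `Trajectory.descent`). Hence it converges, δ and ∇f(y) tend to zero,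
and cluster points of y are critical. Adding the tail of the perturbation series to the energy gap
gives a nonincreasing excess r_k; the Łojasiewicz inequality then bounds the step length by a
decrement of a multiple of r_k^{1-θ} plus a summable term, so that y cannot leave the neighbourhood
of a cluster point (`Descent.tendsto_of_loj`). Summability of these terms is where γ > 2/3 enters.

For rates, r_k is compared with a multiple of b_k = 1/w_k (`Descent.exists_excess_le_mul`). With b_k
= k^{-ψ}, the noise requires ψ < 2γ-1 and the recursion r_{k+1} ≤ r_k - const·a_k r_k^{2θ} requires
(2θ-1)ψ < 1-γ: these are the two terms of Ψ. Cauchy–Schwarz on [k, 2k) bounds the path length by a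
multiple of √(k^{1-γ}b_k), and summing over doublings gives Φ = (Ψ-(1-γ))/2. For γ = 1 and θ = 1/2
the comparison holds with b_k = log(k)^{1+ε}/k once α is large against 1/C². The merit function
enters only through its restriction to the diagonal, which returns the inequality for f with the
same constant. -/

noncomputable section

namespace SGDM

/-! ### Martingale noise in weighted mean square. -/

section Noise

variable {Ω E : Type*} {mΩ : MeasurableSpace Ω} {μ : Measure Ω}
  [NormedAddCommGroup E] [InnerProductSpace ℝ E]

lemma integrable_inner_of_memLp_two {u v : Ω → E} (hu : MemLp u 2 μ) (hv : MemLp v 2 μ) :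
    Integrable (fun ω => inner ℝ (u ω) (v ω)) μ := by
  have hu2 : Integrable (fun ω => ‖u ω‖ ^ 2) μ := hu.integrable_norm_pow two_ne_zero
  have hv2 : Integrable (fun ω => ‖v ω‖ ^ 2) μ := hv.integrable_norm_pow two_ne_zero
  refine (hu2.add hv2).mono' (hu.1.inner hv.1) (ae_of_all _ fun ω => ?_)
  have h := abs_real_inner_le_norm (u ω) (v ω)
  simp only [Real.norm_eq_abs, Pi.add_apply]
  nlinarith [sq_nonneg (‖u ω‖ - ‖v ω‖), sq_nonneg (‖u ω‖), sq_nonneg (‖v ω‖)]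

/-- Expanding the square, the cross term has conditional mean zero because `q` is known at the
current time and `e` is centred. -/
lemma condExp_norm_sq_affine_le [IsProbabilityMeasure μ] [CompleteSpace E] {m : MeasurableSpace Ω} (hm : m ≤ mΩ) {q e : Ω → E} {ρ s σ : ℝ}
    (hq : StronglyMeasurable[m] q) (hq2 : MemLp q 2 μ) (he2 : MemLp e 2 μ)
    (hc : μ[e | m] =ᵐ[μ] 0) (hv : μ[fun ω => ‖e ω‖ ^ 2 | m] ≤ᵐ[μ] fun _ => σ ^ 2) :
    μ[fun ω => ‖ρ • q ω + s • e ω‖ ^ 2 | m] ≤ᵐ[μ]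
      fun ω => ρ ^ 2 * ‖q ω‖ ^ 2 + s ^ 2 * σ ^ 2 := by
  have hqi : Integrable (fun ω => ‖q ω‖ ^ 2) μ := hq2.integrable_norm_pow two_ne_zero
  have hei : Integrable (fun ω => ‖e ω‖ ^ 2) μ := he2.integrable_norm_pow two_ne_zero
  have hin := integrable_inner_of_memLp_two hq2 he2
  have h1 : (fun ω => ‖ρ • q ω + s • e ω‖ ^ 2) =
      (fun ω => ρ ^ 2 * ‖q ω‖ ^ 2) +
        ((2 * ρ * s) • (fun ω => inner ℝ (q ω) (e ω)) + (s ^ 2) • fun ω => ‖e ω‖ ^ 2) := by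
    ext ω
    simp only [Pi.add_apply, Pi.smul_apply, smul_eq_mul]
    rw [norm_add_sq_real, norm_smul, norm_smul, inner_smul_left, inner_smul_right, mul_pow,
      mul_pow, Real.norm_eq_abs, Real.norm_eq_abs, sq_abs, sq_abs]
    simp only [conj_trivial]
    ring
  have hqm : StronglyMeasurable[m] (fun ω => ρ ^ 2 * ‖q ω‖ ^ 2) := (hq.norm.pow 2).const_mul _
  have h2 : μ[fun ω => inner ℝ (q ω) (e ω) | m] =ᵐ[μ] 0 := by
    have := condExp_bilin_of_stronglyMeasurable_left (μ := μ) (innerSL ℝ) hq hin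
      (he2.integrable (by norm_num))
    refine this.trans ?_
    filter_upwards [hc] with ω hω
    rw [hω]; simp
  rw [h1]
  have h3 := condExp_add (m := m) (hqi.const_mul (ρ ^ 2))
    ((hin.smul (2 * ρ * s)).add (hei.smul (s ^ 2)))
  have h4 := condExp_add (m := m) (hin.smul (2 * ρ * s)) (hei.smul (s ^ 2))
  have h5 := condExp_smul (μ := μ) (2 * ρ * s) (fun ω => inner ℝ (q ω) (e ω)) m
  have h6 := condExp_smul (μ := μ) (s ^ 2) (fun ω => ‖e ω‖ ^ 2) m
  have h7 := condExp_of_stronglyMeasurable hm hqm (hqi.const_mul (ρ ^ 2))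
  filter_upwards [h2, h3, h4, h5, h6, hv] with ω a2 a3 a4 a5 a6 a7
  rw [a3, Pi.add_apply, a4, Pi.add_apply, a5, a6, h7]
  simp only [Pi.smul_apply, smul_eq_mul, a2, Pi.zero_apply, mul_zero, zero_add]
  gcongr

/-- A Robbins–Siegmund type statement: a linear recursion driven by martingale differences of
bounded conditional variance, measured in a weighted norm that contracts in the mean. -/
theorem ae_tendsto_weight_mul_norm_sq [IsProbabilityMeasure μ] [CompleteSpace E] {ℱ : Filtration ℕ mΩ} {q e : ℕ → Ω → E}
    {ρ s w τ : ℕ → ℝ} {σ : ℝ}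
    (hq0 : StronglyMeasurable[ℱ 0] (q 0)) (hq02 : MemLp (q 0) 2 μ)
    (hq : ∀ k ω, q (k + 1) ω = ρ k • q k ω + s k • e k ω)
    (hem : ∀ k, StronglyMeasurable[ℱ (k + 1)] (e k)) (he2 : ∀ k, MemLp (e k) 2 μ)
    (hc : ∀ k, μ[e k | ℱ k] =ᵐ[μ] 0)
    (hv : ∀ k, μ[fun ω => ‖e k ω‖ ^ 2 | ℱ k] ≤ᵐ[μ] fun _ => σ ^ 2)
    (hw : ∀ k, 0 ≤ w k) (hτ : ∀ k, 0 ≤ τ k)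
    (hwρ : ∀ k, w (k + 1) * ρ k ^ 2 ≤ (1 - τ k) * w k)
    (hsum : Summable fun k => w (k + 1) * s k ^ 2) :
    ∀ᵐ ω ∂μ, (∃ l, Tendsto (fun k => w k * ‖q k ω‖ ^ 2) atTop (𝓝 l)) ∧
      Summable fun k => τ k * (w k * ‖q k ω‖ ^ 2) := by
  have hqm : ∀ k, StronglyMeasurable[ℱ k] (q k) ∧ MemLp (q k) 2 μ := by
    intro k
    induction k with
    | zero => exact ⟨hq0, hq02⟩
    | succ k ih =>
      have : q (k + 1) = fun ω => ρ k • q k ω + s k • e k ω := funext (hq k)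
      rw [this]
      exact ⟨((ih.1.mono (ℱ.mono k.le_succ)).const_smul _).add ((hem k).const_smul _),
        (ih.2.const_smul _).add ((he2 k).const_smul _)⟩
  have hqi : ∀ k, Integrable (fun ω => ‖q k ω‖ ^ 2) μ :=
    fun k => (hqm k).2.integrable_norm_pow two_ne_zero
  set c : ℕ → ℝ := fun k => w (k + 1) * s k ^ 2 * σ ^ 2 with hcdef
  have hc0 : ∀ k, 0 ≤ c k := fun k => by have := hw (k + 1); positivity
  have hcs : Summable c := hsum.mul_right _
  -- The weighted square, plus the contraction already spent, plus the noise budget still to come.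
  -- The last term keeps `W` nonnegative and turns the perturbed contraction into an exact
  -- supermartingale inequality.
  set W : ℕ → Ω → ℝ := fun k ω => w k * ‖q k ω‖ ^ 2 +
    ∑ i ∈ Finset.range k, τ i * (w i * ‖q i ω‖ ^ 2) + (∑' i, c i - ∑ i ∈ Finset.range k, c i)
    with hW
  have hterm : ∀ i ω, 0 ≤ τ i * (w i * ‖q i ω‖ ^ 2) := fun i ω => by
    have := hw i; have := hτ i; positivity
  have hW0 : ∀ k ω, 0 ≤ W k ω := fun k ω => by
    have h1 := hcs.sum_le_tsum (Finset.range k) fun i _ => hc0 i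
    have h2 : 0 ≤ ∑ i ∈ Finset.range k, τ i * (w i * ‖q i ω‖ ^ 2) :=
      Finset.sum_nonneg fun i _ => hterm i ω
    have h3 := hw k
    have h4 : 0 ≤ w k * ‖q k ω‖ ^ 2 := by positivity
    simp only [hW]; linarith
  have hWi : ∀ k, Integrable (W k) μ := fun k =>
    (((hqi k).const_mul _).add (integrable_finsetSum _ fun i _ =>
      ((hqi i).const_mul _).const_mul _)).add (integrable_const _)
  have hnm : ∀ i k, i ≤ k → StronglyMeasurable[ℱ k] (fun ω => w i * ‖q i ω‖ ^ 2) := fun i k h =>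
    ((((hqm i).1.mono (ℱ.mono h)).norm.pow 2).const_mul _)
  have hWm : ∀ k, StronglyMeasurable[ℱ k] (W k) := fun k =>
    ((hnm k k le_rfl).add (Finset.stronglyMeasurable_fun_sum _ fun i hi =>
      (hnm i k (Finset.mem_range.1 hi).le).const_mul _)).add stronglyMeasurable_const
  have hsuper : Supermartingale W ℱ μ := by
    refine supermartingale_nat hWm hWi fun k => ?_
    set V : Ω → ℝ := fun ω => ∑ i ∈ Finset.range (k + 1), τ i * (w i * ‖q i ω‖ ^ 2) +
      (∑' i, c i - ∑ i ∈ Finset.range (k + 1), c i) with hV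
    have hVm : StronglyMeasurable[ℱ k] V :=
      (Finset.stronglyMeasurable_fun_sum _ fun i hi =>
        (hnm i k (Nat.lt_succ_iff.1 (Finset.mem_range.1 hi))).const_mul _).add
        stronglyMeasurable_const
    have hVi : Integrable V μ := (integrable_finsetSum _ fun i _ =>
      ((hqi i).const_mul _).const_mul _).add (integrable_const _)
    have hsplit : W (k + 1) = (w (k + 1)) • (fun ω => ‖q (k + 1) ω‖ ^ 2) + V := by
      ext ω; simp only [hW, hV, Pi.add_apply, Pi.smul_apply, smul_eq_mul]; ring
    have hqk : (fun ω => ‖q (k + 1) ω‖ ^ 2) = fun ω => ‖ρ k • q k ω + s k • e k ω‖ ^ 2 := by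
      ext ω; rw [hq]
    have h1 := condExp_add (m := ℱ k) ((hqi (k + 1)).smul (w (k + 1))) hVi
    have h2 := condExp_smul (μ := μ) (w (k + 1)) (fun ω => ‖q (k + 1) ω‖ ^ 2) (ℱ k)
    have h3 := condExp_of_stronglyMeasurable (ℱ.le k) hVm hVi
    have h4 := condExp_norm_sq_affine_le (μ := μ) (ρ := ρ k) (s := s k) (ℱ.le k) (hqm k).1
      (hqm k).2 (he2 k) (hc k) (hv k)
    rw [← hqk] at h4
    rw [hsplit]
    filter_upwards [h1, h2, h4] with ω a1 a2 a4
    rw [a1, Pi.add_apply, a2, h3, Pi.smul_apply, smul_eq_mul]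
    have h5 := mul_le_mul_of_nonneg_left a4 (hw (k + 1))
    have h6 := mul_le_mul_of_nonneg_right (hwρ k) (sq_nonneg ‖q k ω‖)
    simp only [hV, hW, Finset.sum_range_succ, hcdef] at *
    nlinarith
  have hbdd : ∀ k, eLpNorm ((-W) k) 1 μ ≤ (Real.toNNReal (∫ ω, W 0 ω ∂μ) : ℝ≥0∞) := by
    intro k
    rw [Pi.neg_apply, eLpNorm_neg, eLpNorm_one_eq_lintegral_enorm,
      ← ofReal_integral_norm_eq_lintegral_enorm (hWi k)]
    refine ENNReal.ofReal_le_ofReal ?_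
    have h1 : ∫ ω, ‖W k ω‖ ∂μ = ∫ ω, W k ω ∂μ :=
      integral_congr_ae (ae_of_all _ fun ω => by simp [abs_of_nonneg (hW0 k ω)])
    rw [h1]
    simpa using hsuper.setIntegral_le (Nat.zero_le k) MeasurableSet.univ
  have hconv := hsuper.neg.exists_ae_tendsto_of_bdd hbdd
  filter_upwards [hconv] with ω hω
  obtain ⟨l, hl⟩ := hω
  have hl' : Tendsto (fun k => W k ω) atTop (𝓝 (-l)) := by
    simpa using hl.neg
  have hS : Summable fun k => τ k * (w k * ‖q k ω‖ ^ 2) := by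
    obtain ⟨B, hB⟩ := hl'.bddAbove_range
    refine summable_of_sum_range_le (c := B) (fun i => hterm i ω) fun k => ?_
    refine le_trans ?_ (hB ⟨k, rfl⟩)
    have h1 := hcs.sum_le_tsum (Finset.range k) fun i _ => hc0 i
    have h3 := hw k
    have h4 : 0 ≤ w k * ‖q k ω‖ ^ 2 := by positivity
    simp only [hW]; linarith
  -- All three parts of `W` except the weighted square converge, hence so does the latter.
  have h1 := (hl'.sub hS.hasSum.tendsto_sum_nat).sub
    (hcs.hasSum.tendsto_sum_nat.const_sub (∑' i, c i))
  refine ⟨⟨_, h1.congr fun k => ?_⟩, hS⟩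
  simp only [hW]; ring

end Noise


/-! ### Admissible weights: powers of k, and k divided by a power of log k. -/

/-- Weight sequences whose reciprocals are admissible rates for noise of step size `k ^ (-γ)`. -/
structure IsWeight (γ : ℝ) (w : ℕ → ℝ) : Prop where
  nonneg : ∀ k, 0 ≤ w k
  pos : ∀ᶠ k in atTop, 0 < w k
  mono : ∀ᶠ k in atTop, w k ≤ w (k + 1)
  growth : ∀ᶠ k : ℕ in atTop, w (k + 1) ≤ (1 + 1 / (k : ℝ)) * w k
  summable : Summable fun k : ℕ => w k / (k : ℝ) ^ (2 * γ)

lemma isWeight_rpow {γ r : ℝ} (hγ1 : γ ≤ 1) (hr0 : 0 ≤ r) (hr : r < 2 * γ - 1) :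
    IsWeight γ fun k : ℕ => (k : ℝ) ^ r where
  nonneg k := by positivity
  pos := by
    filter_upwards [eventually_ge_atTop 1] with k hk
    have : (0 : ℝ) < k := by exact_mod_cast hk
    positivity
  mono := by
    filter_upwards with k
    exact Real.rpow_le_rpow (by positivity) (by push_cast; linarith) hr0
  growth := by
    filter_upwards [eventually_ge_atTop 1] with k hk
    have hk0 : (0 : ℝ) < k := by exact_mod_cast hk
    have h1 : ((k + 1 : ℕ) : ℝ) = (1 + 1 / (k : ℝ)) * k := by push_cast; field_simp
    rw [h1, Real.mul_rpow (by positivity) hk0.le]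
    gcongr
    calc (1 + 1 / (k : ℝ)) ^ r ≤ (1 + 1 / (k : ℝ)) ^ (1 : ℝ) :=
          Real.rpow_le_rpow_of_exponent_le (by simp) (by linarith)
      _ = _ := Real.rpow_one _
  summable := by
    have h : Summable fun k : ℕ => (k : ℝ) ^ (r - 2 * γ) :=
      Real.summable_nat_rpow.2 (by linarith)
    refine h.of_norm_bounded_eventually_nat ?_
    filter_upwards [eventually_ge_atTop 1] with k hk
    have hk0 : (0 : ℝ) < k := by exact_mod_cast hk
    rw [Real.rpow_sub hk0, Real.norm_of_nonneg (by positivity)]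

/-- Cauchy condensation: multiplied by 2^k, the term of index 2^k is a constant times k^{-(1+ε)}. -/
lemma summable_inv_mul_log_rpow {ε : ℝ} (hε : 0 < ε) :
    Summable fun k : ℕ => ((k : ℝ) * Real.log k ^ (1 + ε))⁻¹ := by
  rw [← summable_condensed_iff_of_eventually_nonneg]
  · have h : Summable fun k : ℕ => (Real.log 2 ^ (1 + ε))⁻¹ * ((k : ℝ) ^ (1 + ε))⁻¹ :=
      (Real.summable_nat_rpow_inv.2 (by linarith)).mul_left _
    refine h.congr fun k => ?_
    have hl : (0 : ℝ) ≤ Real.log 2 := Real.log_nonneg (by norm_num)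
    push_cast
    rw [Real.log_pow, Real.mul_rpow (by positivity) hl]
    field_simp
  · filter_upwards [eventually_ge_atTop 1] with k hk
    have : 0 ≤ Real.log k := Real.log_natCast_nonneg k
    simp only [Pi.zero_apply]; positivity
  · filter_upwards [eventually_ge_atTop 2] with k hk
    have hk2 : (2 : ℝ) ≤ k := by exact_mod_cast hk
    have hl : 0 < Real.log k := Real.log_pos (by linarith)
    refine inv_anti₀ (by positivity) ?_
    have := Real.log_le_log (by linarith) (show (k : ℝ) ≤ (k + 1 : ℕ) by push_cast; linarith)
    gcongr
    simp

/-- For γ = 1 the weight k itself just fails the summability condition; the logarithm repairs it and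
costs monotonicity only for small k. -/
lemma isWeight_log {ε : ℝ} (hε : 0 < ε) :
    IsWeight 1 fun k : ℕ => (k : ℝ) / Real.log k ^ (1 + ε) where
  nonneg k := by
    have := Real.log_natCast_nonneg k
    positivity
  pos := by
    filter_upwards [eventually_ge_atTop 2] with k hk
    have hk2 : (2 : ℝ) ≤ k := by exact_mod_cast hk
    have hl : 0 < Real.log k := Real.log_pos (by linarith)
    positivity
  mono := by
    have h1 : ∀ᶠ k : ℕ in atTop, 2 * (1 + ε) ≤ Real.log k :=
      (Real.tendsto_log_atTop.comp tendsto_natCast_atTop_atTop).eventually_ge_atTop _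
    filter_upwards [h1, eventually_ge_atTop 2] with k hl hk
    have hk2 : (2 : ℝ) ≤ k := by exact_mod_cast hk
    have hl0 : 0 < Real.log k := by linarith
    have hlog : Real.log (k + 1 : ℕ) ≤ Real.log k + 1 / k := by
      have h2 : ((k + 1 : ℕ) : ℝ) = k * (1 + 1 / k) := by push_cast; field_simp
      rw [h2, Real.log_mul (by positivity) (by positivity)]
      have := Real.log_le_sub_one_of_pos (show 0 < 1 + 1 / (k : ℝ) by positivity)
      linarith
    have hlog' : Real.log k ≤ Real.log (k + 1 : ℕ) :=
      Real.log_le_log (by linarith) (by push_cast; linarith)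
    rw [div_le_div_iff₀ (by positivity) (by have := hl0.trans_le hlog'; positivity)]
    -- The relative increment of log k is at most t, so monotonicity reduces to (1+t)^{1+ε} ≤ 1 +
    -- 1/k. This holds once log k ≥ 2(1+ε), since then t(1+ε) ≤ 1/(2k).
    set t : ℝ := 1 / (k * Real.log k) with ht
    have ht0 : 0 ≤ t := by positivity
    have hmul : Real.log k + 1 / k = Real.log k * (1 + t) := by rw [ht]; field_simp
    have hb : (1 + t) ^ (1 + ε) ≤ 1 + 1 / k := by
      have h3 : (1 + t) ^ (1 + ε) ≤ Real.exp (t * (1 + ε)) := by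
        rw [Real.exp_mul]
        refine Real.rpow_le_rpow (by positivity) ?_ (by linarith)
        linarith [Real.add_one_le_exp t]
      have h4 : t * (1 + ε) ≤ 1 / (2 * k) := by
        rw [ht, div_mul_eq_mul_div, one_mul, div_le_div_iff₀ (by positivity) (by positivity)]
        nlinarith
      have h5 : Real.exp (1 / (2 * (k : ℝ))) ≤ 1 + 1 / k := by
        have h6 : (0 : ℝ) ≤ 1 / (2 * k) := by positivity
        have h7 : 1 / (2 * (k : ℝ)) ≤ 1 / 2 := by
          rw [div_le_div_iff₀ (by positivity) (by positivity)]; linarith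
        have h8 := Real.exp_bound_div_one_sub_of_interval h6 (by linarith)
        refine h8.trans ?_
        have h9 : (1 : ℝ) / k = 2 * (1 / (2 * k)) := by field_simp
        rw [h9, div_le_iff₀ (by linarith)]
        nlinarith
      exact h3.trans ((Real.exp_le_exp.2 h4).trans h5)
    calc (k : ℝ) * Real.log (k + 1 : ℕ) ^ (1 + ε)
        ≤ k * (Real.log k * (1 + t)) ^ (1 + ε) := by
          rw [← hmul]; gcongr
      _ = k * (1 + t) ^ (1 + ε) * Real.log k ^ (1 + ε) := by
          rw [Real.mul_rpow hl0.le (by positivity)]; ring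
      _ ≤ k * (1 + 1 / k) * Real.log k ^ (1 + ε) := by gcongr
      _ = (k + 1 : ℕ) * Real.log k ^ (1 + ε) := by push_cast; field_simp
  growth := by
    filter_upwards [eventually_ge_atTop 2] with k hk
    have hk2 : (2 : ℝ) ≤ k := by exact_mod_cast hk
    have hl0 : 0 < Real.log k := Real.log_pos (by linarith)
    have hlog' : Real.log k ≤ Real.log (k + 1 : ℕ) :=
      Real.log_le_log (by linarith) (by push_cast; linarith)
    have h1 : (1 + 1 / (k : ℝ)) * ((k : ℝ) / Real.log k ^ (1 + ε)) =
        (k + 1 : ℕ) / Real.log k ^ (1 + ε) := by push_cast; field_simp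
    rw [h1]
    gcongr
  summable := by
    refine (summable_inv_mul_log_rpow hε).congr fun k => ?_
    rcases eq_or_ne (k : ℝ) 0 with hk | hk
    · simp [hk]
    · have : (k : ℝ) ^ (2 * (1 : ℝ)) = (k : ℝ) ^ 2 := by norm_num
      rw [this, mul_inv]; field_simp


/-! ### Almost sure decay of leaky sums of noise. -/

/-- `η` decays at rate `1 / w`, pointwise and in the sense of a weighted series with steps `τ`. -/
def NoiseDecay (τ w η : ℕ → ℝ) : Prop :=
  Tendsto (fun k => w k * η k) atTop (𝓝 0) ∧ Summable fun k => τ k * (w k * η k)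

lemma NoiseDecay.add {τ w η ξ : ℕ → ℝ} (h : NoiseDecay τ w η) (h' : NoiseDecay τ w ξ) :
    NoiseDecay τ w fun k => η k + ξ k := by
  refine ⟨?_, ?_⟩
  · simpa [mul_add] using h.1.add h'.1
  · simpa [mul_add] using h.2.add h'.2

lemma NoiseDecay.of_eventually_le {τ w w' η : ℕ → ℝ} (hτ : ∀ k, 0 ≤ τ k) (hη : ∀ k, 0 ≤ η k)
    (hw' : ∀ k, 0 ≤ w' k) (hww' : ∀ᶠ k in atTop, w' k ≤ w k) (h : NoiseDecay τ w η) :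
    NoiseDecay τ w' η := by
  refine ⟨squeeze_zero' ?_ ?_ h.1, h.2.of_norm_bounded_eventually_nat ?_⟩
  · exact Eventually.of_forall fun k => mul_nonneg (hw' k) (hη k)
  · filter_upwards [hww'] with k hk using mul_le_mul_of_nonneg_right hk (hη k)
  · filter_upwards [hww'] with k hk
    rw [Real.norm_of_nonneg (mul_nonneg (hτ k) (mul_nonneg (hw' k) (hη k)))]
    exact mul_le_mul_of_nonneg_left (mul_le_mul_of_nonneg_right hk (hη k)) (hτ k)

/-- A nonnegative convergent sequence that is summable against a divergent series tends to `0`. -/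
lemma tendsto_zero_of_summable_mul {τ v : ℕ → ℝ} {l : ℝ} (hτ0 : ∀ k, 0 ≤ τ k)
    (hτ : ¬ Summable τ) (hv : ∀ k, 0 ≤ v k) (hl : Tendsto v atTop (𝓝 l))
    (hs : Summable fun k => τ k * v k) : Tendsto v atTop (𝓝 0) := by
  have hl0 : 0 ≤ l := ge_of_tendsto' hl hv
  rcases hl0.eq_or_lt with h | h
  · rwa [h]
  · exfalso
    refine hτ ((hs.mul_left (2 / l)).of_norm_bounded_eventually_nat ?_)
    filter_upwards [hl.eventually_const_le (show l / 2 < l by linarith)] with k hk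
    rw [Real.norm_of_nonneg (hτ0 k)]
    calc τ k = 2 / l * (τ k * (l / 2)) := by field_simp
      _ ≤ _ := mul_le_mul_of_nonneg_left (mul_le_mul_of_nonneg_left hk (hτ0 k)) (by positivity)

section Noise

variable {Ω E : Type*} {mΩ : MeasurableSpace Ω} [NormedAddCommGroup E] [InnerProductSpace ℝ E]

/-- Martingale differences of bounded conditional variance. -/
structure IsNoise (ℱ : Filtration ℕ mΩ) (μ : Measure Ω) (e : ℕ → Ω → E) (σ : ℝ) : Prop where
  stronglyMeasurable : ∀ k, StronglyMeasurable[ℱ (k + 1)] (e k)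
  memLp : ∀ k, MemLp (e k) 2 μ
  condExp_zero : ∀ k, μ[e k | ℱ k] =ᵐ[μ] 0
  condVar_le : ∀ k, μ[fun ω => ‖e k ω‖ ^ 2 | ℱ k] ≤ᵐ[μ] fun _ => σ ^ 2

lemma IsNoise.adapted_memLp {μ : Measure Ω} {ℱ : Filtration ℕ mΩ} {e q : ℕ → Ω → E} {σ : ℝ}
    {ρ s : ℕ → ℝ} (he : IsNoise ℱ μ e σ) (hq0 : ∀ ω, q 0 ω = 0)
    (hq : ∀ k ω, q (k + 1) ω = ρ k • q k ω + s k • e k ω) (k : ℕ) :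
    StronglyMeasurable[ℱ k] (q k) ∧ MemLp (q k) 2 μ := by
  induction k with
  | zero =>
    have : q 0 = fun _ => 0 := funext hq0
    rw [this]
    exact ⟨stronglyMeasurable_const, MemLp.zero'⟩
  | succ k ih =>
    have : q (k + 1) = fun ω => ρ k • q k ω + s k • e k ω := funext (hq k)
    rw [this]
    exact ⟨((ih.1.mono (ℱ.mono k.le_succ)).const_smul _).add
      ((he.stronglyMeasurable k).const_smul _), (ih.2.const_smul _).add ((he.memLp k).const_smul _)⟩

/-- The factor 1 + 1/k in the contraction hypothesis pays for the growth of the weight. The weighted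
squares then converge almost surely, and since they are summable against the divergent series of
`τ`, the limit is zero. -/
theorem ae_noiseDecay {μ : Measure Ω} [IsProbabilityMeasure μ] [CompleteSpace E]
    {ℱ : Filtration ℕ mΩ} {e q : ℕ → Ω → E} {σ γ S : ℝ} {ρ s τ w : ℕ → ℝ}
    (he : IsNoise ℱ μ e σ) (hq0 : ∀ ω, q 0 ω = 0)
    (hq : ∀ k ω, q (k + 1) ω = ρ k • q k ω + s k • e k ω)
    (hs : ∀ᶠ k : ℕ in atTop, |s k| ≤ S / (k : ℝ) ^ γ)
    (hτ0 : ∀ k, 0 ≤ τ k) (hτ : ¬ Summable τ)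
    (hρ : ∀ᶠ k : ℕ in atTop, (1 + 1 / (k : ℝ)) * ρ k ^ 2 ≤ 1 - τ k) (hw : IsWeight γ w) :
    ∀ᵐ ω ∂μ, NoiseDecay τ w fun k => ‖q k ω‖ ^ 2 := by
  obtain ⟨K, hK⟩ := eventually_atTop.1 (hρ.and hw.growth)
  -- Contraction and growth hold only from some index `K` on, so time is shifted by `K`; the shifted
  -- process may start from a nonzero random vector.
  let ℱ' : Filtration ℕ mΩ :=
    ⟨fun k => ℱ (k + K), fun i j h => ℱ.mono (Nat.add_le_add_right h K), fun k => ℱ.le _⟩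
  have hstep : ∀ k, w (k + 1 + K) * ρ (k + K) ^ 2 ≤ (1 - τ (k + K)) * w (k + K) := by
    intro k
    obtain ⟨h1, h2⟩ := hK (k + K) (Nat.le_add_left _ _)
    have h3 := hw.nonneg (k + K)
    have h4 : k + 1 + K = k + K + 1 := by ring
    rw [h4]
    calc w (k + K + 1) * ρ (k + K) ^ 2
        ≤ ((1 + 1 / ((k + K : ℕ) : ℝ)) * w (k + K)) * ρ (k + K) ^ 2 := by gcongr
      _ = ((1 + 1 / ((k + K : ℕ) : ℝ)) * ρ (k + K) ^ 2) * w (k + K) := by ring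
      _ ≤ _ := by gcongr
  have hsum : Summable fun k => w (k + 1) * s k ^ 2 := by
    refine (hw.summable.mul_left (2 * S ^ 2)).of_norm_bounded_eventually_nat ?_
    filter_upwards [hs, hw.growth, eventually_ge_atTop 1] with k h1 h2 hk
    have hk1 : (1 : ℝ) ≤ k := by exact_mod_cast hk
    have h3 := hw.nonneg k
    rw [Real.norm_of_nonneg (mul_nonneg (hw.nonneg _) (sq_nonneg _))]
    have h4 : s k ^ 2 ≤ S ^ 2 / (k : ℝ) ^ (2 * γ) := by
      rw [← sq_abs, mul_comm 2 γ, Real.rpow_mul (by positivity), Real.rpow_two, ← div_pow]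
      gcongr
    have h5 : w (k + 1) ≤ 2 * w k := by
      refine h2.trans ?_
      gcongr
      have : 1 / (k : ℝ) ≤ 1 := by rw [div_le_one (by linarith)]; exact hk1
      linarith
    calc w (k + 1) * s k ^ 2 ≤ (2 * w k) * (S ^ 2 / (k : ℝ) ^ (2 * γ)) := by gcongr
      _ = _ := by ring
  have hcongr : ∀ k, k + 1 + K = k + K + 1 := fun k => by ring
  have main := ae_tendsto_weight_mul_norm_sq (μ := μ) (ℱ := ℱ') (q := fun k => q (k + K))
    (e := fun k => e (k + K)) (ρ := fun k => ρ (k + K)) (s := fun k => s (k + K))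
    (w := fun k => w (k + K)) (τ := fun k => τ (k + K)) (σ := σ)
    (by simpa [ℱ'] using (he.adapted_memLp hq0 hq (0 + K)).1)
    (he.adapted_memLp hq0 hq (0 + K)).2
    (fun k ω => by simp only [hcongr]; exact hq (k + K) ω)
    (fun k => by
      have := he.stronglyMeasurable (k + K)
      rw [← hcongr k] at this
      exact this)
    (fun k => he.memLp _) (fun k => he.condExp_zero _) (fun k => he.condVar_le _)
    (fun k => hw.nonneg _) (fun k => hτ0 _) hstep
    (by simpa only [hcongr] using (summable_nat_add_iff K).2 hsum)
  filter_upwards [main] with ω hω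
  obtain ⟨⟨l, hl⟩, hS⟩ := hω
  have hl' := (tendsto_add_atTop_iff_nat (f := fun k => w k * ‖q k ω‖ ^ 2) K).1 hl
  have hS' := (summable_nat_add_iff (f := fun k => τ k * (w k * ‖q k ω‖ ^ 2)) K).1 hS
  exact ⟨tendsto_zero_of_summable_mul hτ0 hτ
    (fun k => mul_nonneg (hw.nonneg k) (sq_nonneg _)) hl' hS', hS'⟩

/-- All rates at which the noise of an SGD method with step sizes of order `k ^ (-γ)` decays. -/
structure NoiseRates (γ : ℝ) (τ η : ℕ → ℝ) : Prop where
  rpow : ∀ r : ℝ, r < 2 * γ - 1 → NoiseDecay τ (fun k : ℕ => (k : ℝ) ^ r) η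
  log : γ = 1 → ∀ ε : ℝ, 0 < ε →
    NoiseDecay τ (fun k : ℕ => (k : ℝ) / Real.log k ^ (1 + ε)) η

lemma NoiseRates.add {γ : ℝ} {τ η ξ : ℕ → ℝ} (h : NoiseRates γ τ η) (h' : NoiseRates γ τ ξ) :
    NoiseRates γ τ fun k => η k + ξ k :=
  ⟨fun r hr => (h.rpow r hr).add (h'.rpow r hr), fun h1 ε hε => (h.log h1 ε hε).add (h'.log h1 ε hε)⟩

theorem ae_noiseRates {μ : Measure Ω} [IsProbabilityMeasure μ] [CompleteSpace E]
    {ℱ : Filtration ℕ mΩ} {e q : ℕ → Ω → E} {σ γ S : ℝ} {ρ s τ : ℕ → ℝ}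
    (hγ : 1 / 2 < γ) (hγ1 : γ ≤ 1) (he : IsNoise ℱ μ e σ) (hq0 : ∀ ω, q 0 ω = 0)
    (hq : ∀ k ω, q (k + 1) ω = ρ k • q k ω + s k • e k ω)
    (hs : ∀ᶠ k : ℕ in atTop, |s k| ≤ S / (k : ℝ) ^ γ)
    (hτ0 : ∀ k, 0 ≤ τ k) (hτ : ¬ Summable τ)
    (hρ : ∀ᶠ k : ℕ in atTop, (1 + 1 / (k : ℝ)) * ρ k ^ 2 ≤ 1 - τ k) :
    ∀ᵐ ω ∂μ, NoiseRates γ τ fun k => ‖q k ω‖ ^ 2 := by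
  have h1 : ∀ᵐ ω ∂μ, ∀ r : ℚ, 0 ≤ (r : ℝ) → (r : ℝ) < 2 * γ - 1 →
      NoiseDecay τ (fun k : ℕ => (k : ℝ) ^ (r : ℝ)) fun k => ‖q k ω‖ ^ 2 := by
    refine ae_all_iff.2 fun r => ?_
    by_cases hr : 0 ≤ (r : ℝ) ∧ (r : ℝ) < 2 * γ - 1
    · filter_upwards [ae_noiseDecay he hq0 hq hs hτ0 hτ hρ (isWeight_rpow hγ1 hr.1 hr.2)] with ω hω
      exact fun _ _ => hω
    · exact ae_of_all _ fun ω h0 h1 => (hr ⟨h0, h1⟩).elim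
  have h2 : ∀ᵐ ω ∂μ, ∀ r : ℚ, γ = 1 → 0 < (r : ℝ) →
      NoiseDecay τ (fun k : ℕ => (k : ℝ) / Real.log k ^ (1 + (r : ℝ))) fun k => ‖q k ω‖ ^ 2 := by
    refine ae_all_iff.2 fun r => ?_
    by_cases hr : γ = 1 ∧ 0 < (r : ℝ)
    · have hw : IsWeight γ fun k : ℕ => (k : ℝ) / Real.log k ^ (1 + (r : ℝ)) := by
        rw [hr.1]; exact isWeight_log hr.2
      filter_upwards [ae_noiseDecay he hq0 hq hs hτ0 hτ hρ hw] with ω hω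
      exact fun _ _ => hω
    · exact ae_of_all _ fun ω h0 h1 => (hr ⟨h0, h1⟩).elim
  filter_upwards [h1, h2] with ω hω1 hω2
  refine ⟨fun r hr => ?_, fun hγ' ε hε => ?_⟩
  -- Countably many rational exponents share one null set; any real exponent, negative ones
  -- included, is dominated by a rational one that is still admissible.
  · obtain ⟨r', h3, h4⟩ := exists_rat_btwn (max_lt hr (show (0 : ℝ) < 2 * γ - 1 by linarith))
    obtain ⟨h5, h6⟩ := max_lt_iff.1 h3
    refine (hω1 r' h6.le h4).of_eventually_le hτ0 (fun k => sq_nonneg _) (fun k => by positivity) ?_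
    filter_upwards [eventually_ge_atTop 1] with k hk
    exact Real.rpow_le_rpow_of_exponent_le (by exact_mod_cast hk) h5.le
  · obtain ⟨r', h3, h4⟩ := exists_rat_btwn hε
    refine (hω2 r' hγ' h3).of_eventually_le hτ0 (fun k => sq_nonneg _)
      (fun k => by have := Real.log_natCast_nonneg k; positivity) ?_
    have h5 : ∀ᶠ k : ℕ in atTop, 1 ≤ Real.log k :=
      (Real.tendsto_log_atTop.comp tendsto_natCast_atTop_atTop).eventually_ge_atTop _
    filter_upwards [h5] with k hk
    have : 0 < Real.log k := by linarith
    refine div_le_div_of_nonneg_left (by positivity) (by positivity) ?_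
    exact Real.rpow_le_rpow_of_exponent_le hk (by linarith)

end Noise


/-! ### Tails of series and eventually monotone sequences. -/

section Series

/-- The tail of a series. -/
def tailSum (s : ℕ → ℝ) (k : ℕ) : ℝ := ∑' i, s (i + k)

lemma tailSum_nonneg {s : ℕ → ℝ} (hs : ∀ k, 0 ≤ s k) (k : ℕ) : 0 ≤ tailSum s k :=
  tsum_nonneg fun _ => hs _

lemma tailSum_eq_add {s : ℕ → ℝ} (hs : Summable s) (k : ℕ) :
    tailSum s k = s k + tailSum s (k + 1) := by
  have h := ((summable_nat_add_iff k).2 hs).tsum_eq_zero_add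
  simp only [tailSum, h, zero_add]
  congr 1
  exact tsum_congr fun i => by congr 1; ring

lemma tendsto_tailSum (s : ℕ → ℝ) : Tendsto (tailSum s) atTop (𝓝 0) :=
  tendsto_sum_nat_add s

lemma le_of_eventually_mono {w : ℕ → ℝ} {N : ℕ} (h : ∀ k ≥ N, w k ≤ w (k + 1)) {i j : ℕ}
    (hi : N ≤ i) (hij : i ≤ j) : w i ≤ w j := by
  induction j, hij using Nat.le_induction with
  | base => exact le_rfl
  | succ j hj ih => exact ih.trans (h j (hi.trans hj))

lemma le_of_eventually_anti {w : ℕ → ℝ} {N : ℕ} (h : ∀ k ≥ N, w (k + 1) ≤ w k) {i j : ℕ}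
    (hi : N ≤ i) (hij : i ≤ j) : w j ≤ w i := by
  induction j, hij using Nat.le_induction with
  | base => exact le_rfl
  | succ j hj ih => exact (h j (hi.trans hj)).trans ih

/-- An eventually nondecreasing weight can be moved inside the tail, so a weighted summability gives
a rate for the tails. -/
lemma weight_mul_tailSum_le {s w : ℕ → ℝ} (hs0 : ∀ k, 0 ≤ s k) (hw0 : ∀ k, 0 ≤ w k)
    (hw : ∀ᶠ k in atTop, w k ≤ w (k + 1)) (hs : Summable s)
    (hws : Summable fun k => w k * s k) :
    ∀ᶠ k in atTop, w k * tailSum s k ≤ ∑' i, w i * s i := by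
  obtain ⟨N, hN⟩ := eventually_atTop.1 hw
  filter_upwards [eventually_ge_atTop N] with k hk
  have h0 : ∀ i, 0 ≤ w i * s i := fun i => mul_nonneg (hw0 i) (hs0 i)
  have h1 := (summable_nat_add_iff k).2 hws
  have h2 : ∑' i, w (i + k) * s (i + k) ≤ ∑' i, w i * s i := by
    rw [← hws.sum_add_tsum_nat_add k]
    exact le_add_of_nonneg_left (Finset.sum_nonneg fun i _ => h0 i)
  refine le_trans ?_ h2
  rw [tailSum, ← tsum_mul_left]
  refine Summable.tsum_le_tsum (fun i => ?_) (((summable_nat_add_iff k).2 hs).mul_left _) h1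
  exact mul_le_mul_of_nonneg_right (le_of_eventually_mono hN hk (Nat.le_add_left _ _)) (hs0 _)

/-- An eventually antitone sequence that is bounded below converges, to a lower bound. -/
lemma exists_tendsto_of_eventually_anti {v : ℕ → ℝ} {N : ℕ} {B : ℝ}
    (h : ∀ k ≥ N, v (k + 1) ≤ v k) (hB : ∀ k ≥ N, B ≤ v k) :
    ∃ l, Tendsto v atTop (𝓝 l) ∧ ∀ k ≥ N, l ≤ v k := by
  have hanti : Antitone fun k => v (k + N) := antitone_nat_of_succ_le fun k => by
    have := h (k + N) (Nat.le_add_left _ _)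
    rwa [show k + 1 + N = k + N + 1 by ring]
  have hbdd : BddBelow (Set.range fun k => v (k + N)) :=
    ⟨B, by rintro _ ⟨k, rfl⟩; exact hB _ (Nat.le_add_left _ _)⟩
  refine ⟨_, (tendsto_add_atTop_iff_nat N).1 (tendsto_atTop_ciInf hanti hbdd), fun k hk => ?_⟩
  obtain ⟨j, rfl⟩ := Nat.exists_eq_add_of_le' hk
  exact ciInf_le hbdd j

/-- A nonnegative sequence with summable upward increments that is summable against a divergent
series tends to zero. -/
lemma tendsto_zero_of_le_add {τ v s : ℕ → ℝ} (hτ0 : ∀ k, 0 ≤ τ k) (hτ : ¬ Summable τ)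
    (hv : ∀ k, 0 ≤ v k) (hs0 : ∀ k, 0 ≤ s k) (hs : Summable s)
    (hvs : ∀ᶠ k in atTop, v (k + 1) ≤ v k + s k) (hsum : Summable fun k => τ k * v k) :
    Tendsto v atTop (𝓝 0) := by
  obtain ⟨N, hN⟩ := eventually_atTop.1 hvs
  -- Adding the tail of the upward increments makes `v` eventually nonincreasing.
  obtain ⟨l, hl, -⟩ := exists_tendsto_of_eventually_anti (v := fun k => v k + tailSum s k) (N := N)
    (B := 0) (fun k hk => by
      have h1 := hN k hk
      have h2 := tailSum_eq_add hs k
      linarith)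
    (fun k _ => add_nonneg (hv k) (tailSum_nonneg hs0 k))
  have h1 : Tendsto v atTop (𝓝 (l - 0)) := by
    refine (hl.sub (tendsto_tailSum s)).congr fun k => by ring
  exact tendsto_zero_of_summable_mul hτ0 hτ hv h1 hsum

lemma summable_of_add_le {v s : ℕ → ℝ} (hs0 : ∀ k, 0 ≤ s k) (hv : ∀ᶠ k in atTop, 0 ≤ v k)
    (h : ∀ᶠ k in atTop, v (k + 1) + s k ≤ v k) : Summable s := by
  obtain ⟨N, hN⟩ := eventually_atTop.1 (hv.and h)
  rw [← summable_nat_add_iff N]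
  refine summable_of_sum_range_le (c := v N) (fun i => hs0 _) fun n => ?_
  have h1 : ∑ i ∈ Finset.range n, s (i + N) ≤ v N - v (n + N) := by
    induction n with
    | zero => simp
    | succ n ih =>
      rw [Finset.sum_range_succ]
      have := (hN (n + N) (Nat.le_add_left _ _)).2
      rw [show n + 1 + N = n + N + 1 by ring]
      linarith
  linarith [(hN (n + N) (Nat.le_add_left _ _)).1]

end Series

/-! ### Trapping near a cluster point. -/

section Trap

variable {E : Type*} [NormedAddCommGroup E]

lemma norm_sub_le_of_telescope {y : ℕ → E} {φ : ℕ → ℝ} {n k : ℕ} (hnk : n ≤ k)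
    (h : ∀ i, n ≤ i → i < k → ‖y (i + 1) - y i‖ ≤ φ i - φ (i + 1)) :
    ‖y k - y n‖ ≤ φ n - φ k := by
  induction k, hnk using Nat.le_induction with
  | base => simp
  | succ k hk ih =>
    have h1 := ih fun i hi hik => h i hi (hik.trans k.lt_succ_self)
    have h2 := h k hk k.lt_succ_self
    calc ‖y (k + 1) - y n‖ = ‖(y (k + 1) - y k) + (y k - y n)‖ := by congr 1; abel
      _ ≤ _ := (norm_add_le _ _).trans (by linarith)

/-- A sequence whose steps near a cluster point are controlled by a telescoping potential
converges to that cluster point. -/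
lemma tendsto_of_telescope_near {y : ℕ → E} {p : E} {φ : ℕ → ℝ} {R : ℝ} (hR : 0 < R)
    (hφ0 : ∀ᶠ k in atTop, 0 ≤ φ k) (hφ : Tendsto φ atTop (𝓝 0)) (hp : MapClusterPt p atTop y)
    (h : ∀ᶠ k in atTop, ‖y k - p‖ < R → ‖y (k + 1) - y k‖ ≤ φ k - φ (k + 1)) :
    Tendsto y atTop (𝓝 p) := by
  rw [Metric.tendsto_atTop]
  intro ε hε
  set ρ := min ε R with hρ
  have hρ0 : 0 < ρ := lt_min hε hR
  obtain ⟨N, hN⟩ := eventually_atTop.1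
    ((hφ0.and h).and (hφ.eventually_lt_const (show (0 : ℝ) < ρ / 2 by linarith)))
  have hfreq := mapClusterPt_iff_frequently.1 hp (Metric.ball p (ρ / 2))
    (Metric.ball_mem_nhds p (by linarith))
  obtain ⟨n, hn, hyn⟩ := (frequently_atTop.1 hfreq) N
  rw [Metric.mem_ball, dist_eq_norm] at hyn
  -- As long as all earlier points lie in the ball, the length travelled is at most `φ n`, which is
  -- less than `ρ / 2`, and the start is within `ρ / 2` of `p`; so the next point lies in the ball
  -- too.
  have key : ∀ k, n ≤ k → ‖y k - p‖ < ρ := by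
    intro k hk
    induction k using Nat.strong_induction_on with
    | _ k ih =>
      have h1 : ‖y k - y n‖ ≤ φ n - φ k := by
        refine norm_sub_le_of_telescope hk fun i hi hik => ?_
        exact (hN i (hn.trans hi)).1.2 ((ih i hik hi).trans_le (min_le_right _ _))
      have h2 := (hN k (hn.trans hk)).1.1
      have h3 := (hN n hn).2
      calc ‖y k - p‖ = ‖(y k - y n) + (y n - p)‖ := by congr 1; abel
        _ ≤ ‖y k - y n‖ + ‖y n - p‖ := norm_add_le _ _
        _ < ρ := by linarith
  exact ⟨n, fun k hk => by rw [dist_eq_norm]; exact (key k hk).trans_le (min_le_left _ _)⟩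

end Trap

/-! ### Łojasiewicz length estimate and descent sequences. -/

/-- One step of the Kurdyka–Łojasiewicz length estimate, with a perturbation `u`. -/
lemma loj_step_length {a P r r' u θ c : ℝ} (ha : 0 ≤ a) (hr' : 0 ≤ r') (hu : 0 ≤ u)
    (hc : 0 < c) (hθ0 : 0 < θ) (hθ1 : θ < 1) (hdec : r' + a / 2 * P ^ 2 ≤ r)
    (hloj : c * r ^ θ ≤ P + c * u ^ θ) :
    a * P ≤ 4 / ((1 - θ) * c) * (r ^ (1 - θ) - r' ^ (1 - θ)) + a * (c * u ^ θ) := by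
  have haP : 0 ≤ a / 2 * P ^ 2 := by positivity
  have hrr' : r' ≤ r := by linarith
  have h1θ : 0 < 1 - θ := by linarith
  have hmono : 0 ≤ r ^ (1 - θ) - r' ^ (1 - θ) := by
    have := Real.rpow_le_rpow hr' hrr' h1θ.le
    linarith
  have hut : 0 ≤ c * u ^ θ := by positivity
  -- Either the perturbation dominates `P`, and the last term alone suffices, or c r^θ ≤ 2P and the
  -- classical argument applies.
  rcases le_or_gt P (c * u ^ θ) with h | h
  · have : 0 ≤ 4 / ((1 - θ) * c) * (r ^ (1 - θ) - r' ^ (1 - θ)) := by positivity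
    have := mul_le_mul_of_nonneg_left h ha
    linarith
  · have hP0 : 0 < P := hut.trans_lt h
    have hr0 : 0 ≤ r := hr'.trans hrr'
    rcases hr0.eq_or_lt with h0 | h0
    · have hP2 : a * P ^ 2 = 0 := le_antisymm (by linarith) (by positivity)
      have ha0 : a = 0 := by
        rcases mul_eq_zero.1 hP2 with h | h
        · exact h
        · exact absurd h (by positivity)
      subst ha0
      simp only [zero_mul, add_zero]
      positivity
    · have hrθ : 0 < r ^ θ := Real.rpow_pos_of_pos h0 θ
      have h2 : c * r ^ θ ≤ 2 * P := by linarith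
      -- Bernoulli's inequality is concavity of t ↦ t^{1-θ} at `r`, in a form that also allows `r' =
      -- 0`.
      have hB := rpow_one_add_le_one_add_mul_self (s := r' / r - 1)
        (by have : 0 ≤ r' / r := by positivity
            linarith) h1θ.le (by linarith)
      have h3 : r' ^ (1 - θ) = r ^ (1 - θ) * (1 + (r' / r - 1)) ^ (1 - θ) := by
        rw [← Real.mul_rpow h0.le (by have : 0 ≤ r' / r := by positivity
                                      linarith)]
        congr 1; field_simp; ring
      have h4 : r ^ (1 - θ) * r ^ θ = r := by
        rw [← Real.rpow_add h0]; simp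
      have h5 : (1 - θ) * (r - r') ≤ (r ^ (1 - θ) - r' ^ (1 - θ)) * r ^ θ := by
        have h6 : r' ^ (1 - θ) ≤ r ^ (1 - θ) * (1 + (1 - θ) * (r' / r - 1)) := by
          rw [h3]; gcongr
        have h7 : r ^ (1 - θ) * (1 + (1 - θ) * (r' / r - 1)) * r ^ θ =
            r + (1 - θ) * (r' - r) := by
          have : r ^ (1 - θ) * (1 + (1 - θ) * (r' / r - 1)) * r ^ θ =
            (r ^ (1 - θ) * r ^ θ) * (1 + (1 - θ) * (r' / r - 1)) := by ring
          rw [this, h4]; field_simp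
        have h8 := mul_le_mul_of_nonneg_right h6 hrθ.le
        nlinarith
      set X := r ^ (1 - θ) - r' ^ (1 - θ) with hX
      have h9 : (1 - θ) * c * (a / 2 * P ^ 2) ≤ X * (2 * P) := by
        calc (1 - θ) * c * (a / 2 * P ^ 2) ≤ (1 - θ) * c * (r - r') := by
              gcongr; linarith
          _ = c * ((1 - θ) * (r - r')) := by ring
          _ ≤ c * (X * r ^ θ) := by gcongr
          _ = X * (c * r ^ θ) := by ring
          _ ≤ X * (2 * P) := by gcongr
      have h10 : a * P ≤ 4 / ((1 - θ) * c) * X := by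
        rw [div_mul_eq_mul_div, le_div_iff₀ (by positivity)]
        have : P * (a * P * ((1 - θ) * c)) ≤ P * (4 * X) := by nlinarith
        exact le_of_mul_le_mul_left this hP0
      have : 0 ≤ a * (c * u ^ θ) := by positivity
      linarith


/-- A sequence `y` with energy `Λ`, energy dissipation `P ^ 2` and `D`, and perturbations `η`. -/
structure Descent {E : Type*} [NormedAddCommGroup E] (a Λ P D η : ℕ → ℝ) (y : ℕ → E)
    (c₀ K : ℝ) : Prop where
  a_nonneg : ∀ k, 0 ≤ a k
  P_nonneg : ∀ k, 0 ≤ P k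
  D_nonneg : ∀ k, 0 ≤ D k
  η_nonneg : ∀ k, 0 ≤ η k
  c₀_pos : 0 < c₀
  K_nonneg : 0 ≤ K
  decrease : ∀ᶠ k in atTop,
    Λ (k + 1) + a k / 2 * P k ^ 2 + c₀ * D k ≤ Λ k + K * (a k * η k)
  step : ∀ᶠ k in atTop, ‖y (k + 1) - y k‖ ≤ K * (a k * (P k + √(η k)))

/-- The energy above its limit, corrected by the remaining perturbations. -/
def excess (a Λ η : ℕ → ℝ) (K ℓ : ℝ) (k : ℕ) : ℝ :=
  Λ k - ℓ + K * tailSum (fun i => a i * η i) k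

namespace Descent

variable {E : Type*} [NormedAddCommGroup E] {a Λ P D η : ℕ → ℝ} {y : ℕ → E} {c₀ K ℓ : ℝ}

lemma aη_nonneg (h : Descent a Λ P D η y c₀ K) (k : ℕ) : 0 ≤ a k * η k :=
  mul_nonneg (h.a_nonneg k) (h.η_nonneg k)

lemma u_nonneg (h : Descent a Λ P D η y c₀ K) (k : ℕ) :
    0 ≤ K * tailSum (fun i => a i * η i) k :=
  mul_nonneg h.K_nonneg (tailSum_nonneg h.aη_nonneg k)

lemma excess_decrease (h : Descent a Λ P D η y c₀ K) (hs : Summable fun k => a k * η k) :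
    ∀ᶠ k in atTop, excess a Λ η K ℓ (k + 1) + a k / 2 * P k ^ 2 + c₀ * D k ≤
      excess a Λ η K ℓ k := by
  filter_upwards [h.decrease] with k hk
  have h1 := tailSum_eq_add hs k
  simp only [excess]
  rw [h1]
  linarith

lemma excess_anti (h : Descent a Λ P D η y c₀ K) (hs : Summable fun k => a k * η k) :
    ∀ᶠ k in atTop, excess a Λ η K ℓ (k + 1) ≤ excess a Λ η K ℓ k := by
  filter_upwards [h.excess_decrease (ℓ := ℓ) hs] with k hk
  have h1 := h.a_nonneg k
  have h2 : 0 ≤ a k / 2 * P k ^ 2 := by positivity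
  have h3 := mul_nonneg h.c₀_pos.le (h.D_nonneg k)
  linarith

lemma tendsto_u (a η : ℕ → ℝ) (K : ℝ) :
    Tendsto (fun k => K * tailSum (fun i => a i * η i) k) atTop (𝓝 0) := by
  simpa using (tendsto_tailSum fun i => a i * η i).const_mul K

lemma exists_limit (h : Descent a Λ P D η y c₀ K) (hs : Summable fun k => a k * η k) {B : ℝ}
    (hB : ∀ k, B ≤ Λ k) : ∃ ℓ, Tendsto Λ atTop (𝓝 ℓ) := by
  obtain ⟨N, hN⟩ := eventually_atTop.1 (h.excess_anti (ℓ := 0) hs)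
  obtain ⟨l, hl, -⟩ := exists_tendsto_of_eventually_anti (B := B) hN fun k _ => by
    have h1 := h.u_nonneg k
    have h2 := hB k
    simp only [excess]; linarith
  refine ⟨l - 0, (hl.sub (tendsto_u a η K)).congr fun k => ?_⟩
  simp only [excess]; ring

lemma tendsto_excess (hΛ : Tendsto Λ atTop (𝓝 ℓ)) :
    Tendsto (excess a Λ η K ℓ) atTop (𝓝 0) := by
  have := (hΛ.sub_const ℓ).add (tendsto_u a η K)
  rwa [sub_self, zero_add] at this

/-- The excess is eventually nonincreasing and tends to zero. -/
lemma excess_nonneg (h : Descent a Λ P D η y c₀ K) (hs : Summable fun k => a k * η k)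
    (hΛ : Tendsto Λ atTop (𝓝 ℓ)) : ∀ᶠ k in atTop, 0 ≤ excess a Λ η K ℓ k := by
  obtain ⟨N, hN⟩ := eventually_atTop.1 (h.excess_anti (ℓ := ℓ) hs)
  filter_upwards [eventually_ge_atTop N] with k hk
  refine le_of_tendsto (tendsto_excess (a := a) (η := η) (K := K) hΛ) ?_
  filter_upwards [eventually_ge_atTop k] with j hj
  exact le_of_eventually_anti hN hk hj

lemma summable_dissipation (h : Descent a Λ P D η y c₀ K) (hs : Summable fun k => a k * η k)
    (hΛ : Tendsto Λ atTop (𝓝 ℓ)) :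
    (Summable fun k => a k * P k ^ 2) ∧ Summable D := by
  have h0 : ∀ k, 0 ≤ a k / 2 * P k ^ 2 := fun k => by have := h.a_nonneg k; positivity
  have h1 : ∀ k, 0 ≤ c₀ * D k := fun k => mul_nonneg h.c₀_pos.le (h.D_nonneg k)
  have h2 := h.excess_decrease (ℓ := ℓ) hs
  have h3 := h.excess_nonneg hs hΛ
  have hS1 : Summable fun k => a k / 2 * P k ^ 2 := summable_of_add_le h0 h3 (by
    filter_upwards [h2] with k hk using by linarith [h1 k])
  have hS2 : Summable fun k => c₀ * D k := summable_of_add_le h1 h3 (by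
    filter_upwards [h2] with k hk using by linarith [h0 k])
  refine ⟨(hS1.mul_left 2).congr fun k => by ring, (hS2.mul_left c₀⁻¹).congr fun k => ?_⟩
  have := h.c₀_pos
  field_simp

/-- Subadditivity of t ↦ t^θ passes from the energy gap to the excess at the price of the θ-th power
of the tail. -/
lemma loj_excess (h : Descent a Λ P D η y c₀ K) {θ c : ℝ} (hθ0 : 0 ≤ θ) (hθ1 : θ ≤ 1)
    (hc : 0 < c) {k : ℕ} (hr : 0 ≤ excess a Λ η K ℓ k) (hloj : c * |Λ k - ℓ| ^ θ ≤ P k) :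
    c * excess a Λ η K ℓ k ^ θ ≤
      P k + c * (K * tailSum (fun i => a i * η i) k) ^ θ := by
  have hu := h.u_nonneg k
  have h1 : excess a Λ η K ℓ k ^ θ ≤
      |Λ k - ℓ| ^ θ + (K * tailSum (fun i => a i * η i) k) ^ θ := by
    refine le_trans ?_ (Real.rpow_add_le_add_rpow (abs_nonneg _) hu hθ0 hθ1)
    refine Real.rpow_le_rpow hr ?_ hθ0
    simp only [excess]
    linarith [le_abs_self (Λ k - ℓ)]
  have := mul_le_mul_of_nonneg_left h1 hc.le
  linarith

/-- Convergence to a cluster point at which a Łojasiewicz inequality holds. -/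
theorem tendsto_of_loj (h : Descent a Λ P D η y c₀ K) (hs : Summable fun k => a k * η k)
    (hΛ : Tendsto Λ atTop (𝓝 ℓ)) {θ c R : ℝ} {p : E} (hθ0 : 0 < θ) (hθ1 : θ < 1) (hc : 0 < c)
    (hR : 0 < R) (hloj : ∀ᶠ k in atTop, ‖y k - p‖ < R → c * |Λ k - ℓ| ^ θ ≤ P k)
    (hp : MapClusterPt p atTop y)
    (hu : Summable fun k => a k * tailSum (fun i => a i * η i) k ^ θ)
    (hη : Summable fun k => a k * √(η k)) : Tendsto y atTop (𝓝 p) := by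
  set r := excess a Λ η K ℓ with hr
  set T := tailSum fun i => a i * η i with hT
  have hT0 : ∀ k, 0 ≤ T k := tailSum_nonneg h.aη_nonneg
  -- `s` collects the part of the step length caused by perturbations. It is summable, so its tail
  -- joins the desingularized excess in the telescoping potential.
  set s : ℕ → ℝ := fun k => K * (a k * (c * (K * T k) ^ θ)) + K * (a k * √(η k)) with hsdef
  have hs0 : ∀ k, 0 ≤ s k := fun k => by
    have h1 := h.a_nonneg k
    have h2 := hT0 k
    have h3 := h.K_nonneg
    positivity
  have hss : Summable s := by
    refine Summable.add ((hu.mul_left (K * (c * K ^ θ))).congr fun k => ?_) (hη.mul_left K)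
    rw [Real.mul_rpow h.K_nonneg (hT0 k)]; ring
  set C := K * (4 / ((1 - θ) * c)) with hC
  have hC0 : 0 ≤ C := by
    have := h.K_nonneg
    have : 0 < 1 - θ := by linarith
    positivity
  refine tendsto_of_telescope_near (φ := fun k => C * r k ^ (1 - θ) + tailSum s k) hR ?_ ?_ hp ?_
  · filter_upwards [h.excess_nonneg hs hΛ] with k hk
    have := tailSum_nonneg hs0 k
    positivity
  · have h1 : Tendsto (fun k => r k ^ (1 - θ)) atTop (𝓝 (0 ^ (1 - θ))) :=
      (tendsto_excess hΛ).rpow_const (Or.inr (by linarith))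
    rw [Real.zero_rpow (by linarith)] at h1
    simpa using (h1.const_mul C).add (tendsto_tailSum s)
  · filter_upwards [hloj, h.step, h.excess_nonneg hs hΛ, h.excess_decrease (ℓ := ℓ) hs,
      (tendsto_add_atTop_nat 1).eventually (h.excess_nonneg hs hΛ)] with k h1 h2 h3 h4 h5 hk
    have h6 := h.loj_excess hθ0.le hθ1.le hc h3 (h1 hk)
    have h7 := loj_step_length (h.a_nonneg k) h5 (h.u_nonneg k) hc hθ0 hθ1
      (by linarith [mul_nonneg h.c₀_pos.le (h.D_nonneg k)]) h6
    have h8 := mul_le_mul_of_nonneg_left h7 h.K_nonneg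
    have h9 := tailSum_eq_add hss k
    rw [h9]
    refine h2.trans ?_
    simp only [hsdef, hC]
    linarith

/-- A comparison principle: an admissible rate `b` that dominates the perturbations is a rate for
the energy. -/
theorem exists_excess_le_mul (h : Descent a Λ P D η y c₀ K) (hs : Summable fun k => a k * η k)
    {θ c U : ℝ} {b : ℕ → ℝ} (hθ : 1 / 2 ≤ θ) (hc : 0 < c)
    (hloj : ∀ᶠ k in atTop, c * |Λ k - ℓ| ^ θ ≤ P k)
    (hb0 : ∀ᶠ k in atTop, 0 < b k) (hb2 : ∀ᶠ k in atTop, b k ≤ 2 * b (k + 1))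
    (hu : ∀ᶠ k in atTop, K * tailSum (fun i => a i * η i) k ≤ U * b k)
    (hb : ∀ᶠ k in atTop,
      b k - b (k + 1) ≤ c ^ 2 / 2 * (1 / 2) ^ (2 * θ) * a k * b (k + 1) ^ (2 * θ)) :
    ∃ A, 0 < A ∧ ∀ᶠ k in atTop, excess a Λ η K ℓ k ≤ A * b k := by
  obtain ⟨N, hN⟩ := eventually_atTop.1 ((((hloj.and hb0).and hb2).and hu).and
    (hb.and (h.excess_decrease (ℓ := ℓ) hs)))
  set r := excess a Λ η K ℓ with hr
  -- A ≥ 1 gives A ≤ A^{2θ}, A ≥ 4U makes the perturbation tail at most half of the excess in the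
  -- critical case, and the third entry starts the induction.
  set A := max (max 1 (4 * U)) (r N / b N) with hA
  have hA1 : 1 ≤ A := (le_max_left _ _).trans (le_max_left _ _)
  have hAU : 4 * U ≤ A := (le_max_right _ _).trans (le_max_left _ _)
  refine ⟨A, by linarith, eventually_atTop.2 ⟨N, fun k hk => ?_⟩⟩
  induction k, hk using Nat.le_induction with
  | base =>
    have := (hN N le_rfl).1.1.1.2
    rw [← div_le_iff₀ this]
    exact le_max_right _ _
  | succ k hk ih =>
    obtain ⟨⟨⟨⟨h1, h2⟩, h3⟩, h4⟩, h5, h6⟩ := hN k hk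
    have h2' := (hN (k + 1) (hk.trans k.le_succ)).1.1.1.2
    have ha := h.a_nonneg k
    have hD := mul_nonneg h.c₀_pos.le (h.D_nonneg k)
    have hP : 0 ≤ a k / 2 * P k ^ 2 := by positivity
    -- If the excess is already below the next bound, monotonicity suffices. Otherwise at least half
    -- of `A * b (k + 1)` is genuine energy gap, and the Łojasiewicz inequality forces a decrease no
    -- smaller than that of `A * b`.
    rcases le_or_gt (r k) (A * b (k + 1)) with h7 | h7
    · linarith
    · have h8 : 2 * (K * tailSum (fun i => a i * η i) k) ≤ r k := by
        have : 2 * (U * b k) ≤ A * b (k + 1) := by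
          calc 2 * (U * b k) = (4 * U) * (b k / 2) := by ring
            _ ≤ A * (b k / 2) := by gcongr
            _ ≤ A * b (k + 1) := by gcongr; linarith
        linarith
      have hAb : 0 < A * b (k + 1) := by positivity
      have h9 : A * b (k + 1) / 2 ≤ |Λ k - ℓ| := by
        refine le_trans ?_ (le_abs_self _)
        have : r k = Λ k - ℓ + K * tailSum (fun i => a i * η i) k := rfl
        linarith
      have h10 : c * (A * b (k + 1) / 2) ^ θ ≤ P k := by
        refine le_trans ?_ h1
        gcongr
      have h11 : c ^ 2 * ((1 / 2) ^ (2 * θ) * (A * b (k + 1) ^ (2 * θ))) ≤ P k ^ 2 := by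
        calc c ^ 2 * ((1 / 2) ^ (2 * θ) * (A * b (k + 1) ^ (2 * θ)))
            ≤ c ^ 2 * ((1 / 2) ^ (2 * θ) * (A ^ (2 * θ) * b (k + 1) ^ (2 * θ))) := by
              gcongr
              calc A = A ^ (1 : ℝ) := (Real.rpow_one A).symm
                _ ≤ A ^ (2 * θ) := Real.rpow_le_rpow_of_exponent_le hA1 (by linarith)
          _ = (c * (A * b (k + 1) / 2) ^ θ) ^ 2 := by
              rw [mul_pow, ← Real.rpow_two ((A * b (k + 1) / 2) ^ θ), ← Real.rpow_mul (by positivity),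
                mul_comm θ 2, ← Real.mul_rpow (by linarith) h2'.le, ← Real.mul_rpow (by norm_num)
                (by positivity)]
              congr 2; ring
          _ ≤ P k ^ 2 := by gcongr
      have h12 := mul_le_mul_of_nonneg_left h11 (show 0 ≤ a k / 2 by positivity)
      have h13 := mul_le_mul_of_nonneg_left h5 (show 0 ≤ A by linarith)
      have h14 : A * (c ^ 2 / 2 * (1 / 2) ^ (2 * θ) * a k * b (k + 1) ^ (2 * θ)) =
        a k / 2 * (c ^ 2 * ((1 / 2) ^ (2 * θ) * (A * b (k + 1) ^ (2 * θ)))) := by ring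
      linarith

end Descent

/-! ### Averages and path lengths over windows of indices. -/

lemma sum_Ico_le_of_add_le {v s : ℕ → ℝ} {N j k : ℕ} (h : ∀ i ≥ N, v (i + 1) + s i ≤ v i)
    (hj : N ≤ j) (hjk : j ≤ k) : ∑ i ∈ Finset.Ico j k, s i ≤ v j - v k := by
  induction k, hjk using Nat.le_induction with
  | base => simp
  | succ k hk ih =>
    rw [Finset.sum_Ico_succ_top hk]
    linarith [h k (hj.trans hk)]

lemma sum_Ico_le_tailSum {s : ℕ → ℝ} (hs0 : ∀ k, 0 ≤ s k) (hs : Summable s) {j k : ℕ}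
    (hjk : j ≤ k) : ∑ i ∈ Finset.Ico j k, s i ≤ tailSum s j := by
  have := sum_Ico_le_of_add_le (v := tailSum s) (s := s) (N := 0)
    (fun i _ => by rw [tailSum_eq_add hs i]; linarith) (Nat.zero_le j) hjk
  linarith [tailSum_nonneg hs0 k]

/-- A quantity with controlled upward increments is controlled by its average over a window. -/
lemma sum_mul_le_of_le_add {a v s : ℕ → ℝ} {N j k : ℕ} {B : ℝ} (ha : ∀ i, 0 ≤ a i)
    (hs0 : ∀ i, 0 ≤ s i) (h : ∀ i ≥ N, v (i + 1) ≤ v i + s i) (hj : N ≤ j)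
    (hB : ∑ i ∈ Finset.Ico j k, s i ≤ B) :
    (∑ i ∈ Finset.Ico j k, a i) * v k ≤
      ∑ i ∈ Finset.Ico j k, a i * v i + (∑ i ∈ Finset.Ico j k, a i) * B := by
  rw [Finset.sum_mul, Finset.sum_mul, ← Finset.sum_add_distrib]
  refine Finset.sum_le_sum fun i hi => ?_
  obtain ⟨hi1, hi2⟩ := Finset.mem_Ico.1 hi
  rw [← mul_add]
  refine mul_le_mul_of_nonneg_left ?_ (ha i)
  have h1 := sum_Ico_le_of_add_le (v := v) (s := fun l => -s l) (N := N)
    (fun l hl => by linarith [h l hl]) (hj.trans hi1) hi2.le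
  have h2 : ∑ l ∈ Finset.Ico i k, s l ≤ ∑ l ∈ Finset.Ico j k, s l :=
    Finset.sum_le_sum_of_subset_of_nonneg (Finset.Ico_subset_Ico_left hi1) fun l _ _ => hs0 l
  rw [Finset.sum_neg_distrib] at h1
  linarith

namespace Descent

variable {E : Type*} [NormedAddCommGroup E] {a Λ P D η : ℕ → ℝ} {y : ℕ → E} {c₀ K ℓ : ℝ}

lemma sum_dissipation_le (h : Descent a Λ P D η y c₀ K) (hs : Summable fun k => a k * η k)
    (hΛ : Tendsto Λ atTop (𝓝 ℓ)) : ∀ᶠ j in atTop, ∀ k ≥ j,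
      ∑ i ∈ Finset.Ico j k, a i * P i ^ 2 ≤ 2 * excess a Λ η K ℓ j := by
  obtain ⟨N, hN⟩ := eventually_atTop.1 ((h.excess_decrease (ℓ := ℓ) hs).and (h.excess_nonneg hs hΛ))
  filter_upwards [eventually_ge_atTop N] with j hj k hk
  have h1 := sum_Ico_le_of_add_le (v := excess a Λ η K ℓ) (s := fun i => a i / 2 * P i ^ 2) (N := N)
    (fun i hi => by linarith [(hN i hi).1, mul_nonneg h.c₀_pos.le (h.D_nonneg i)]) hj hk
  have h2 := (hN k (hj.trans hk)).2
  have h3 : ∑ i ∈ Finset.Ico j k, a i * P i ^ 2 =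
      2 * ∑ i ∈ Finset.Ico j k, a i / 2 * P i ^ 2 := by
    rw [Finset.mul_sum]
    exact Finset.sum_congr rfl fun i _ => by ring
  linarith

/-- Length of a piece of the trajectory, by the Cauchy–Schwarz inequality. -/
lemma norm_sub_le_sqrt (h : Descent a Λ P D η y c₀ K) (hs : Summable fun k => a k * η k)
    (hΛ : Tendsto Λ atTop (𝓝 ℓ)) : ∀ᶠ j in atTop, ∀ k ≥ j,
      ‖y k - y j‖ ≤ K * √((∑ i ∈ Finset.Ico j k, a i) *
        (4 * excess a Λ η K ℓ j + 2 * tailSum (fun i => a i * η i) j)) := by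
  obtain ⟨N, hN⟩ := eventually_atTop.1 (h.step)
  filter_upwards [eventually_ge_atTop N, h.sum_dissipation_le hs hΛ] with j hj h1 k hk
  set q : ℕ → ℝ := fun i => P i + √(η i)
  have h2 : ‖y k - y j‖ ≤ K * ∑ i ∈ Finset.Ico j k, a i * q i := by
    rw [Finset.mul_sum]
    have h3 : y k - y j = ∑ i ∈ Finset.Ico j k, (y (i + 1) - y i) :=
      (Finset.sum_Ico_sub y hk).symm
    rw [h3]
    refine (norm_sum_le _ _).trans (Finset.sum_le_sum fun i hi => ?_)
    exact hN i (hj.trans (Finset.mem_Ico.1 hi).1)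
  refine h2.trans (mul_le_mul_of_nonneg_left (Real.le_sqrt_of_sq_le ?_) h.K_nonneg)
  have h4 := Finset.sum_sq_le_sum_mul_sum_of_sq_le_mul (Finset.Ico j k) (r := fun i => a i * q i)
    (f := a) (g := fun i => a i * q i ^ 2) (fun i _ => h.a_nonneg i)
    (fun i _ => mul_nonneg (h.a_nonneg i) (sq_nonneg _)) (fun i _ => le_of_eq (by ring))
  refine h4.trans (mul_le_mul_of_nonneg_left ?_ (Finset.sum_nonneg fun i _ => h.a_nonneg i))
  have h5 : ∑ i ∈ Finset.Ico j k, a i * q i ^ 2 ≤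
      2 * (∑ i ∈ Finset.Ico j k, a i * P i ^ 2) + 2 * ∑ i ∈ Finset.Ico j k, a i * η i := by
    rw [Finset.mul_sum, Finset.mul_sum, ← Finset.sum_add_distrib]
    refine Finset.sum_le_sum fun i _ => ?_
    have h6 : q i ^ 2 ≤ 2 * P i ^ 2 + 2 * η i := by
      have := Real.sq_sqrt (h.η_nonneg i)
      simp only [q]
      nlinarith [sq_nonneg (P i - √(η i))]
    have := mul_le_mul_of_nonneg_left h6 (h.a_nonneg i)
    linarith
  have h7 := sum_Ico_le_tailSum h.aη_nonneg hs hk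
  linarith [h1 k hk]

end Descent

/-- A convergent sequence with geometrically decaying increments along doubling indices. -/
lemma norm_sub_le_of_doubling {E : Type*} [NormedAddCommGroup E] {y : ℕ → E} {p : E} {B : ℕ → ℝ}
    {q : ℝ} (hq1 : q < 1) (hy : Tendsto y atTop (𝓝 p))
    (hB0 : ∀ᶠ k in atTop, 0 ≤ B k) (hBq : ∀ᶠ k in atTop, B (2 * k) ≤ q * B k)
    (h : ∀ᶠ k in atTop, ‖y (2 * k) - y k‖ ≤ B k) :
    ∀ᶠ k in atTop, ‖y k - p‖ ≤ B k / (1 - q) := by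
  obtain ⟨N, hN⟩ := eventually_atTop.1 ((hB0.and hBq).and h)
  filter_upwards [eventually_ge_atTop (max N 1)] with k hk
  have hkN : N ≤ k := (le_max_left _ _).trans hk
  have hk1 : 1 ≤ k := (le_max_right _ _).trans hk
  have hq' : 0 < 1 - q := by linarith
  have hge : ∀ n, N ≤ 2 ^ n * k := fun n =>
    hkN.trans (Nat.le_mul_of_pos_left k (by positivity))
  have hdbl : ∀ n, 2 ^ (n + 1) * k = 2 * (2 ^ n * k) := fun n => by ring
  have h1 : ∀ n, ‖y (2 ^ n * k) - y k‖ ≤ (B k - B (2 ^ n * k)) / (1 - q) := by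
    intro n
    induction n with
    | zero => simp
    | succ n ih =>
      obtain ⟨⟨-, h2⟩, h3⟩ := hN _ (hge n)
      rw [hdbl]
      -- The geometric decay lets each increment be bounded by a telescoping difference.
      have h4 : B (2 ^ n * k) ≤ (B (2 ^ n * k) - B (2 * (2 ^ n * k))) / (1 - q) := by
        rw [le_div_iff₀ hq']; linarith
      calc ‖y (2 * (2 ^ n * k)) - y k‖
          = ‖(y (2 * (2 ^ n * k)) - y (2 ^ n * k)) + (y (2 ^ n * k) - y k)‖ := by congr 1; abel
        _ ≤ _ := norm_add_le _ _
        _ ≤ (B (2 ^ n * k) - B (2 * (2 ^ n * k))) / (1 - q) +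
            (B k - B (2 ^ n * k)) / (1 - q) := by linarith
        _ = _ := by ring
  have h2 : Tendsto (fun n => 2 ^ n * k) atTop atTop :=
    tendsto_atTop_mono (fun n => Nat.le_mul_of_pos_right _ hk1)
      (tendsto_pow_atTop_atTop_of_one_lt one_lt_two)
  have h3 : Tendsto (fun n => ‖y (2 ^ n * k) - y k‖) atTop (𝓝 ‖p - y k‖) :=
    ((hy.comp h2).sub_const _).norm
  rw [norm_sub_rev]
  refine le_of_tendsto' h3 fun n => (h1 n).trans ?_
  have := (hN _ (hge n)).1.1
  gcongr
  linarith


/-! ### Smoothness and one step of the perturbed recursion. -/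

namespace SmoothObjective

variable {d : ℕ} {f : Vec d → ℝ} {L : ℝ}

/-- Mean value inequality on a ball around `y`; it yields the constant L instead of the sharp L/2,
which is enough here. -/
lemma abs_sub_sub_inner_le (hf : SmoothObjective f L) (y v : Vec d) :
    |f (y + v) - f y - inner ℝ (gradient f y) v| ≤ L * ‖v‖ ^ 2 := by
  have hgr : ∀ x, HasGradientAt f (gradient f x) x := fun x => (hf.differentiable x).hasGradientAt
  have h := Convex.norm_image_sub_le_of_norm_hasFDerivWithin_le' (𝕜 := ℝ) (f := f)
    (f' := fun x => InnerProductSpace.toDual ℝ (Vec d) (gradient f x))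
    (φ := InnerProductSpace.toDual ℝ (Vec d) (gradient f y)) (C := L * ‖v‖)
    (s := Metric.closedBall y ‖v‖) (x := y) (y := y + v)
    (fun x _ => (hgr x).hasFDerivAt.hasFDerivWithinAt) (fun x hx => by
      rw [← map_sub, LinearIsometryEquiv.norm_map]
      refine (hf.lipschitz x y).trans ?_
      rw [Metric.mem_closedBall, dist_eq_norm] at hx
      exact mul_le_mul_of_nonneg_left hx hf.L_pos.le)
    (convex_closedBall _ _) (by simp) (by simp [Metric.mem_closedBall, dist_eq_norm])
  simp only [add_sub_cancel_left, InnerProductSpace.toDual_apply_apply, Real.norm_eq_abs] at h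
  calc _ ≤ _ := h
    _ = _ := by ring

lemma continuous_gradient (hf : SmoothObjective f L) : Continuous (gradient f) := by
  have : LipschitzWith (Real.toNNReal L) (gradient f) :=
    LipschitzWith.of_dist_le_mul fun x y => by
      rw [dist_eq_norm, dist_eq_norm, Real.coe_toNNReal _ hf.L_pos.le]
      exact hf.lipschitz x y
  exact this.continuous

end SmoothObjective

lemma norm_add_three_sq_le {E : Type*} [NormedAddCommGroup E] {g u v w : E} {Q : ℝ}
    (h : ‖g‖ ≤ Q * (‖u‖ + ‖v‖ + ‖w‖)) :
    ‖g‖ ^ 2 ≤ 3 * Q ^ 2 * (‖u‖ ^ 2 + ‖v‖ ^ 2 + ‖w‖ ^ 2) := by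
  have h1 := pow_le_pow_left₀ (norm_nonneg g) h 2
  refine h1.trans ?_
  have : (‖u‖ + ‖v‖ + ‖w‖) ^ 2 ≤ 3 * (‖u‖ ^ 2 + ‖v‖ ^ 2 + ‖w‖ ^ 2) := by
    nlinarith [sq_nonneg (‖u‖ - ‖v‖), sq_nonneg (‖v‖ - ‖w‖), sq_nonneg (‖u‖ - ‖w‖)]
  calc (Q * (‖u‖ + ‖v‖ + ‖w‖)) ^ 2 = Q ^ 2 * (‖u‖ + ‖v‖ + ‖w‖) ^ 2 := by ring
    _ ≤ Q ^ 2 * (3 * (‖u‖ ^ 2 + ‖v‖ ^ 2 + ‖w‖ ^ 2)) := by gcongr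
    _ = _ := by ring

/-- The vector is a convex combination of `u` and `-s • v`, so convexity of the squared norm
applies; the momentum thereby loses a fixed fraction of its square. -/
lemma norm_smul_sub_smul_sq_le {E : Type*} [NormedAddCommGroup E] [NormedSpace ℝ E]
    {lam s : ℝ} (hlam : 0 ≤ lam) (hlam1 : lam < 1) (u v : E) :
    ‖lam • u - ((1 - lam) * s) • v‖ ^ 2 ≤ lam * ‖u‖ ^ 2 + s ^ 2 * ‖v‖ ^ 2 := by
  have h1 : ‖lam • u - ((1 - lam) * s) • v‖ ≤ lam * ‖u‖ + (1 - lam) * (|s| * ‖v‖) := by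
    refine (norm_sub_le _ _).trans ?_
    rw [norm_smul, norm_smul, Real.norm_of_nonneg hlam, norm_mul,
      Real.norm_of_nonneg (by linarith : 0 ≤ 1 - lam), Real.norm_eq_abs, mul_assoc]
  have h2 := pow_le_pow_left₀ (norm_nonneg _) h1 2
  have h3 : s ^ 2 * ‖v‖ ^ 2 = (|s| * ‖v‖) ^ 2 := by rw [mul_pow, sq_abs]
  rw [h3]
  refine h2.trans ?_
  set A := ‖u‖
  set B := |s| * ‖v‖
  have : (lam * A + (1 - lam) * B) ^ 2 ≤ lam * A ^ 2 + (1 - lam) * B ^ 2 := by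
    nlinarith [mul_nonneg (mul_nonneg hlam (by linarith : 0 ≤ 1 - lam)) (sq_nonneg (A - B))]
  nlinarith [sq_nonneg B]

section OneStep

variable {d : ℕ} {f : Vec d → ℝ} {L : ℝ}

/-- The gradient at the shifted extrapolated point differs from the gradient at the shifted point
by at most the noise and the momentum. -/
lemma norm_gradient_sub_le (hf : SmoothObjective f L) {c κ : ℝ} (y n m δ : Vec d) :
    ‖gradient f (y + n + c • (δ + m)) - κ • n - gradient f y‖ ≤
      (L + |κ| + L * |c|) * (‖n‖ + ‖m‖ + ‖δ‖) := by
  have h1 : ‖gradient f (y + n + c • (δ + m)) - gradient f y‖ ≤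
      L * (‖n‖ + |c| * (‖δ‖ + ‖m‖)) := by
    refine (hf.lipschitz _ _).trans (mul_le_mul_of_nonneg_left ?_ hf.L_pos.le)
    calc ‖y + n + c • (δ + m) - y‖ = ‖n + c • (δ + m)‖ := by congr 1; abel
      _ ≤ ‖n‖ + ‖c • (δ + m)‖ := norm_add_le _ _
      _ ≤ _ := by rw [norm_smul, Real.norm_eq_abs]; gcongr; exact norm_add_le _ _
  have h2 : ‖gradient f (y + n + c • (δ + m)) - κ • n - gradient f y‖ ≤
      ‖gradient f (y + n + c • (δ + m)) - gradient f y‖ + |κ| * ‖n‖ := by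
    rw [sub_right_comm]
    refine (norm_sub_le _ _).trans ?_
    rw [norm_smul, Real.norm_eq_abs]
  have h3 := hf.L_pos
  refine (h2.trans (add_le_add_left h1 _)).trans ?_
  have h4 := mul_nonneg h3.le (norm_nonneg m)
  have h5 := mul_nonneg h3.le (norm_nonneg δ)
  have h6 := mul_nonneg (mul_nonneg h3.le (abs_nonneg c)) (norm_nonneg n)
  have h7 := mul_nonneg (abs_nonneg κ) (norm_nonneg m)
  have h8 := mul_nonneg (abs_nonneg κ) (norm_nonneg δ)
  nlinarith

/-- Decrease of the energy `f(y) + ‖δ‖²` in one step with small step size `a`. -/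
lemma energy_decrease (hf : SmoothObjective f L) {lam c κ a Q : ℝ} (hlam : 0 ≤ lam)
    (hlam1 : lam < 1) (hQ : L + |κ| + L * |c| ≤ Q) (ha : 0 ≤ a) (haL : 16 * L * a ≤ 1)
    (ha8 : 8 * a ≤ 1) (haQ : 20 * Q ^ 2 * a ≤ 1 - lam) {y y' n m δ δ' : Vec d}
    (hy' : y' = y - a • (gradient f (y + n + c • (δ + m)) - κ • n))
    (hδ' : δ' = lam • δ - ((1 - lam) * a) • gradient f (y + n + c • (δ + m))) :
    f y' + ‖δ'‖ ^ 2 + a / 2 * ‖gradient f y‖ ^ 2 + (1 - lam) / 2 * ‖δ‖ ^ 2 ≤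
      f y + ‖δ‖ ^ 2 + 10 * Q ^ 2 * (a * (‖n‖ ^ 2 + ‖m‖ ^ 2)) := by
  have hL := hf.L_pos
  have hQ0 : 0 < Q := by
    have := mul_nonneg hL.le (abs_nonneg c)
    have := abs_nonneg κ
    linarith
  set g := gradient f (y + n + c • (δ + m)) with hg
  set G := gradient f y with hG
  set h := g - κ • n - G with hh
  have hsum0 : 0 ≤ ‖n‖ + ‖m‖ + ‖δ‖ := by positivity
  have hh2 : ‖h‖ ^ 2 ≤ 3 * Q ^ 2 * (‖n‖ ^ 2 + ‖m‖ ^ 2 + ‖δ‖ ^ 2) :=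
    norm_add_three_sq_le ((norm_gradient_sub_le hf y n m δ).trans
      (mul_le_mul_of_nonneg_right hQ hsum0))
  -- The momentum is driven by the bare gradient, without the correction κn: the case κ = 0 of the
  -- same estimate.
  have hg2 : ‖g - G‖ ^ 2 ≤ 3 * Q ^ 2 * (‖n‖ ^ 2 + ‖m‖ ^ 2 + ‖δ‖ ^ 2) := by
    refine norm_add_three_sq_le ?_
    have := norm_gradient_sub_le hf (c := c) (κ := 0) y n m δ
    simp only [zero_smul, sub_zero, abs_zero, add_zero] at this
    refine this.trans (mul_le_mul_of_nonneg_right ?_ hsum0)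
    linarith [abs_nonneg κ]
  set S := ‖n‖ ^ 2 + ‖m‖ ^ 2 + ‖δ‖ ^ 2 with hS
  have hS0 : 0 ≤ S := by positivity
  have hGh : g - κ • n = G + h := by rw [hh]; abel
  have h1 := (abs_le.1 (hf.abs_sub_sub_inner_le y (-(a • (G + h))))).2
  have hy1 : y + -(a • (G + h)) = y' := by rw [hy', hGh]; abel
  rw [hy1, norm_neg, norm_smul, inner_neg_right, inner_smul_right, inner_add_right,
    real_inner_self_eq_norm_sq, Real.norm_of_nonneg ha, mul_pow] at h1
  have h2 : -inner ℝ G h ≤ ‖G‖ ^ 2 / 8 + 2 * ‖h‖ ^ 2 := by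
    have := neg_le_of_abs_le (abs_real_inner_le_norm G h)
    nlinarith [sq_nonneg (‖G‖ - 4 * ‖h‖)]
  have h3 : ‖G + h‖ ^ 2 ≤ 2 * ‖G‖ ^ 2 + 2 * ‖h‖ ^ 2 := by
    have := pow_le_pow_left₀ (norm_nonneg _) (norm_add_le G h) 2
    nlinarith [sq_nonneg (‖G‖ - ‖h‖)]
  -- Of the full a‖G‖², one eighth goes to the cross term and one eighth to the quadratic remainder.
  -- The momentum square later costs another quarter, which leaves a/2.
  have h4 : f y' ≤ f y - 3 / 4 * (a * ‖G‖ ^ 2) + 3 * (a * ‖h‖ ^ 2) := by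
    have h5 : a * (-inner ℝ G h) ≤ a * (‖G‖ ^ 2 / 8 + 2 * ‖h‖ ^ 2) :=
      mul_le_mul_of_nonneg_left h2 ha
    have h6 : L * (a ^ 2 * ‖G + h‖ ^ 2) ≤ a / 16 * (2 * ‖G‖ ^ 2 + 2 * ‖h‖ ^ 2) := by
      calc L * (a ^ 2 * ‖G + h‖ ^ 2) = (16 * L * a) * (a / 16 * ‖G + h‖ ^ 2) := by ring
        _ ≤ 1 * (a / 16 * ‖G + h‖ ^ 2) := by gcongr
        _ ≤ _ := by rw [one_mul]; gcongr
    have h7 : 0 ≤ a * ‖h‖ ^ 2 := by positivity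
    linarith
  have h5 : ‖g‖ ^ 2 ≤ 2 * ‖G‖ ^ 2 + 2 * ‖g - G‖ ^ 2 := by
    have h6 : ‖g‖ ≤ ‖G‖ + ‖g - G‖ := by
      have := norm_add_le G (g - G)
      rwa [add_sub_cancel] at this
    have := pow_le_pow_left₀ (norm_nonneg _) h6 2
    nlinarith [sq_nonneg (‖G‖ - ‖g - G‖)]
  have h6 := norm_smul_sub_smul_sq_le (s := a) hlam hlam1 δ g
  rw [← hδ'] at h6
  have h7 : a ^ 2 * ‖g‖ ^ 2 ≤ a / 8 * (2 * ‖G‖ ^ 2 + 2 * (3 * Q ^ 2 * S)) := by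
    calc a ^ 2 * ‖g‖ ^ 2 = (8 * a) * (a / 8 * ‖g‖ ^ 2) := by ring
      _ ≤ 1 * (a / 8 * ‖g‖ ^ 2) := by gcongr
      _ ≤ _ := by rw [one_mul]; gcongr; linarith
  have h8 : a * ‖h‖ ^ 2 ≤ a * (3 * Q ^ 2 * S) := mul_le_mul_of_nonneg_left hh2 ha
  have h9 : 10 * Q ^ 2 * a * ‖δ‖ ^ 2 ≤ (1 - lam) / 2 * ‖δ‖ ^ 2 := by
    refine mul_le_mul_of_nonneg_right ?_ (sq_nonneg _)
    linarith
  have h10 : 0 ≤ Q ^ 2 * (a * S) := by positivity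
  have h11 : Q ^ 2 * (a * S) = Q ^ 2 * (a * (‖n‖ ^ 2 + ‖m‖ ^ 2)) + Q ^ 2 * a * ‖δ‖ ^ 2 := by
    rw [hS]; ring
  have h12 : a * ‖G‖ ^ 2 = 2 * (a / 2 * ‖G‖ ^ 2) := by ring
  have h13 : 0 ≤ a / 2 * ‖G‖ ^ 2 := by positivity
  have h14 : lam * ‖δ‖ ^ 2 + (1 - lam) / 2 * ‖δ‖ ^ 2 + (1 - lam) / 2 * ‖δ‖ ^ 2 = ‖δ‖ ^ 2 := by
    ring
  linarith

end OneStep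


/-! ### Step sizes, perturbed trajectories and their energy. -/

/-- Step sizes of exact order `k ^ (-γ)`. -/
structure IsStep (γ a₀ : ℝ) (a : ℕ → ℝ) : Prop where
  pos : 0 < a₀
  nonneg : ∀ k, 0 ≤ a k
  le : ∀ᶠ k : ℕ in atTop, a k ≤ a₀ / (k : ℝ) ^ γ
  ge : ∀ᶠ k : ℕ in atTop, a₀ / 2 / (k : ℝ) ^ γ ≤ a k

namespace IsStep

variable {γ a₀ : ℝ} {a : ℕ → ℝ}

lemma tendsto_zero (h : IsStep γ a₀ a) (hγ : 0 < γ) : Tendsto a atTop (𝓝 0) := by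
  refine squeeze_zero' (Eventually.of_forall h.nonneg) h.le ?_
  exact ((tendsto_rpow_atTop hγ).comp tendsto_natCast_atTop_atTop).const_div_atTop a₀

lemma not_summable (h : IsStep γ a₀ a) (hγ1 : γ ≤ 1) : ¬ Summable a := by
  intro hs
  have h1 : Summable fun k : ℕ => ((k : ℝ) ^ γ)⁻¹ := by
    refine (hs.mul_left (2 / a₀)).of_norm_bounded_eventually_nat ?_
    filter_upwards [h.ge] with k hk
    have ha := h.pos
    rw [Real.norm_of_nonneg (by positivity)]
    calc ((k : ℝ) ^ γ)⁻¹ = 2 / a₀ * (a₀ / 2 / (k : ℝ) ^ γ) := by field_simp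
      _ ≤ _ := by gcongr
  have := Real.summable_nat_rpow_inv.1 h1
  linarith

end IsStep

/-- The recursion of SGDM after the noise has been split off: `y` is the shifted iterate, `n` and
`m` are noise, `δ` is the noiseless momentum. -/
structure Trajectory {d : ℕ} (f : Vec d → ℝ) (lam c κ : ℝ) (a : ℕ → ℝ)
    (y n m δ : ℕ → Vec d) : Prop where
  step_y : ∀ᶠ k in atTop,
    y (k + 1) = y k - a k • (gradient f (y k + n k + c • (δ k + m k)) - κ • n k)
  step_δ : ∀ᶠ k in atTop,
    δ (k + 1) = lam • δ k - ((1 - lam) * a k) • gradient f (y k + n k + c • (δ k + m k))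

/-- The Łojasiewicz inequality with a prescribed constant. -/
def LojasiewiczBound {d : ℕ} (f : Vec d → ℝ) (p : Vec d) (θ C : ℝ) : Prop :=
  ∃ η : ℝ, 0 < η ∧ ∃ U ∈ 𝓝 p, ∀ x ∈ U, |f x - f p| < η → C * |f x - f p| ^ θ ≤ ‖gradient f x‖

section

variable {d : ℕ} {f : Vec d → ℝ} {L lam c κ γ a₀ : ℝ} {a : ℕ → ℝ} {y n m δ : ℕ → Vec d}
  {p : Vec d}

lemma HasLojasiewiczAt.exists_bound {θ : ℝ} (hθ : 0 < θ) (h : HasLojasiewiczAt f p θ) :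
    ∃ C, 0 < C ∧ LojasiewiczBound f p θ C := by
  obtain ⟨C, hC, η, hη, U, hU, h⟩ := h
  refine ⟨C, hC, η, hη, U, hU, fun x hx hxη => ?_⟩
  rcases (abs_nonneg (f x - f p)).eq_or_lt with h0 | h0
  · rw [← h0, Real.zero_rpow hθ.ne', mul_zero]
    exact norm_nonneg _
  · exact h x hx h0 hxη

/-- A larger exponent is weaker where the gap is at most 1. The convergence proof uses this freedom
to make the perturbation series converge. -/
lemma LojasiewiczBound.mono_exponent {θ θ' C : ℝ} (hC : 0 < C) (hθ : 0 < θ) (hθθ' : θ ≤ θ')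
    (h : LojasiewiczBound f p θ C) : LojasiewiczBound f p θ' C := by
  obtain ⟨η, hη, U, hU, h⟩ := h
  refine ⟨min η 1, lt_min hη one_pos, U, hU, fun x hx hxη => ?_⟩
  refine le_trans ?_ (h x hx (hxη.trans_le (min_le_left _ _)))
  refine mul_le_mul_of_nonneg_left ?_ hC.le
  rcases (abs_nonneg (f x - f p)).eq_or_lt with h0 | h0
  · rw [← h0, Real.zero_rpow hθ.ne', Real.zero_rpow (by linarith)]
  · exact Real.rpow_le_rpow_of_exponent_ge h0 (hxη.le.trans (min_le_right _ _)) hθθ'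

/-- The Łojasiewicz inequality of `f` passes to the energy `f(y) + ‖δ‖²`. -/
lemma LojasiewiczBound.energy {θ C : ℝ} (hC : 0 < C) (hθ : 1 / 2 ≤ θ) (hθ1 : θ ≤ 1)
    (h : LojasiewiczBound f p θ C) (hfy : Tendsto (fun k => f (y k)) atTop (𝓝 (f p)))
    (hδ : Tendsto (fun k => ‖δ k‖ ^ 2) atTop (𝓝 0)) :
    ∃ R, 0 < R ∧ ∀ᶠ k in atTop, ‖y k - p‖ < R →
      C / √2 * |f (y k) + ‖δ k‖ ^ 2 - f p| ^ θ ≤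
        √(‖gradient f (y k)‖ ^ 2 + (1 + C ^ 2) * ‖δ k‖ ^ 2) := by
  obtain ⟨η, hη, U, hU, h⟩ := h
  obtain ⟨R, hR, hRU⟩ := Metric.mem_nhds_iff.1 hU
  refine ⟨R, hR, ?_⟩
  have h1 : ∀ᶠ k in atTop, |f (y k) - f p| < η := by
    have := (Metric.tendsto_nhds.1 hfy) η hη
    simpa only [Real.dist_eq] using this
  filter_upwards [h1, hδ.eventually_lt_const one_pos] with k h1 h2 h3
  have hy := h (y k) (hRU (by rwa [Metric.mem_ball, dist_eq_norm])) h1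
  set D := ‖δ k‖ with hD
  set G := ‖gradient f (y k)‖ with hG
  have hD0 : 0 ≤ D := norm_nonneg _
  have hD1 : D ≤ 1 := by nlinarith
  have h4 : |f (y k) + D ^ 2 - f p| ^ θ ≤ |f (y k) - f p| ^ θ + D := by
    have h5 : |f (y k) + D ^ 2 - f p| ≤ |f (y k) - f p| + D ^ 2 := by
      have := abs_add_le (f (y k) - f p) (D ^ 2)
      rwa [abs_of_nonneg (sq_nonneg D), sub_add_eq_add_sub] at this
    refine (Real.rpow_le_rpow (abs_nonneg _) h5 (by linarith)).trans ?_
    refine (Real.rpow_add_le_add_rpow (abs_nonneg _) (sq_nonneg D) (by linarith) hθ1).trans ?_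
    -- Here θ ≥ 1/2 is essential: the momentum part of the energy is then controlled by ‖δ‖ to the
    -- first power.
    have h6 : (D ^ 2) ^ θ ≤ D := by
      rw [← Real.rpow_two, ← Real.rpow_mul hD0]
      rcases hD0.eq_or_lt with h0 | h0
      · rw [← h0, Real.zero_rpow (by linarith)]
      · calc D ^ (2 * θ) ≤ D ^ (1 : ℝ) :=
              Real.rpow_le_rpow_of_exponent_ge h0 hD1 (by linarith)
          _ = D := Real.rpow_one D
    linarith
  have h7 : C * |f (y k) + D ^ 2 - f p| ^ θ ≤ G + C * D := by
    have := mul_le_mul_of_nonneg_left h4 hC.le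
    linarith
  have hs2 : 0 < √2 := by positivity
  rw [div_mul_eq_mul_div, div_le_iff₀ hs2, ← Real.sqrt_mul (by positivity)]
  refine h7.trans (Real.le_sqrt_of_sq_le ?_)
  -- (G + CD)² ≤ 2(G² + C²D²), whence the loss of √2 and the weight of ‖δ‖² in the dissipation.
  nlinarith [sq_nonneg (G - C * D), sq_nonneg D]

namespace Trajectory

/-- The dissipation of ‖δ‖² carries no step size. Since a_k → 0, half of it pays for any multiple
`B` of ‖δ‖² inside P², so `B` can be adapted to the Łojasiewicz constant. -/
lemma descent (hf : SmoothObjective f L) (h : Trajectory f lam c κ a y n m δ) (hlam : 0 ≤ lam)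
    (hlam1 : lam < 1) (ha0 : ∀ k, 0 ≤ a k) (ha : Tendsto a atTop (𝓝 0)) {B : ℝ} (hB : 1 ≤ B) :
    ∃ K, Descent a (fun k => f (y k) + ‖δ k‖ ^ 2)
      (fun k => √(‖gradient f (y k)‖ ^ 2 + B * ‖δ k‖ ^ 2)) (fun k => ‖δ k‖ ^ 2)
      (fun k => ‖n k‖ ^ 2 + ‖m k‖ ^ 2) y ((1 - lam) / 4) K := by
  set Q := L + |κ| + L * |c| with hQ
  have hL := hf.L_pos
  have hQ0 : 0 < Q := by positivity
  have hsmall : ∀ M : ℝ, ∀ s : ℝ, 0 < s → ∀ᶠ k in atTop, M * a k ≤ s := fun M s hs => by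
    have := ha.const_mul M
    rw [mul_zero] at this
    filter_upwards [this.eventually_lt_const hs] with k hk using hk.le
  have h1lam : 0 < 1 - lam := by linarith
  have hB0 : 0 ≤ B := by linarith
  refine ⟨10 * Q ^ 2 + 2 * (1 + Q), ha0, fun k => by positivity, fun k => by positivity,
    fun k => by positivity, by linarith, by positivity, ?_, ?_⟩
  · filter_upwards [h.step_y, h.step_δ, hsmall (16 * L) 1 one_pos, hsmall 8 1 one_pos,
      hsmall (20 * Q ^ 2) (1 - lam) h1lam, hsmall (2 * B) (1 - lam) h1lam] with k h1 h2 h3 h4 h5 h6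
    have h7 := energy_decrease hf hlam hlam1 le_rfl (ha0 k) h3 h4 h5 h1 h2
    rw [Real.sq_sqrt (by positivity)]
    have h8 : a k / 2 * (B * ‖δ k‖ ^ 2) ≤ (1 - lam) / 4 * ‖δ k‖ ^ 2 := by
      calc a k / 2 * (B * ‖δ k‖ ^ 2) = (2 * B * a k) / 4 * ‖δ k‖ ^ 2 := by ring
        _ ≤ _ := by gcongr
    have h9 : 0 ≤ 2 * (1 + Q) * (a k * (‖n k‖ ^ 2 + ‖m k‖ ^ 2)) := by
      have := ha0 k; positivity
    rw [← hQ] at h7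
    linarith
  · filter_upwards [h.step_y] with k h1
    set P := √(‖gradient f (y k)‖ ^ 2 + B * ‖δ k‖ ^ 2) with hP
    set e := √(‖n k‖ ^ 2 + ‖m k‖ ^ 2) with he
    have h2 := norm_gradient_sub_le hf (c := c) (κ := κ) (y k) (n k) (m k) (δ k)
    rw [← hQ] at h2
    set g := gradient f (y k + n k + c • (δ k + m k)) - κ • n k with hg
    have h3 : ‖g‖ ≤ ‖gradient f (y k)‖ + Q * (‖n k‖ + ‖m k‖ + ‖δ k‖) := by
      have := norm_add_le (gradient f (y k)) (g - gradient f (y k))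
      rw [add_sub_cancel] at this
      linarith
    have h4 : ‖gradient f (y k)‖ ≤ P := Real.le_sqrt_of_sq_le (by
      have : 0 ≤ B * ‖δ k‖ ^ 2 := by positivity
      linarith)
    have h5 : ‖δ k‖ ≤ P := Real.le_sqrt_of_sq_le (by
      nlinarith [sq_nonneg ‖δ k‖, sq_nonneg ‖gradient f (y k)‖])
    have h6 : ‖n k‖ ≤ e := Real.le_sqrt_of_sq_le (by nlinarith [sq_nonneg ‖m k‖])
    have h7 : ‖m k‖ ≤ e := Real.le_sqrt_of_sq_le (by nlinarith [sq_nonneg ‖n k‖])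
    have hP0 : 0 ≤ P := Real.sqrt_nonneg _
    have he0 : 0 ≤ e := Real.sqrt_nonneg _
    have h8 : ‖y (k + 1) - y k‖ = a k * ‖g‖ := by
      rw [h1, sub_sub_cancel_left, norm_neg, norm_smul, Real.norm_of_nonneg (ha0 k)]
    rw [h8]
    have h9 : ‖g‖ ≤ (10 * Q ^ 2 + 2 * (1 + Q)) * (P + e) := by
      calc ‖g‖ ≤ P + Q * (e + e + P) := by
            refine h3.trans ?_
            gcongr
        _ ≤ (2 * (1 + Q)) * (P + e) := by nlinarith [mul_nonneg hQ0.le hP0]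
        _ ≤ _ := by
            gcongr
            have : 0 ≤ 10 * Q ^ 2 := by positivity
            linarith
    calc a k * ‖g‖ ≤ a k * ((10 * Q ^ 2 + 2 * (1 + Q)) * (P + e)) :=
          mul_le_mul_of_nonneg_left h9 (ha0 k)
      _ = _ := by ring

end Trajectory

/-- Growth of the squared gradient norm along a descent sequence. -/
lemma Descent.exists_gradient_step {Λ D η P : ℕ → ℝ} {c₀ K : ℝ} (hf : SmoothObjective f L)
    (h : Descent a Λ P D η y c₀ K) (ha : Tendsto a atTop (𝓝 0))
    (hP : ∀ k, ‖gradient f (y k)‖ ≤ P k) :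
    ∃ M, 0 ≤ M ∧ ∀ᶠ k in atTop, ‖gradient f (y (k + 1))‖ ^ 2 ≤
      ‖gradient f (y k)‖ ^ 2 + M * (a k * P k ^ 2 + a k * η k) := by
  have hL := hf.L_pos
  have hK := h.K_nonneg
  refine ⟨3 * (L * K) + 2 * (L * K) ^ 2, by positivity, ?_⟩
  filter_upwards [h.step, ha.eventually_lt_const one_pos] with k h1 h2
  have hak := h.a_nonneg k
  have hPk := h.P_nonneg k
  have hgP := hP k
  have hηk := h.η_nonneg k
  set e := √(η k) with he
  have he0 : 0 ≤ e := Real.sqrt_nonneg _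
  have hes : e ^ 2 = η k := Real.sq_sqrt hηk
  set g := ‖gradient f (y k)‖ with hg
  have hg0 : 0 ≤ g := norm_nonneg _
  set X := L * K with hX
  have hX0 : 0 ≤ X := by positivity
  have h3 : ‖gradient f (y (k + 1))‖ ≤ g + X * (a k * (P k + e)) := by
    have h4 := norm_add_le (gradient f (y k)) (gradient f (y (k + 1)) - gradient f (y k))
    rw [add_sub_cancel] at h4
    have h5 := (hf.lipschitz (y (k + 1)) (y k)).trans (mul_le_mul_of_nonneg_left h1 hL.le)
    calc _ ≤ g + L * (K * (a k * (P k + e))) := by linarith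
      _ = _ := by rw [hX]; ring
  have h4 := pow_le_pow_left₀ (norm_nonneg _) h3 2
  have h5 : g * (P k + e) ≤ 3 / 2 * (P k ^ 2 + η k) := by
    rw [← hes]
    nlinarith [mul_le_mul_of_nonneg_right hgP (by positivity : 0 ≤ P k + e), sq_nonneg (P k - e)]
  have h6 : (P k + e) ^ 2 ≤ 2 * (P k ^ 2 + η k) := by
    rw [← hes]; nlinarith [sq_nonneg (P k - e)]
  have h7 : a k ^ 2 ≤ a k := by nlinarith
  calc ‖gradient f (y (k + 1))‖ ^ 2 ≤ (g + X * (a k * (P k + e))) ^ 2 := h4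
    _ = g ^ 2 + 2 * X * a k * (g * (P k + e)) + X ^ 2 * (a k ^ 2 * (P k + e) ^ 2) := by ring
    _ ≤ g ^ 2 + 2 * X * a k * (3 / 2 * (P k ^ 2 + η k)) +
        X ^ 2 * (a k * (2 * (P k ^ 2 + η k))) := by gcongr
    _ = _ := by ring

end


/-! ### Convergence of trajectories to critical points. -/

section

variable {d : ℕ} {f : Vec d → ℝ} {L lam c κ γ a₀ : ℝ} {a η : ℕ → ℝ} {y n m δ : ℕ → Vec d}
  {x : ℕ → Vec d} {p : Vec d}

lemma IsStep.summable_mul_rpow (h : IsStep γ a₀ a) {s : ℝ} (hs : 1 < γ + s) :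
    Summable fun k : ℕ => a k * (k : ℝ) ^ (-s) := by
  have h1 : Summable fun k : ℕ => (k : ℝ) ^ (-γ - s) := Real.summable_nat_rpow.2 (by linarith)
  refine (h1.mul_left a₀).of_norm_bounded_eventually_nat ?_
  filter_upwards [h.le, eventually_ge_atTop 1] with k hk hk1
  have hk0 : (0 : ℝ) < k := by exact_mod_cast hk1
  rw [Real.norm_of_nonneg (mul_nonneg (h.nonneg k) (by positivity)), sub_eq_add_neg,
    Real.rpow_add hk0, Real.rpow_neg hk0.le γ, ← mul_assoc]
  exact mul_le_mul_of_nonneg_right hk (by positivity)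

lemma NoiseRates.summable (h : NoiseRates γ a η) (hγ : 1 / 2 < γ) :
    Summable fun k => a k * η k := by
  simpa using (h.rpow 0 (by linarith)).2

lemma NoiseRates.exists_tailSum_le (h : NoiseRates γ a η) (ha : ∀ k, 0 ≤ a k) (hη : ∀ k, 0 ≤ η k)
    {r : ℝ} (hr0 : 0 ≤ r) (hr : r < 2 * γ - 1) :
    ∃ S, 0 ≤ S ∧ ∀ᶠ k : ℕ in atTop,
      tailSum (fun i => a i * η i) k ≤ S * (k : ℝ) ^ (-r) := by
  have h1 : Summable fun k : ℕ => (k : ℝ) ^ r * (a k * η k) :=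
    (h.rpow r hr).2.congr fun k => by ring
  have h2 := weight_mul_tailSum_le (w := fun k : ℕ => (k : ℝ) ^ r)
    (fun k => mul_nonneg (ha k) (hη k)) (fun k => by positivity)
    (Eventually.of_forall fun k => Real.rpow_le_rpow (by positivity) (by push_cast; linarith) hr0)
    (h.summable (by linarith)) h1
  refine ⟨∑' i : ℕ, (i : ℝ) ^ r * (a i * η i), tsum_nonneg fun i =>
    mul_nonneg (by positivity) (mul_nonneg (ha i) (hη i)), ?_⟩
  filter_upwards [h2, eventually_ge_atTop 1] with k hk hk1
  have hk0 : (0 : ℝ) < k := by exact_mod_cast hk1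
  rwa [Real.rpow_neg hk0.le, ← div_eq_mul_inv, le_div_iff₀' (by positivity)]

lemma NoiseRates.summable_mul_tailSum_rpow (h : NoiseRates γ a η) (ha : IsStep γ a₀ a)
    (hη : ∀ k, 0 ≤ η k) {r θ : ℝ} (hr0 : 0 ≤ r) (hr : r < 2 * γ - 1) (hθ : 0 ≤ θ)
    (hrθ : 1 < γ + r * θ) :
    Summable fun k => a k * tailSum (fun i => a i * η i) k ^ θ := by
  obtain ⟨S, hS, hT⟩ := h.exists_tailSum_le ha.nonneg hη hr0 hr
  refine ((ha.summable_mul_rpow hrθ).mul_left (S ^ θ)).of_norm_bounded_eventually_nat ?_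
  filter_upwards [hT] with k hk
  have h0 := tailSum_nonneg (fun i => mul_nonneg (ha.nonneg i) (hη i)) k
  have h1 := Real.rpow_le_rpow h0 hk hθ
  rw [Real.mul_rpow hS (by positivity), ← Real.rpow_mul (by positivity), neg_mul] at h1
  rw [Real.norm_of_nonneg (mul_nonneg (ha.nonneg k) (by positivity))]
  calc _ ≤ a k * (S ^ θ * (k : ℝ) ^ (-(r * θ))) := mul_le_mul_of_nonneg_left h1 (ha.nonneg k)
    _ = _ := by ring

/-- Split √η as a product and use the arithmetic-geometric mean: √η ≤ k^r η + k^{-r}, both summable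
against `a`. -/
lemma NoiseRates.summable_mul_sqrt (h : NoiseRates γ a η) (ha : IsStep γ a₀ a)
    (hη : ∀ k, 0 ≤ η k) {r : ℝ} (hr : r < 2 * γ - 1) (hr1 : 1 < γ + r) :
    Summable fun k => a k * √(η k) := by
  refine ((h.rpow r hr).2.add (ha.summable_mul_rpow hr1)).of_norm_bounded_eventually_nat ?_
  filter_upwards [eventually_ge_atTop 1] with k hk1
  have hk0 : (0 : ℝ) < k := by exact_mod_cast hk1
  rw [Real.norm_of_nonneg (mul_nonneg (ha.nonneg k) (by positivity)), ← mul_add]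
  refine mul_le_mul_of_nonneg_left ?_ (ha.nonneg k)
  have h1 : 0 ≤ (k : ℝ) ^ r * η k := mul_nonneg (by positivity) (hη k)
  have h2 : 0 ≤ (k : ℝ) ^ (-r) := by positivity
  refine Real.sqrt_le_iff.2 ⟨by positivity, ?_⟩
  have h3 : ((k : ℝ) ^ r * η k) * (k : ℝ) ^ (-r) = η k := by
    rw [Real.rpow_neg hk0.le]; field_simp
  nlinarith

lemma tendsto_zero_of_norm_sq {E : Type*} [NormedAddCommGroup E] {u : ℕ → E}
    (h : Tendsto (fun k => ‖u k‖ ^ 2) atTop (𝓝 0)) : Tendsto u atTop (𝓝 0) := by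
  rw [tendsto_zero_iff_norm_tendsto_zero]
  have := h.sqrt
  simpa [Real.sqrt_sq (norm_nonneg _)] using this

lemma NoiseRates.tendsto_zero (h : NoiseRates γ a fun k => ‖n k‖ ^ 2 + ‖m k‖ ^ 2)
    (hγ : 1 / 2 < γ) : Tendsto n atTop (𝓝 0) ∧ Tendsto m atTop (𝓝 0) := by
  have h1 : Tendsto (fun k => ‖n k‖ ^ 2 + ‖m k‖ ^ 2) atTop (𝓝 0) := by
    simpa using (h.rpow 0 (by linarith)).1
  refine ⟨tendsto_zero_of_norm_sq (squeeze_zero (fun k => sq_nonneg _) (fun k => ?_) h1),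
    tendsto_zero_of_norm_sq (squeeze_zero (fun k => sq_nonneg _) (fun k => ?_) h1)⟩
  · linarith [sq_nonneg ‖m k‖]
  · linarith [sq_nonneg ‖n k‖]

namespace Trajectory

/-- A bounded-along-a-subsequence trajectory converges to a critical point. -/
theorem exists_tendsto (hf : SmoothObjective f L) (hLoj : SatisfiesLojasiewicz f)
    (h : Trajectory f lam c κ a y n m δ) (hlam : 0 ≤ lam) (hlam1 : lam < 1)
    (hγ : 2 / 3 < γ) (hγ1 : γ ≤ 1) (ha : IsStep γ a₀ a)
    (hη : NoiseRates γ a fun k => ‖n k‖ ^ 2 + ‖m k‖ ^ 2)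
    {c' : ℝ} (hx : ∀ᶠ k in atTop, x k = y k + n k - c' • (δ k + m k))
    {B : ℝ} (hB : ∃ᶠ k in atTop, ‖x k‖ ≤ B) :
    ∃ p ∈ crit f, Tendsto x atTop (𝓝 p) ∧ Tendsto y atTop (𝓝 p) ∧
      Tendsto (fun k => ‖δ k‖ ^ 2) atTop (𝓝 0) := by
  have ha0 := ha.tendsto_zero (by linarith)
  have hη0 : ∀ k, 0 ≤ ‖n k‖ ^ 2 + ‖m k‖ ^ 2 := fun k => by positivity
  have hs := hη.summable (by linarith)
  obtain ⟨fbar, hfbar⟩ := hf.bddBelow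
  -- This first descent, with weight B = 1, serves only to produce limits and a cluster point; the
  -- Łojasiewicz constant is not known before the cluster point is.
  obtain ⟨K₁, hD₁⟩ := h.descent hf hlam hlam1 ha.nonneg ha0 le_rfl
  obtain ⟨ℓ, hℓ⟩ := hD₁.exists_limit hs (B := fbar) fun k => by
    have := hfbar (y k); have := sq_nonneg ‖δ k‖; linarith
  obtain ⟨hsP, hsD⟩ := hD₁.summable_dissipation hs hℓ
  have hδ := hsD.tendsto_atTop_zero
  have hfy : Tendsto (fun k => f (y k)) atTop (𝓝 ℓ) := by
    have := hℓ.sub hδ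
    rw [sub_zero] at this
    exact this.congr fun k => by ring
  have hgP : ∀ k, ‖gradient f (y k)‖ ≤ √(‖gradient f (y k)‖ ^ 2 + 1 * ‖δ k‖ ^ 2) := fun k =>
    Real.le_sqrt_of_sq_le (by have := sq_nonneg ‖δ k‖; linarith)
  obtain ⟨M, hM, hgrad⟩ := hD₁.exists_gradient_step hf ha0 hgP
  -- Summability of a‖∇f(y)‖² alone gives only a zero lower limit; the summable upward increments
  -- upgrade it to a limit.
  have hG : Tendsto (fun k => ‖gradient f (y k)‖ ^ 2) atTop (𝓝 0) := by
    refine tendsto_zero_of_le_add ha.nonneg (ha.not_summable hγ1) (fun k => sq_nonneg _)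
      (fun k => ?_) ((hsP.add hs).mul_left M) hgrad ?_
    · have := ha.nonneg k; have := hη0 k; positivity
    · refine Summable.of_nonneg_of_le (fun k => mul_nonneg (ha.nonneg k) (sq_nonneg _))
        (fun k => mul_le_mul_of_nonneg_left ?_ (ha.nonneg k)) hsP
      exact pow_le_pow_left₀ (norm_nonneg _) (hgP k) 2
  obtain ⟨hn0, hm0⟩ := hη.tendsto_zero (by linarith)
  have hr0 : Tendsto (fun k => n k - c' • (δ k + m k)) atTop (𝓝 0) := by
    simpa using hn0.sub (((tendsto_zero_of_norm_sq hδ).add hm0).const_smul c')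
  have hBy : ∃ᶠ k in atTop, ‖y k‖ ≤ B + 1 := by
    refine (hB.and_eventually (hx.and
      ((tendsto_zero_iff_norm_tendsto_zero.1 hr0).eventually_lt_const one_pos))).mono ?_
    rintro k ⟨h1, h2, h3⟩
    have h4 : y k = x k - (n k - c' • (δ k + m k)) := by rw [h2]; abel
    rw [h4]
    exact (norm_sub_le _ _).trans (by linarith)
  obtain ⟨p, -, hp⟩ := (isCompact_closedBall (0 : Vec d) (B + 1)).exists_mapClusterPt_of_frequently
    (hBy.mono fun k hk => by simpa [Metric.mem_closedBall] using hk)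
  obtain ⟨ψ, hψ, hyψ⟩ := MapClusterPt.tendsto_subseq hp
  have hcrit : p ∈ crit f := by
    have h1 := ((hf.continuous_gradient.tendsto p).comp hyψ).norm.pow 2
    have h2 := tendsto_nhds_unique h1 (hG.comp hψ.tendsto_atTop)
    simpa [crit] using h2
  have hfp : f p = ℓ :=
    tendsto_nhds_unique ((hf.differentiable.continuous.tendsto p).comp hyψ)
      (hfy.comp hψ.tendsto_atTop)
  suffices hy : Tendsto y atTop (𝓝 p) by
    have h1 := hy.add hr0
    rw [add_zero] at h1
    refine ⟨p, hcrit, h1.congr' ?_, hy, hδ⟩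
    filter_upwards [hx] with k hk
    rw [hk]; abel
  obtain ⟨θ₀, hθ₀, hθ₀1, hL₀⟩ := hLoj p hcrit
  obtain ⟨C, hC, hLC⟩ := hL₀.exists_bound (by linarith)
  -- Raising the exponent to 1/γ - 1/2, which is below 1 exactly when γ > 2/3, makes the series of
  -- a_k times the θ-th power of the tail converge.
  set θ := max θ₀ (1 / γ - 1 / 2) with hθ
  have hγ0 : 0 < γ := by linarith
  have hθ1 : θ < 1 := max_lt hθ₀1 (by
    have : 1 / γ < 3 / 2 := by rw [div_lt_iff₀ hγ0]; linarith
    linarith)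
  have hθh : 1 / 2 ≤ θ := hθ₀.trans (le_max_left _ _)
  have hLC' := hLC.mono_exponent hC (by linarith) (le_max_left θ₀ (1 / γ - 1 / 2))
  rw [← hfp] at hfy hℓ
  obtain ⟨R, hR, hloj⟩ := hLC'.energy hC hθh hθ1.le hfy hδ
  obtain ⟨K₂, hD₂⟩ := h.descent hf hlam hlam1 ha.nonneg ha0
    (show 1 ≤ 1 + C ^ 2 by have := sq_nonneg C; linarith)
  refine hD₂.tendsto_of_loj hs hℓ (by linarith) hθ1 (by positivity) hR hloj hp ?_ ?_
  -- The exponent γ/2 is below 2γ-1 since γ > 2/3, and γ + (γ/2)θ ≥ 3γ/4 + 1/2 > 1.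
  · refine hη.summable_mul_tailSum_rpow ha hη0 (r := γ / 2) (by linarith) (by linarith)
      (by linarith) ?_
    have h1 : 1 / γ - 1 / 2 ≤ θ := le_max_right _ _
    have h2 : γ / 2 * (1 / γ - 1 / 2) = 1 / 2 - γ / 4 := by field_simp; ring
    nlinarith
  · exact hη.summable_mul_sqrt ha hη0 (r := γ / 2) (by linarith) (by linarith)

end Trajectory

end


/-! ### Weights and steps over dyadic windows; rates for the shifted iterates. -/

/-- The growth condition says that w_k/k is eventually nonincreasing; halving the index thus costs
only a constant. -/
lemma IsWeight.exists_le_mul {γ : ℝ} {w : ℕ → ℝ} (hw : IsWeight γ w) :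
    ∃ N, ∀ j ≥ N, ∀ k ≥ j, w k * j ≤ w j * k := by
  obtain ⟨N, hN⟩ := eventually_atTop.1 hw.growth
  refine ⟨max N 1, fun j hj k hk => ?_⟩
  induction k, hk using Nat.le_induction with
  | base => exact le_rfl
  | succ k hk ih =>
    have hk1 : 1 ≤ k := ((le_max_right _ _).trans hj).trans hk
    have hk0 : (0 : ℝ) < k := by exact_mod_cast hk1
    have h1 := hN k (((le_max_left _ _).trans hj).trans hk)
    calc w (k + 1) * j ≤ ((1 + 1 / (k : ℝ)) * w k) * j := by gcongr
      _ = (1 + 1 / (k : ℝ)) * (w k * j) := by ring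
      _ ≤ (1 + 1 / (k : ℝ)) * (w j * k) := by gcongr
      _ = w j * (k + 1 : ℕ) := by push_cast; field_simp

lemma IsWeight.inv_half_le {γ : ℝ} {w : ℕ → ℝ} (hw : IsWeight γ w) :
    ∀ᶠ k in atTop, (w (k / 2))⁻¹ ≤ 3 * (w k)⁻¹ := by
  obtain ⟨N, hN⟩ := hw.exists_le_mul
  obtain ⟨N', hN'⟩ := eventually_atTop.1 hw.pos
  filter_upwards [eventually_ge_atTop (2 * (N + N' + 1))] with k hk
  have hj : N + N' + 1 ≤ k / 2 := by omega
  have h1 := hN (k / 2) (by omega) k (by omega)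
  have hp := hN' (k / 2) (by omega)
  have hpk := hN' k (by omega)
  have hj0 : (0 : ℝ) < (k / 2 : ℕ) := by
    have : 0 < k / 2 := by omega
    exact_mod_cast this
  have h2 : (k : ℝ) ≤ 3 * (k / 2 : ℕ) := by
    have : k ≤ 3 * (k / 2) := by omega
    exact_mod_cast this
  have h3 : w k ≤ 3 * w (k / 2) := by
    have : w k * (k / 2 : ℕ) ≤ (3 * w (k / 2)) * (k / 2 : ℕ) := by
      calc _ ≤ w (k / 2) * k := h1
        _ ≤ w (k / 2) * (3 * (k / 2 : ℕ)) := by gcongr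
        _ = _ := by ring
    exact le_of_mul_le_mul_right this hj0
  rw [← div_eq_mul_inv, le_div_iff₀ hpk, inv_mul_le_iff₀ hp]
  linarith

lemma tendsto_half : Tendsto (fun k : ℕ => k / 2) atTop atTop :=
  Nat.tendsto_div_const_atTop two_ne_zero

/-- Windows [k/2, k) carry a total step bounded below because γ ≤ 1; averaging the squared gradient
over them then loses only a constant. -/
lemma IsStep.le_sum_half {γ a₀ : ℝ} {a : ℕ → ℝ} (ha : IsStep γ a₀ a) (hγ1 : γ ≤ 1) :
    ∀ᶠ k in atTop, a₀ / 4 ≤ ∑ i ∈ Finset.Ico (k / 2) k, a i := by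
  obtain ⟨N, hN⟩ := eventually_atTop.1 ha.ge
  filter_upwards [eventually_ge_atTop (2 * (N + 1))] with k hk
  have ha0 := ha.pos
  have hk0 : (0 : ℝ) < k := by
    have : 0 < k := by omega
    exact_mod_cast this
  have h1 : ∀ i ∈ Finset.Ico (k / 2) k, a₀ / 2 / k ≤ a i := by
    intro i hi
    obtain ⟨hi1, hi2⟩ := Finset.mem_Ico.1 hi
    refine le_trans ?_ (hN i (by omega))
    have hi0 : (1 : ℝ) ≤ i := by
      have : 1 ≤ i := by omega
      exact_mod_cast this
    refine div_le_div_of_nonneg_left (by positivity) (by positivity) ?_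
    calc (i : ℝ) ^ γ ≤ (i : ℝ) ^ (1 : ℝ) := Real.rpow_le_rpow_of_exponent_le hi0 hγ1
      _ = i := Real.rpow_one _
      _ ≤ k := by exact_mod_cast hi2.le
  have h2 := Finset.card_nsmul_le_sum _ _ _ h1
  refine le_trans ?_ h2
  rw [Nat.card_Ico, nsmul_eq_mul, ← mul_div_assoc, le_div_iff₀ hk0]
  have h3 : (k : ℝ) ≤ 2 * (k - k / 2 : ℕ) := by
    have : k ≤ 2 * (k - k / 2) := by omega
    exact_mod_cast this
  nlinarith

lemma IsStep.sum_double_le {γ a₀ : ℝ} {a : ℕ → ℝ} (ha : IsStep γ a₀ a) (hγ0 : 0 ≤ γ) :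
    ∀ᶠ k : ℕ in atTop, ∑ i ∈ Finset.Ico k (2 * k), a i ≤ a₀ * (k : ℝ) ^ (1 - γ) := by
  obtain ⟨N, hN⟩ := eventually_atTop.1 ha.le
  filter_upwards [eventually_ge_atTop (N + 1)] with k hk
  have ha0 := ha.pos
  have hk0 : (0 : ℝ) < k := by
    have : 0 < k := by omega
    exact_mod_cast this
  have h1 : ∀ i ∈ Finset.Ico k (2 * k), a i ≤ a₀ / (k : ℝ) ^ γ := by
    intro i hi
    obtain ⟨hi1, hi2⟩ := Finset.mem_Ico.1 hi
    refine (hN i (by omega)).trans ?_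
    gcongr
  refine (Finset.sum_le_card_nsmul _ _ _ h1).trans (le_of_eq ?_)
  rw [Nat.card_Ico, nsmul_eq_mul, Real.rpow_sub hk0, Real.rpow_one,
    show 2 * k - k = k by omega]
  ring

section

variable {d : ℕ} {f : Vec d → ℝ} {L lam c κ γ a₀ : ℝ} {a : ℕ → ℝ} {x y n m δ : ℕ → Vec d}
  {p : Vec d}

/-- Rates for the shifted iterates. -/
theorem Trajectory.exists_rates (hf : SmoothObjective f L)
    (h : Trajectory f lam c κ a y n m δ) (hlam : 0 ≤ lam) (hlam1 : lam < 1)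
    (hγ : 1 / 2 < γ) (hγ1 : γ ≤ 1) (ha : IsStep γ a₀ a)
    (hs : Summable fun k => a k * (‖n k‖ ^ 2 + ‖m k‖ ^ 2))
    (hy : Tendsto y atTop (𝓝 p)) (hδ : Tendsto (fun k => ‖δ k‖ ^ 2) atTop (𝓝 0))
    {θ C : ℝ} (hθ : 1 / 2 ≤ θ) (hθ1 : θ ≤ 1) (hC : 0 < C) (hLoj : LojasiewiczBound f p θ C)
    {w : ℕ → ℝ} (hw : IsWeight γ w) (hη : NoiseDecay a w fun k => ‖n k‖ ^ 2 + ‖m k‖ ^ 2)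
    (hb : ∀ᶠ k in atTop, (w k)⁻¹ - (w (k + 1))⁻¹ ≤
      C ^ 2 / 4 * (1 / 2) ^ (2 * θ) * a k * (w (k + 1))⁻¹ ^ (2 * θ))
    {q : ℝ} (hq1 : q < 1) (hq : ∀ᶠ k : ℕ in atTop,
      √(((2 * k : ℕ) : ℝ) ^ (1 - γ) * (w (2 * k))⁻¹) ≤ q * √((k : ℝ) ^ (1 - γ) * (w k)⁻¹)) :
    ∃ A, 0 ≤ A ∧ ∀ᶠ k : ℕ in atTop, |f (y k) - f p| ≤ A * (w k)⁻¹ ∧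
      ‖gradient f (y k)‖ ^ 2 ≤ A * (w k)⁻¹ ∧ ‖δ k‖ ^ 2 ≤ A * (w k)⁻¹ ∧
      ‖y k - p‖ ≤ A * √((k : ℝ) ^ (1 - γ) * (w k)⁻¹) := by
  have ha0 := ha.tendsto_zero (by linarith)
  have hapos := ha.pos
  have hη0 : ∀ k, 0 ≤ ‖n k‖ ^ 2 + ‖m k‖ ^ 2 := fun k => by positivity
  have haη0 : ∀ k, 0 ≤ a k * (‖n k‖ ^ 2 + ‖m k‖ ^ 2) := fun k => mul_nonneg (ha.nonneg k) (hη0 k)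
  have hfy : Tendsto (fun k => f (y k)) atTop (𝓝 (f p)) :=
    (hf.differentiable.continuous.tendsto p).comp hy
  have hΛ : Tendsto (fun k => f (y k) + ‖δ k‖ ^ 2) atTop (𝓝 (f p)) := by
    simpa using hfy.add hδ
  obtain ⟨R, hR, hloj⟩ := hLoj.energy hC hθ hθ1 hfy hδ
  have hloj' : ∀ᶠ k in atTop, C / √2 * |f (y k) + ‖δ k‖ ^ 2 - f p| ^ θ ≤
      √(‖gradient f (y k)‖ ^ 2 + (1 + C ^ 2) * ‖δ k‖ ^ 2) := by
    filter_upwards [hloj, (Metric.tendsto_nhds.1 hy) R hR] with k h1 h2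
    exact h1 (by rwa [dist_eq_norm] at h2)
  obtain ⟨K, hD⟩ := h.descent hf hlam hlam1 ha.nonneg ha0
    (show 1 ≤ 1 + C ^ 2 by have := sq_nonneg C; linarith)
  have hK := hD.K_nonneg
  set T := tailSum fun k => a k * (‖n k‖ ^ 2 + ‖m k‖ ^ 2) with hT
  set r := excess a (fun k => f (y k) + ‖δ k‖ ^ 2) (fun k => ‖n k‖ ^ 2 + ‖m k‖ ^ 2) K (f p) with hr
  set U := ∑' i, w i * (a i * (‖n i‖ ^ 2 + ‖m i‖ ^ 2)) with hU
  have hU0 : 0 ≤ U := tsum_nonneg fun i => mul_nonneg (hw.nonneg i) (haη0 i)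
  have hTU : ∀ᶠ k in atTop, T k ≤ U * (w k)⁻¹ := by
    filter_upwards [weight_mul_tailSum_le haη0 hw.nonneg hw.mono hs
      (hη.2.congr fun k => by ring), hw.pos] with k h1 h2
    rwa [← div_eq_mul_inv, le_div_iff₀' h2]
  have hT0 : ∀ k, 0 ≤ T k := tailSum_nonneg haη0
  have hs2 : (√2 : ℝ) ^ 2 = 2 := Real.sq_sqrt (by norm_num)
  obtain ⟨A, hA, hrA⟩ := hD.exists_excess_le_mul (ℓ := f p) (U := K * U) (b := fun k => (w k)⁻¹)
    hs hθ (by positivity) hloj' (hw.pos.mono fun k hk => by positivity)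
    (by
      filter_upwards [hw.growth, hw.pos, (tendsto_add_atTop_nat 1).eventually hw.pos,
        eventually_ge_atTop 1] with k h1 h2 h3 h4
      have hk1 : (1 : ℝ) ≤ k := by exact_mod_cast h4
      have h5 : 1 / (k : ℝ) ≤ 1 := by rw [div_le_one (by linarith)]; exact hk1
      rw [← div_eq_mul_inv, le_div_iff₀ h3, inv_mul_le_iff₀ h2]
      nlinarith)
    (by
      filter_upwards [hTU] with k hk
      have := mul_le_mul_of_nonneg_left hk hK
      linarith)
    (by
      filter_upwards [hb] with k hk
      -- With c = C/√2 the constant c²/2 of the comparison principle is C²/4.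
      rw [div_pow, hs2, div_div]
      norm_num at hk ⊢
      exact hk)
  have hr0 := hD.excess_nonneg hs hΛ
  have hgP : ∀ k, ‖gradient f (y k)‖ ≤ √(‖gradient f (y k)‖ ^ 2 + (1 + C ^ 2) * ‖δ k‖ ^ 2) :=
    fun k => Real.le_sqrt_of_sq_le (by
      have : 0 ≤ (1 + C ^ 2) * ‖δ k‖ ^ 2 := by positivity
      linarith)
  have hbδ : ∀ᶠ k in atTop, ‖δ k‖ ^ 2 ≤ (4 / (1 - lam) * A) * (w k)⁻¹ := by
    filter_upwards [hrA, hD.excess_decrease (ℓ := f p) hs,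
      (tendsto_add_atTop_nat 1).eventually hr0] with k h1 h2 h3
    have h4 : 0 ≤ a k / 2 * √(‖gradient f (y k)‖ ^ 2 + (1 + C ^ 2) * ‖δ k‖ ^ 2) ^ 2 := by
      have := ha.nonneg k
      positivity
    have h5 : (1 - lam) / 4 * ‖δ k‖ ^ 2 ≤ A * (w k)⁻¹ := by linarith
    have h6 : 0 < 1 - lam := by linarith
    calc ‖δ k‖ ^ 2 = 4 / (1 - lam) * ((1 - lam) / 4 * ‖δ k‖ ^ 2) := by field_simp
      _ ≤ 4 / (1 - lam) * (A * (w k)⁻¹) := by gcongr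
      _ = _ := by ring
  have hbf : ∀ᶠ k in atTop, |f (y k) - f p| ≤ (A + K * U + 4 / (1 - lam) * A) * (w k)⁻¹ := by
    filter_upwards [hrA, hTU, hr0, hbδ] with k h1 h2 h3 h4
    have h5 : r k = f (y k) + ‖δ k‖ ^ 2 - f p + K * T k := rfl
    have h6 : 0 ≤ K * T k := mul_nonneg hK (hT0 k)
    have h7 : K * T k ≤ K * (U * (w k)⁻¹) := by gcongr
    have h8 : 0 ≤ A * (w k)⁻¹ := h3.trans h1
    have h9 := sq_nonneg ‖δ k‖
    rw [abs_le]
    constructor <;> linarith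
  obtain ⟨M, hM, hgrad⟩ := hD.exists_gradient_step hf ha0 hgP
  -- The dissipation bounds only averages of ‖∇f(y)‖². Since its upward increments are controlled by
  -- dissipation and noise, the last value of a window is bounded by the window average plus a term
  -- of the same order.
  have hbG : ∀ᶠ k in atTop, ‖gradient f (y k)‖ ^ 2 ≤
      ((8 * A / a₀ + M * (2 * A + U)) * 3) * (w k)⁻¹ := by
    obtain ⟨N, hN⟩ := eventually_atTop.1 hgrad
    filter_upwards [ha.le_sum_half hγ1, hw.inv_half_le, tendsto_half.eventually hrA,
      tendsto_half.eventually hTU, tendsto_half.eventually (hD.sum_dissipation_le hs hΛ),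
      tendsto_half.eventually_ge_atTop N] with k h1 h2 h3 h4 h5 h6
    set j := k / 2 with hj
    have hjk : j ≤ k := Nat.div_le_self _ _
    have h7 := h5 k hjk
    have h8 := sum_Ico_le_tailSum haη0 hs hjk
    have h9 : ∑ i ∈ Finset.Ico j k,
        M * (a i * √(‖gradient f (y i)‖ ^ 2 + (1 + C ^ 2) * ‖δ i‖ ^ 2) ^ 2 +
          a i * (‖n i‖ ^ 2 + ‖m i‖ ^ 2)) ≤ M * (2 * r j + T j) := by
      rw [← Finset.mul_sum, Finset.sum_add_distrib]
      gcongr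
    have h10 := sum_mul_le_of_le_add (v := fun i => ‖gradient f (y i)‖ ^ 2) ha.nonneg (fun i => by
      have := ha.nonneg i; have := hη0 i; positivity) hN h6 h9
    have h11 : ∑ i ∈ Finset.Ico j k, a i * ‖gradient f (y i)‖ ^ 2 ≤ 2 * r j := by
      refine le_trans (Finset.sum_le_sum fun i _ => mul_le_mul_of_nonneg_left ?_ (ha.nonneg i)) h7
      exact pow_le_pow_left₀ (norm_nonneg _) (hgP i) 2
    set S := ∑ i ∈ Finset.Ico j k, a i with hS
    have hS0 : 0 < S := lt_of_lt_of_le (by positivity) h1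
    have hrj0 : 0 ≤ r j := by
      have : 0 ≤ ∑ i ∈ Finset.Ico j k, a i * ‖gradient f (y i)‖ ^ 2 :=
        Finset.sum_nonneg fun i _ => mul_nonneg (ha.nonneg i) (sq_nonneg _)
      linarith
    have h12 : ‖gradient f (y k)‖ ^ 2 ≤ 8 * r j / a₀ + M * (2 * r j + T j) := by
      have h13 : S * ‖gradient f (y k)‖ ^ 2 ≤ S * (8 * r j / a₀ + M * (2 * r j + T j)) := by
        have h14 : 2 * r j ≤ S * (8 * r j / a₀) := by
          calc 2 * r j = a₀ / 4 * (8 * r j / a₀) := by field_simp; ring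
            _ ≤ _ := by gcongr
        linarith
      exact le_of_mul_le_mul_left h13 hS0
    calc ‖gradient f (y k)‖ ^ 2 ≤ 8 * r j / a₀ + M * (2 * r j + T j) := h12
      _ ≤ 8 * (A * (w j)⁻¹) / a₀ + M * (2 * (A * (w j)⁻¹) + U * (w j)⁻¹) := by gcongr
      _ = (8 * A / a₀ + M * (2 * A + U)) * (w j)⁻¹ := by ring
      _ ≤ (8 * A / a₀ + M * (2 * A + U)) * (3 * (w k)⁻¹) := by gcongr
      _ = _ := by ring
  set A' := K * √(a₀ * (4 * A + 2 * U)) with hA'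
  have hby : ∀ᶠ k : ℕ in atTop,
      ‖y k - p‖ ≤ (A' * √((k : ℝ) ^ (1 - γ) * (w k)⁻¹)) / (1 - q) := by
    refine norm_sub_le_of_doubling hq1 hy (Eventually.of_forall fun k => by positivity) ?_ ?_
    · filter_upwards [hq] with k hk
      calc _ ≤ A' * (q * √((k : ℝ) ^ (1 - γ) * (w k)⁻¹)) :=
            mul_le_mul_of_nonneg_left hk (by positivity)
        _ = _ := by ring
    · filter_upwards [hD.norm_sub_le_sqrt hs hΛ, ha.sum_double_le (by linarith), hrA, hTU, hr0,
        hw.pos] with k h1 h2 h3 h4 h5 h6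
      refine (h1 (2 * k) (by omega)).trans ?_
      rw [hA', mul_assoc, ← Real.sqrt_mul (by positivity)]
      refine mul_le_mul_of_nonneg_left (Real.sqrt_le_sqrt ?_) hK
      have h7 := hT0 k
      calc (∑ i ∈ Finset.Ico k (2 * k), a i) * (4 * r k + 2 * T k)
          ≤ (a₀ * (k : ℝ) ^ (1 - γ)) * (4 * (A * (w k)⁻¹) + 2 * (U * (w k)⁻¹)) := by gcongr
        _ = _ := by ring
  have h1lam : 0 < 1 - lam := by linarith
  have h1q : 0 < 1 - q := by linarith
  set A₁ := A + K * U + 4 / (1 - lam) * A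
  set A₂ := (8 * A / a₀ + M * (2 * A + U)) * 3
  set A₃ := 4 / (1 - lam) * A
  have hA₁ : 0 ≤ A₁ := by positivity
  have hA₂ : 0 ≤ A₂ := by positivity
  have hA₃ : 0 ≤ A₃ := by positivity
  have hA₄ : 0 ≤ A' / (1 - q) := by positivity
  refine ⟨A₁ + A₂ + A₃ + A' / (1 - q), by positivity, ?_⟩
  filter_upwards [hbf, hbG, hbδ, hby, hw.pos] with k h1 h2 h3 h4 h5
  have h6 : 0 ≤ (w k)⁻¹ := by positivity
  refine ⟨h1.trans ?_, h2.trans ?_, h3.trans ?_, h4.trans ?_⟩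
  · gcongr; linarith
  · gcongr; linarith
  · gcongr; linarith
  · rw [mul_div_right_comm]
    gcongr; linarith

end


/-! ### Rates for the iterates, polynomial and logarithmic. -/

section

variable {d : ℕ} {f : Vec d → ℝ} {L lam c κ γ a₀ : ℝ} {a : ℕ → ℝ} {x y n m δ : ℕ → Vec d}
  {p : Vec d}

/-- Rates for the iterates. -/
theorem Trajectory.exists_rates_iterates (hf : SmoothObjective f L)
    (h : Trajectory f lam c κ a y n m δ) (hlam : 0 ≤ lam) (hlam1 : lam < 1)
    (hγ : 1 / 2 < γ) (hγ1 : γ ≤ 1) (ha : IsStep γ a₀ a) {c' : ℝ}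
    (hx : ∀ᶠ k in atTop, x k = y k + n k - c' • (δ k + m k))
    (hs : Summable fun k => a k * (‖n k‖ ^ 2 + ‖m k‖ ^ 2))
    (hy : Tendsto y atTop (𝓝 p)) (hδ : Tendsto (fun k => ‖δ k‖ ^ 2) atTop (𝓝 0))
    {θ C : ℝ} (hθ : 1 / 2 ≤ θ) (hθ1 : θ ≤ 1) (hC : 0 < C) (hLoj : LojasiewiczBound f p θ C)
    {w : ℕ → ℝ} (hw : IsWeight γ w) (hη : NoiseDecay a w fun k => ‖n k‖ ^ 2 + ‖m k‖ ^ 2)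
    (hb : ∀ᶠ k in atTop, (w k)⁻¹ - (w (k + 1))⁻¹ ≤
      C ^ 2 / 4 * (1 / 2) ^ (2 * θ) * a k * (w (k + 1))⁻¹ ^ (2 * θ))
    {q : ℝ} (hq1 : q < 1) (hq : ∀ᶠ k : ℕ in atTop,
      √(((2 * k : ℕ) : ℝ) ^ (1 - γ) * (w (2 * k))⁻¹) ≤ q * √((k : ℝ) ^ (1 - γ) * (w k)⁻¹)) :
    ∃ A, ∀ᶠ k : ℕ in atTop, |f (x k) - f p| ≤ A * (w k)⁻¹ ∧
      ‖gradient f (x k)‖ ^ 2 ≤ A * (w k)⁻¹ ∧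
      ‖x k - p‖ ≤ A * √((k : ℝ) ^ (1 - γ) * (w k)⁻¹) := by
  obtain ⟨A, hA, hr⟩ := h.exists_rates hf hlam hlam1 hγ hγ1 ha hs hy hδ hθ hθ1 hC hLoj hw hη hb
    hq1 hq
  have hL := hf.L_pos
  set A₁ := 3 * (1 + |c'|) ^ 2 * (1 + A) with hA₁
  have hA₁0 : 0 ≤ A₁ := by positivity
  refine ⟨(2 * A + (1 + L) * A₁) + (2 * A + 2 * L ^ 2 * A₁) + (√A₁ + A), ?_⟩
  filter_upwards [hr, hx, hw.pos, hη.1.eventually_lt_const one_pos, eventually_ge_atTop 1] with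
    k ⟨h1, h2, h3, h4⟩ h5 h6 h7 hk
  have hk1 : (1 : ℝ) ≤ k := by exact_mod_cast hk
  set b := (w k)⁻¹ with hb
  have hb0 : 0 < b := by positivity
  have h8 : ‖n k‖ ^ 2 + ‖m k‖ ^ 2 ≤ b := by
    rw [hb, ← one_div, le_div_iff₀' h6]
    exact h7.le
  -- The iterate differs from `y` by n, m and δ, whose squares all decay at the rate `b`; this
  -- preserves the function, gradient and distance rates.
  have h9 : ‖x k - y k‖ ^ 2 ≤ A₁ * b := by
    have h10 : ‖x k - y k‖ ≤ (1 + |c'|) * (‖n k‖ + ‖m k‖ + ‖δ k‖) := by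
      have h11 : x k - y k = n k - c' • (δ k + m k) := by rw [h5]; abel
      rw [h11]
      refine (norm_sub_le _ _).trans ?_
      rw [norm_smul, Real.norm_eq_abs]
      have := mul_le_mul_of_nonneg_left (norm_add_le (δ k) (m k)) (abs_nonneg c')
      have := mul_nonneg (abs_nonneg c') (norm_nonneg (n k))
      have := norm_nonneg (m k)
      have := norm_nonneg (δ k)
      linarith
    refine (norm_add_three_sq_le h10).trans ?_
    have h12 : A₁ * b = 3 * (1 + |c'|) ^ 2 * ((1 + A) * b) := by rw [hA₁]; ring
    rw [h12]
    exact mul_le_mul_of_nonneg_left (by linarith) (by positivity)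
  have hA₁b : 0 ≤ A₁ * b := by positivity
  have hA₁' : 0 ≤ √A₁ := Real.sqrt_nonneg _
  refine ⟨?_, ?_, ?_⟩
  · have h10 := abs_le.1 (hf.abs_sub_sub_inner_le (y k) (x k - y k))
    rw [add_sub_cancel] at h10
    have h11 := abs_le.1 (abs_real_inner_le_norm (gradient f (y k)) (x k - y k))
    have h12 : ‖gradient f (y k)‖ * ‖x k - y k‖ ≤ A * b + A₁ * b := by
      nlinarith [sq_nonneg (‖gradient f (y k)‖ - ‖x k - y k‖), sq_nonneg ‖gradient f (y k)‖,
        sq_nonneg ‖x k - y k‖]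
    have h13 := mul_le_mul_of_nonneg_left h9 hL.le
    have h14 : |f (x k) - f p| ≤ (2 * A + (1 + L) * A₁) * b := by
      have h15 := abs_le.1 h1
      rw [abs_le]
      constructor <;> linarith
    refine h14.trans (mul_le_mul_of_nonneg_right ?_ hb0.le)
    have : 0 ≤ L ^ 2 * A₁ := by positivity
    linarith
  · have h10 : ‖gradient f (x k)‖ ≤ ‖gradient f (y k)‖ + L * ‖x k - y k‖ := by
      have := norm_add_le (gradient f (y k)) (gradient f (x k) - gradient f (y k))
      rw [add_sub_cancel] at this
      linarith [hf.lipschitz (x k) (y k)]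
    have h11 := pow_le_pow_left₀ (norm_nonneg _) h10 2
    have h12 : (‖gradient f (y k)‖ + L * ‖x k - y k‖) ^ 2 ≤
        2 * ‖gradient f (y k)‖ ^ 2 + 2 * L ^ 2 * ‖x k - y k‖ ^ 2 := by
      nlinarith [sq_nonneg (‖gradient f (y k)‖ - L * ‖x k - y k‖)]
    have h13 := mul_le_mul_of_nonneg_left h9 (show 0 ≤ 2 * L ^ 2 by positivity)
    have h14 : ‖gradient f (x k)‖ ^ 2 ≤ (2 * A + 2 * L ^ 2 * A₁) * b := by linarith
    refine h14.trans (mul_le_mul_of_nonneg_right ?_ hb0.le)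
    have : 0 ≤ L * A₁ := by positivity
    linarith
  · have h10 : ‖x k - y k‖ ≤ √A₁ * √((k : ℝ) ^ (1 - γ) * b) := by
      rw [← Real.sqrt_mul hA₁0]
      refine Real.le_sqrt_of_sq_le (h9.trans (mul_le_mul_of_nonneg_left ?_ hA₁0))
      exact le_mul_of_one_le_left hb0.le (Real.one_le_rpow hk1 (by linarith))
    have h11 : ‖x k - p‖ ≤ ‖x k - y k‖ + ‖y k - p‖ := norm_sub_le_norm_sub_add_norm_sub _ _ _
    set β := √((k : ℝ) ^ (1 - γ) * b)
    have hβ : 0 ≤ β := Real.sqrt_nonneg _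
    have h14 : ‖x k - p‖ ≤ (√A₁ + A) * β := by linarith
    refine h14.trans (mul_le_mul_of_nonneg_right ?_ hβ)
    have : 0 ≤ L ^ 2 * A₁ := by positivity
    have : 0 ≤ L * A₁ := by positivity
    linarith

lemma IsWeight.inv_sub_inv_le {w : ℕ → ℝ} (hw : IsWeight γ w) :
    ∀ᶠ k : ℕ in atTop, (w k)⁻¹ - (w (k + 1))⁻¹ ≤ 1 / (k : ℝ) * (w (k + 1))⁻¹ := by
  filter_upwards [hw.growth, hw.pos, (tendsto_add_atTop_nat 1).eventually hw.pos] with k h1 h2 h3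
  have h4 : (w k)⁻¹ ≤ (1 + 1 / (k : ℝ)) * (w (k + 1))⁻¹ := by
    rw [← div_eq_mul_inv, le_div_iff₀ h3, inv_mul_le_iff₀ h2]
    linarith
  linarith

lemma isLittleO_rpow_rpow {s t : ℝ} (hst : s < t) :
    (fun x : ℝ => x ^ s) =o[atTop] fun x : ℝ => x ^ t := by
  rw [isLittleO_iff_tendsto']
  · refine (tendsto_rpow_neg_atTop (sub_pos.2 hst)).congr' ?_
    filter_upwards [eventually_gt_atTop 0] with x hx
    rw [neg_sub, Real.rpow_sub hx]
  · filter_upwards [eventually_gt_atTop 0] with x hx h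
    exact absurd h (by positivity)

lemma isLittleO_of_le_rpow {u : ℕ → ℝ} {A s t : ℝ} (hst : t < s)
    (hu : ∀ᶠ k : ℕ in atTop, |u k| ≤ A * (k : ℝ) ^ (-s)) :
    u =o[atTop] fun k : ℕ => 1 / (k : ℝ) ^ t := by
  have h1 : u =O[atTop] fun k : ℕ => (k : ℝ) ^ (-s) := by
    refine IsBigO.of_bound A ?_
    filter_upwards [hu] with k hk
    rwa [Real.norm_eq_abs, Real.norm_of_nonneg (by positivity)]
  have h2 : (fun k : ℕ => (k : ℝ) ^ (-s)) =o[atTop] fun k : ℕ => (k : ℝ) ^ (-t) :=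
    (isLittleO_rpow_rpow (by linarith)).comp_tendsto tendsto_natCast_atTop_atTop
  refine (h1.trans_isLittleO h2).congr_right fun k => ?_
  rw [Real.rpow_neg (by positivity), one_div]

/-- The path-length bound √(k^{1-γ}k^{-ψ}) turns a function rate ψ into the distance rate
(ψ-(1-γ))/2, and Φ is exactly this image of Ψ. -/
lemma ratePhi_eq {θ : ℝ} (hθ : 1 / 2 ≤ θ) : ratePhi γ θ = (ratePsi γ θ - (1 - γ)) / 2 := by
  rw [ratePhi, ratePsi]
  split_ifs with h
  · ring
  · have h1 : 0 < 2 * θ - 1 := by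
      have := lt_of_le_of_ne hθ (Ne.symm h)
      linarith
    have h2 : (1 - γ) * (1 - θ) / (2 * θ - 1) = ((1 - γ) / (2 * θ - 1) - (1 - γ)) / 2 := by
      have h3 : (1 - γ) / (2 * θ - 1) - (1 - γ) = (1 - γ) * (2 - 2 * θ) / (2 * θ - 1) := by
        rw [eq_div_iff h1.ne', sub_mul, div_mul_cancel₀ _ h1.ne']; ring
      rw [h3]; ring
    rw [h2, ← min_sub_sub_right, ← min_div_div_right (by norm_num)]
    congr 1; ring

lemma ratePsi_bounds {θ ψ : ℝ} (hγ1 : γ < 1) (hθ : 1 / 2 ≤ θ) (hψ : ψ < ratePsi γ θ) :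
    ψ < 2 * γ - 1 ∧ (2 * θ - 1) * ψ < 1 - γ := by
  rw [ratePsi] at hψ
  split_ifs at hψ with h
  · subst h
    refine ⟨hψ, ?_⟩
    norm_num
    exact hγ1
  · have h1 : 0 < 2 * θ - 1 := by
      have := lt_of_le_of_ne hθ (Ne.symm h)
      linarith
    obtain ⟨h2, h3⟩ := lt_min_iff.1 hψ
    refine ⟨h2, ?_⟩
    rw [lt_div_iff₀ h1] at h3
    linarith

/-- This makes k^{1-γ-ψ} decay geometrically under doubling for ψ near Ψ. The noise term needs γ >
2/3, the other needs θ < 1. -/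
lemma lt_ratePsi {θ : ℝ} (hγ : 2 / 3 < γ) (hγ1 : γ < 1) (hθ : 1 / 2 ≤ θ) (hθ1 : θ < 1) :
    1 - γ < ratePsi γ θ := by
  rw [ratePsi]
  split_ifs with h
  · linarith
  · have h1 : 0 < 2 * θ - 1 := by
      have := lt_of_le_of_ne hθ (Ne.symm h)
      linarith
    refine lt_min (by linarith) ?_
    rw [lt_div_iff₀ h1]
    nlinarith

/-- The decrement of b_k = k^{-ψ} is O(b_k/k), while the right side is of order b_k k^{-γ-(2θ-1)ψ},
which is larger by a positive power of k. -/
lemma IsStep.rpow_weight_condition (ha : IsStep γ a₀ a) {ψ θ c₀ : ℝ} (hγ1 : γ ≤ 1)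
    (hc₀ : 0 < c₀) (hψ0 : 0 ≤ ψ) (hψ : ψ < 2 * γ - 1) (hθ : 1 / 2 ≤ θ)
    (hψθ : (2 * θ - 1) * ψ < 1 - γ) :
    ∀ᶠ k : ℕ in atTop, ((k : ℝ) ^ ψ)⁻¹ - (((k + 1 : ℕ) : ℝ) ^ ψ)⁻¹ ≤
      c₀ * a k * ((((k + 1 : ℕ) : ℝ) ^ ψ)⁻¹) ^ (2 * θ) := by
  set s := (2 * θ - 1) * ψ with hs
  have hs0 : 0 ≤ s := mul_nonneg (by linarith) hψ0
  have ha0 := ha.pos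
  have h1 : Tendsto (fun k : ℕ => (k : ℝ) ^ (-(1 - γ - s))) atTop (𝓝 0) :=
    (tendsto_rpow_neg_atTop (by linarith)).comp tendsto_natCast_atTop_atTop
  have h2 : 0 < c₀ * (a₀ / 2) / 2 ^ s := by positivity
  filter_upwards [(isWeight_rpow hγ1 hψ0 hψ).inv_sub_inv_le, ha.ge, h1.eventually_lt_const h2,
    eventually_ge_atTop 1] with k h3 h4 h5 hk
  have hk1 : (1 : ℝ) ≤ k := by exact_mod_cast hk
  have hk0 : (0 : ℝ) < k := by linarith
  refine h3.trans ?_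
  set b := (((k + 1 : ℕ) : ℝ) ^ ψ)⁻¹ with hb
  have hkk : (0 : ℝ) < ((k + 1 : ℕ) : ℝ) := by positivity
  have hb0 : 0 < b := by positivity
  have h6 : b ^ (2 * θ) = b * (((k + 1 : ℕ) : ℝ) ^ s)⁻¹ := by
    rw [show 2 * θ = 1 + (2 * θ - 1) by ring, Real.rpow_add hb0, Real.rpow_one, hb,
      Real.inv_rpow (by positivity), ← Real.rpow_mul hkk.le, hs, mul_comm ψ]
  have h7 : (2 ^ s * (k : ℝ) ^ s)⁻¹ ≤ (((k + 1 : ℕ) : ℝ) ^ s)⁻¹ := by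
    rw [← Real.mul_rpow (by norm_num) hk0.le]
    refine inv_anti₀ (by positivity) (Real.rpow_le_rpow hkk.le ?_ hs0)
    push_cast; linarith
  have h8 : 1 / (k : ℝ) ≤ c₀ * (a₀ / 2 / (k : ℝ) ^ γ) * (2 ^ s * (k : ℝ) ^ s)⁻¹ := by
    have h9 : 1 / (k : ℝ) = (k : ℝ) ^ (-(1 - γ - s)) * ((k : ℝ) ^ γ)⁻¹ * ((k : ℝ) ^ s)⁻¹ := by
      rw [← Real.rpow_neg hk0.le, ← Real.rpow_neg hk0.le, ← Real.rpow_add hk0, ← Real.rpow_add hk0,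
        one_div, ← Real.rpow_neg_one]
      congr 1; ring
    rw [h9]
    calc _ ≤ c₀ * (a₀ / 2) / 2 ^ s * ((k : ℝ) ^ γ)⁻¹ * ((k : ℝ) ^ s)⁻¹ := by gcongr
      _ = _ := by rw [mul_inv]; ring
  rw [h6]
  calc 1 / (k : ℝ) * b ≤ (c₀ * (a₀ / 2 / (k : ℝ) ^ γ) * (2 ^ s * (k : ℝ) ^ s)⁻¹) * b := by gcongr
    _ ≤ (c₀ * a k * (((k + 1 : ℕ) : ℝ) ^ s)⁻¹) * b := by
        have := ha.nonneg k
        gcongr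
    _ = _ := by ring

/-- Polynomial rates for step sizes of order `k ^ (-γ)`, `γ < 1`. -/
theorem Trajectory.isLittleO_of_lt_one (hf : SmoothObjective f L)
    (h : Trajectory f lam c κ a y n m δ) (hlam : 0 ≤ lam) (hlam1 : lam < 1)
    (hγ : 2 / 3 < γ) (hγ1 : γ < 1) (ha : IsStep γ a₀ a) {c' : ℝ}
    (hx : ∀ᶠ k in atTop, x k = y k + n k - c' • (δ k + m k))
    (hη : NoiseRates γ a fun k => ‖n k‖ ^ 2 + ‖m k‖ ^ 2)
    (hy : Tendsto y atTop (𝓝 p)) (hδ : Tendsto (fun k => ‖δ k‖ ^ 2) atTop (𝓝 0))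
    {θ : ℝ} (hθ : 1 / 2 ≤ θ) (hθ1 : θ < 1) (hLoj : HasLojasiewiczAt f p θ)
    {ε : ℝ} (hε : 0 < ε) :
    ((fun k : ℕ => ‖x k - p‖) =o[atTop] fun k : ℕ => 1 / (k : ℝ) ^ (ratePhi γ θ - ε)) ∧
    ((fun k : ℕ => |f (x k) - f p|) =o[atTop] fun k : ℕ => 1 / (k : ℝ) ^ (ratePsi γ θ - ε)) ∧
    ((fun k : ℕ => ‖gradient f (x k)‖ ^ 2) =o[atTop]
      fun k : ℕ => 1 / (k : ℝ) ^ (ratePsi γ θ - ε)) := by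
  obtain ⟨C, hC, hLC⟩ := hLoj.exists_bound (by linarith)
  -- ψ strictly between Ψ-ε and Ψ turns the big-O rate at ψ into the claimed little-o, and ψ > 1-γ
  -- keeps the path length summable over doublings.
  obtain ⟨ψ, hψ1, hψ2⟩ := exists_between (max_lt (show ratePsi γ θ - ε < ratePsi γ θ by linarith)
    (lt_ratePsi hγ hγ1 hθ hθ1))
  obtain ⟨hψε, hψγ⟩ := max_lt_iff.1 hψ1
  obtain ⟨hψ3, hψ4⟩ := ratePsi_bounds hγ1 hθ hψ2
  have hψ0 : 0 ≤ ψ := by linarith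
  have hexp : (2 : ℝ) ^ (1 - γ - ψ) < 1 :=
    Real.rpow_lt_one_of_one_lt_of_neg one_lt_two (by linarith)
  obtain ⟨A, hA⟩ := h.exists_rates_iterates hf hlam hlam1 (by linarith) hγ1.le ha hx
    (hη.summable (by linarith)) hy hδ hθ hθ1.le hC hLC (isWeight_rpow hγ1.le hψ0 hψ3)
    (hη.rpow ψ hψ3) (ha.rpow_weight_condition hγ1.le (by positivity) hψ0 hψ3 hθ hψ4)
    (q := √((2 : ℝ) ^ (1 - γ - ψ)))
    (by rw [Real.sqrt_lt' one_pos]; simpa using hexp)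
    (by
      filter_upwards [eventually_ge_atTop 1] with k hk
      have hk0 : (0 : ℝ) < k := by exact_mod_cast hk
      rw [← Real.sqrt_mul (by positivity)]
      refine le_of_eq (congrArg _ ?_)
      push_cast
      rw [← Real.rpow_neg (by positivity), ← Real.rpow_neg (by positivity), ← Real.rpow_add hk0,
        ← Real.rpow_add (by positivity), Real.mul_rpow (by norm_num) hk0.le, ← sub_eq_add_neg])
  refine ⟨isLittleO_of_le_rpow (A := A) (s := (ψ - (1 - γ)) / 2) ?_ ?_,
    isLittleO_of_le_rpow (A := A) hψε ?_, isLittleO_of_le_rpow (A := A) hψε ?_⟩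
  · rw [ratePhi_eq hθ]; linarith
  · filter_upwards [hA, eventually_ge_atTop 1] with k ⟨h1, h2, h3⟩ hk
    have hk0 : (0 : ℝ) < k := by exact_mod_cast hk
    rw [abs_of_nonneg (norm_nonneg _)]
    refine h3.trans (le_of_eq ?_)
    rw [← Real.rpow_neg hk0.le, ← Real.rpow_add hk0, Real.sqrt_eq_rpow, ← Real.rpow_mul hk0.le]
    congr 2; ring
  · filter_upwards [hA] with k ⟨h1, h2, h3⟩
    rw [Real.rpow_neg (by positivity), abs_abs]
    exact h1
  · filter_upwards [hA] with k ⟨h1, h2, h3⟩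
    rw [Real.rpow_neg (by positivity), abs_of_nonneg (by positivity)]
    exact h2

lemma isLittleO_log_rpow_mul {g : ℕ → ℝ} {s t : ℝ} (hst : s < t) :
    (fun k : ℕ => Real.log k ^ s * g k) =o[atTop] fun k : ℕ => Real.log k ^ t * g k := by
  have h1 : (fun k : ℕ => Real.log k ^ s) =o[atTop] fun k : ℕ => Real.log k ^ t :=
    (isLittleO_rpow_rpow hst).comp_tendsto
      (Real.tendsto_log_atTop.comp tendsto_natCast_atTop_atTop)
  exact h1.mul_isBigO (isBigO_refl g atTop)

/-- Any constant below 2 would do: it must lose against the factor 1/2 gained by doubling k. -/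
lemma eventually_log_two_mul_rpow_le (s : ℝ) :
    ∀ᶠ k : ℕ in atTop, Real.log (2 * k : ℕ) ^ s ≤ 3 / 2 * Real.log k ^ s := by
  have h1 : Tendsto (fun k : ℕ => Real.log 2 / Real.log k) atTop (𝓝 0) :=
    (Real.tendsto_log_atTop.comp tendsto_natCast_atTop_atTop).const_div_atTop _
  have h2 : Tendsto (fun k : ℕ => (Real.log 2 / Real.log k + 1) ^ s) atTop (𝓝 1) := by
    have := (h1.add_const 1).rpow_const (p := s) (Or.inl (by norm_num))
    simpa using this
  filter_upwards [h2.eventually_lt_const (show (1 : ℝ) < 3 / 2 by norm_num),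
    eventually_ge_atTop 2] with k h3 hk
  have hk2 : (2 : ℝ) ≤ k := by exact_mod_cast hk
  have hl : 0 < Real.log k := Real.log_pos (by linarith)
  have hl2 : 0 < Real.log 2 := Real.log_pos (by norm_num)
  have h4 : Real.log (2 * k : ℕ) = (Real.log 2 / Real.log k + 1) * Real.log k := by
    push_cast
    rw [Real.log_mul (by norm_num) (by positivity)]
    field_simp
  rw [h4, Real.mul_rpow (by positivity) hl.le]
  gcongr

/-- Rates for step sizes of order `1 / k` under the Łojasiewicz inequality with exponent `1 / 2`. -/
theorem Trajectory.isLittleO_of_eq_one (hf : SmoothObjective f L)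
    (h : Trajectory f lam c κ a y n m δ) (hlam : 0 ≤ lam) (hlam1 : lam < 1)
    (ha : IsStep 1 a₀ a) {c' : ℝ}
    (hx : ∀ᶠ k in atTop, x k = y k + n k - c' • (δ k + m k))
    (hη : NoiseRates 1 a fun k => ‖n k‖ ^ 2 + ‖m k‖ ^ 2)
    (hy : Tendsto y atTop (𝓝 p)) (hδ : Tendsto (fun k => ‖δ k‖ ^ 2) atTop (𝓝 0))
    {C : ℝ} (hC : 0 < C) (hLoj : LojasiewiczBound f p (1 / 2) C) (hCa : 16 ≤ a₀ * C ^ 2)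
    {ε : ℝ} (hε : 0 < ε) :
    ((fun k : ℕ => ‖x k - p‖) =o[atTop] fun k : ℕ => Real.log k ^ (1 / 2 + ε) / √k) ∧
    ((fun k : ℕ => |f (x k) - f p|) =o[atTop] fun k : ℕ => Real.log k ^ (1 + ε) / k) ∧
    ((fun k : ℕ => ‖gradient f (x k)‖ ^ 2) =o[atTop] fun k : ℕ => Real.log k ^ (1 + ε) / k) := by
  -- Half of ε is kept to pass from big-O to little-o.
  have hw := isWeight_log (half_pos hε)
  obtain ⟨A, hA⟩ := h.exists_rates_iterates hf hlam hlam1 (by norm_num) le_rfl ha hx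
    (hη.summable (by norm_num)) hy hδ le_rfl (by norm_num) hC hLoj hw
    (hη.log rfl (ε / 2) (half_pos hε))
    (by
      filter_upwards [hw.inv_sub_inv_le, ha.ge, eventually_ge_atTop 1] with k h1 h2 hk
      have hk0 : (0 : ℝ) < k := by exact_mod_cast hk
      refine h1.trans ?_
      -- The two sides have the same order 1/k, so constants matter: a_k ≥ a₀/(2k) and the factor
      -- C²/8 require a₀C² ≥ 16.
      have h3 : 1 / (k : ℝ) ≤ C ^ 2 / 8 * a k := by
        rw [Real.rpow_one] at h2
        calc 1 / (k : ℝ) ≤ (a₀ * C ^ 2 / 16) / k := by gcongr; linarith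
          _ = C ^ 2 / 8 * (a₀ / 2 / k) := by ring
          _ ≤ _ := by gcongr
      have h4 : C ^ 2 / 4 * (1 / 2) ^ (2 * (1 / 2 : ℝ)) * a k = C ^ 2 / 8 * a k := by
        rw [show 2 * (1 / 2 : ℝ) = 1 by norm_num, Real.rpow_one]; ring
      rw [h4, show 2 * (1 / 2 : ℝ) = 1 by norm_num, Real.rpow_one]
      exact mul_le_mul_of_nonneg_right h3 (inv_nonneg.2 (hw.nonneg _)))
    (q := √(3 / 4)) (by rw [Real.sqrt_lt' one_pos]; norm_num)
    (by
      filter_upwards [eventually_log_two_mul_rpow_le (1 + ε / 2), eventually_ge_atTop 1] with k h1 hk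
      have hk0 : (0 : ℝ) < k := by exact_mod_cast hk
      rw [← Real.sqrt_mul (by norm_num)]
      refine Real.sqrt_le_sqrt ?_
      simp only [sub_self, Real.rpow_zero, one_mul, inv_div]
      push_cast at h1 ⊢
      calc Real.log (2 * (k : ℝ)) ^ (1 + ε / 2) / (2 * k)
          ≤ (3 / 2 * Real.log k ^ (1 + ε / 2)) / (2 * k) := by gcongr
        _ = _ := by ring)
  have hO : ∀ {u : ℕ → ℝ}, (∀ᶠ k : ℕ in atTop,
      |u k| ≤ A * ((k : ℝ) / Real.log k ^ (1 + ε / 2))⁻¹) →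
      u =o[atTop] fun k : ℕ => Real.log k ^ (1 + ε) / k := by
    intro u hu
    have h1 : u =O[atTop] fun k : ℕ => Real.log k ^ (1 + ε / 2) * (k : ℝ)⁻¹ := by
      refine IsBigO.of_bound A ?_
      filter_upwards [hu] with k hk
      have := Real.log_natCast_nonneg k
      rw [Real.norm_eq_abs, Real.norm_of_nonneg (by positivity)]
      rwa [inv_div, div_eq_mul_inv] at hk
    refine (h1.trans_isLittleO (isLittleO_log_rpow_mul
      (show 1 + ε / 2 < 1 + ε by linarith))).congr_right fun k => ?_
    rw [div_eq_mul_inv]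
  refine ⟨?_, hO (hA.mono fun k hk => by rw [abs_abs]; exact hk.1),
    hO (hA.mono fun k hk => by rw [abs_of_nonneg (by positivity)]; exact hk.2.1)⟩
  have h1 : (fun k : ℕ => ‖x k - p‖) =O[atTop]
      fun k : ℕ => Real.log k ^ (1 / 2 + ε / 4) * (√(k : ℝ))⁻¹ := by
    refine IsBigO.of_bound A ?_
    filter_upwards [hA] with k hk
    have hl := Real.log_natCast_nonneg k
    rw [norm_norm, Real.norm_of_nonneg (by positivity)]
    refine hk.2.2.trans (le_of_eq ?_)
    rw [sub_self, Real.rpow_zero, one_mul, inv_div, Real.sqrt_div (by positivity),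
      Real.sqrt_eq_rpow (Real.log k ^ _), ← Real.rpow_mul hl, div_eq_mul_inv]
    congr 3; ring
  refine (h1.trans_isLittleO (isLittleO_log_rpow_mul
    (show 1 / 2 + ε / 4 < 1 / 2 + ε by linarith))).congr_right fun k => ?_
  exact (div_eq_mul_inv _ _).symm

end


/-! ### The Łojasiewicz inequality of the merit function. -/

section

variable {d : ℕ} {f : Vec d → ℝ} {L lam : ℝ} {p : Vec d}

lemma hasGradientAt_merit (hf : SmoothObjective f L) (x z : Vec d) :
    HasGradientAt (merit f L lam)
      (WithLp.toLp 2 (-(2 * (3 * L / (1 - lam))) • (z - x),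
        gradient f z + (2 * (3 * L / (1 - lam))) • (z - x))) (WithLp.toLp 2 (x, z)) := by
  set ζ := 3 * L / (1 - lam) with hζ
  have h1 : HasFDerivAt (fun q : WithLp 2 (Vec d × Vec d) => q.snd)
      (WithLp.sndL 2 ℝ (Vec d) (Vec d)) (WithLp.toLp 2 (x, z)) :=
    (WithLp.sndL 2 ℝ (Vec d) (Vec d)).hasFDerivAt
  have h2 : HasFDerivAt (fun q : WithLp 2 (Vec d × Vec d) => q.fst)
      (WithLp.fstL 2 ℝ (Vec d) (Vec d)) (WithLp.toLp 2 (x, z)) :=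
    (WithLp.fstL 2 ℝ (Vec d) (Vec d)).hasFDerivAt
  have h3 : HasFDerivAt f (InnerProductSpace.toDual ℝ (Vec d) (gradient f z))
      (WithLp.toLp 2 (x, z) : WithLp 2 (Vec d × Vec d)).snd :=
    (hf.differentiable z).hasGradientAt.hasFDerivAt
  have h4 := (h3.comp _ h1).add (((h1.sub h2).norm_sq).const_mul ζ)
  rw [hasGradientAt_iff_hasFDerivAt]
  refine h4.congr_fderiv ?_
  ext v
  simp [inner_add_left, inner_sub_left, inner_smul_left, inner_neg_left]
  ring

lemma norm_gradient_merit_sq (hf : SmoothObjective f L) (x z : Vec d) :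
    ‖gradient (merit f L lam) (WithLp.toLp 2 (x, z))‖ ^ 2 =
      (2 * (3 * L / (1 - lam))) ^ 2 * ‖z - x‖ ^ 2 +
        ‖gradient f z + (2 * (3 * L / (1 - lam))) • (z - x)‖ ^ 2 := by
  rw [(hasGradientAt_merit hf x z).gradient, WithLp.prod_norm_sq_eq_of_L2]
  change ‖_ • (z - x)‖ ^ 2 + ‖gradient f z + _‖ ^ 2 = _
  rw [norm_smul, mul_pow, Real.norm_eq_abs, sq_abs, neg_sq]

/-- On the diagonal the quadratic term and its gradient vanish, so the inequality for f follows with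
the same constant. -/
lemma MeritLojasiewiczAt.lojasiewiczBound (hf : SmoothObjective f L) {θ C : ℝ}
    (h : MeritLojasiewiczAt f L lam p θ C) : LojasiewiczBound f p θ C := by
  obtain ⟨η, hη, U, hU, h⟩ := h
  refine ⟨η, hη, U, hU, fun x hx hxη => ?_⟩
  have h1 := h x hx x hx hxη hxη
  have h2 := norm_gradient_merit_sq (lam := lam) hf x x
  have h3 : ‖gradient (merit f L lam) (WithLp.toLp 2 (x, x))‖ = ‖gradient f x‖ := by
    rw [← sq_eq_sq₀ (norm_nonneg _) (norm_nonneg _), h2]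
    simp
  rw [h3] at h1
  simpa [merit] using h1

/-- For θ = 1/2 the squared inequality bounds the gap by the squared gradient, for f by assumption
and for the quadratic term automatically; the two add up. -/
lemma LojasiewiczBound.exists_meritLojasiewiczAt (hf : SmoothObjective f L) (hlam1 : lam < 1)
    {C₀ : ℝ} (hC₀ : 0 < C₀) (h : LojasiewiczBound f p (1 / 2) C₀) :
    ∃ C, 0 < C ∧ MeritLojasiewiczAt f L lam p (1 / 2) C := by
  obtain ⟨η, hη, U, hU, h⟩ := h
  have hL := hf.L_pos
  have h1lam : 0 < 1 - lam := by linarith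
  set ζ := 3 * L / (1 - lam) with hζ
  have hζ0 : 0 < ζ := by positivity
  set S := 1 / C₀ ^ 2 + 1 / (4 * ζ) with hS
  have hS0 : 0 < S := by positivity
  refine ⟨1 / √(3 * S), by positivity, η, hη, U, hU, fun x _ z hz _ hzη => ?_⟩
  have h1 := h z hz hzη
  have h2 := norm_gradient_merit_sq (lam := lam) hf x z
  rw [← hζ] at h2
  set N := ‖gradient (merit f L lam) (WithLp.toLp 2 (x, z))‖ with hN
  set g := gradient f z with hg
  set v := (2 * ζ) • (z - x) with hv
  have hv2 : ‖v‖ ^ 2 = (2 * ζ) ^ 2 * ‖z - x‖ ^ 2 := by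
    rw [hv, norm_smul, mul_pow, Real.norm_eq_abs, sq_abs]
  rw [← hv2] at h2
  -- ‖g‖² ≤ 2‖g+v‖² + 2‖v‖²; with one further ‖v‖² the factor is 3.
  have h3 : ‖g‖ ^ 2 + ‖v‖ ^ 2 ≤ 3 * N ^ 2 := by
    have h4 : ‖g‖ ≤ ‖g + v‖ + ‖v‖ := by simpa using norm_sub_le (g + v) v
    have h5 := pow_le_pow_left₀ (norm_nonneg _) h4 2
    nlinarith [sq_nonneg (‖g + v‖ - ‖v‖), sq_nonneg ‖g + v‖]
  have h4 : |f z - f p| ≤ 1 / C₀ ^ 2 * ‖g‖ ^ 2 := by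
    have h5 := pow_le_pow_left₀ (by positivity) h1 2
    rw [mul_pow, ← Real.sqrt_eq_rpow, Real.sq_sqrt (abs_nonneg _)] at h5
    rw [div_mul_eq_mul_div, one_mul, le_div_iff₀ (by positivity)]
    linarith
  have h5 : ζ * ‖z - x‖ ^ 2 = 1 / (4 * ζ) * ‖v‖ ^ 2 := by
    rw [hv2]; field_simp; norm_num
  have h6 : |merit f L lam (WithLp.toLp 2 (x, z)) - f p| ≤ 3 * S * N ^ 2 := by
    have h7 : |merit f L lam (WithLp.toLp 2 (x, z)) - f p| ≤ |f z - f p| + ζ * ‖z - x‖ ^ 2 := by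
      have h8 : merit f L lam (WithLp.toLp 2 (x, z)) - f p = (f z - f p) + ζ * ‖z - x‖ ^ 2 := by
        change f z + ζ * ‖z - x‖ ^ 2 - f p = _
        ring
      rw [h8]
      refine (abs_add_le _ _).trans (le_of_eq ?_)
      rw [abs_of_nonneg (by positivity : 0 ≤ ζ * ‖z - x‖ ^ 2)]
    have h9 : S * (‖g‖ ^ 2 + ‖v‖ ^ 2) ≤ S * (3 * N ^ 2) := mul_le_mul_of_nonneg_left h3 hS0.le
    have h10 : 0 ≤ 1 / C₀ ^ 2 * ‖v‖ ^ 2 := by positivity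
    have h11 : 0 ≤ 1 / (4 * ζ) * ‖g‖ ^ 2 := by positivity
    have h12 : S * (‖g‖ ^ 2 + ‖v‖ ^ 2) = 1 / C₀ ^ 2 * ‖g‖ ^ 2 + 1 / (4 * ζ) * ‖g‖ ^ 2 +
      (1 / C₀ ^ 2 * ‖v‖ ^ 2 + 1 / (4 * ζ) * ‖v‖ ^ 2) := by rw [hS]; ring
    linarith
  rw [div_mul_eq_mul_div, one_mul, div_le_iff₀ (by positivity), ← Real.sqrt_eq_rpow]
  refine Real.sqrt_le_iff.2 ⟨by positivity, h6.trans (le_of_eq ?_)⟩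
  rw [mul_pow, Real.sq_sqrt (by positivity)]; ring

end


/-! ### Reduction of SGDM to a perturbed trajectory. -/

/-- The solution of `q (k+1) = ρ k • q k + s k • e k` with `q 0 = 0`. -/
def leakySum {E : Type*} [NormedAddCommGroup E] [NormedSpace ℝ E] (ρ s : ℕ → ℝ) (e : ℕ → E) :
    ℕ → E
  | 0 => 0
  | k + 1 => ρ k • leakySum ρ s e k + s k • e k

section

variable {α β γ lam : ℝ}

lemma isStep_polynomial (hα : 0 < α) (hβ : 0 ≤ β) (hγ : 0 < γ) (hγ1 : γ ≤ 1) (hlam1 : lam < 1) :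
    IsStep γ (α / (1 - lam)) fun k : ℕ => α / ((k : ℝ) + β) ^ γ / (1 - lam) := by
  have h1 : 0 < 1 - lam := by linarith
  refine ⟨by positivity, fun k => by positivity, ?_, ?_⟩
  · filter_upwards [eventually_ge_atTop 1] with k hk
    have hk0 : (0 : ℝ) < k := by exact_mod_cast hk
    have h2 : (k : ℝ) ^ γ ≤ ((k : ℝ) + β) ^ γ :=
      Real.rpow_le_rpow hk0.le (by linarith) hγ.le
    rw [div_right_comm]
    exact div_le_div_of_nonneg_left (by positivity) (by positivity) h2
  · filter_upwards [eventually_ge_atTop 1, tendsto_natCast_atTop_atTop.eventually_ge_atTop β]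
      with k hk hkβ
    have hk0 : (0 : ℝ) < k := by exact_mod_cast hk
    have h2 : ((k : ℝ) + β) ^ γ ≤ 2 * (k : ℝ) ^ γ := by
      calc ((k : ℝ) + β) ^ γ ≤ (2 * (k : ℝ)) ^ γ :=
            Real.rpow_le_rpow (by positivity) (by linarith) hγ.le
        _ = 2 ^ γ * (k : ℝ) ^ γ := Real.mul_rpow (by norm_num) hk0.le
        _ ≤ 2 * (k : ℝ) ^ γ := by
            gcongr
            simpa using Real.rpow_le_rpow_of_exponent_le (by norm_num : (1 : ℝ) ≤ 2) hγ1
    have h3 : α / (1 - lam) / 2 / (k : ℝ) ^ γ = α / (2 * (k : ℝ) ^ γ) / (1 - lam) := by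
      field_simp
    rw [h3]
    gcongr

/-- The contraction factors `1 - κ a k` absorb the factor `1 + 1/k` once `κ` is large. -/
lemma IsStep.eventually_contraction {a₀ : ℝ} {a : ℕ → ℝ} (ha : IsStep γ a₀ a) (hγ : 0 < γ)
    (hγ1 : γ ≤ 1) :
    ∀ᶠ k : ℕ in atTop, (1 + 1 / (k : ℝ)) * (1 - (1 + 2 / a₀) * a k) ^ 2 ≤ 1 - a k := by
  have h0 := ha.pos
  have hκ : 0 < 1 + 2 / a₀ := by positivity
  have h1 : ∀ᶠ k in atTop, a k < 1 / (1 + 2 / a₀) :=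
    (ha.tendsto_zero hγ).eventually_lt_const (by positivity)
  filter_upwards [h1, ha.ge, eventually_ge_atTop 1] with k h1 h2 hk
  have hk1 : (1 : ℝ) ≤ k := by exact_mod_cast hk
  have hk0 : (0 : ℝ) < k := by linarith
  rw [lt_div_iff₀ hκ] at h1
  have h3 : (k : ℝ) ^ γ ≤ k := by simpa using Real.rpow_le_rpow_of_exponent_le hk1 hγ1
  have h4 : a₀ / 2 / k ≤ a k :=
    (div_le_div_of_nonneg_left (by positivity) (by positivity) h3).trans h2
  -- The part 2/a₀ of the leak cancels the growth 1/k of the weights, and the part 1 leaves the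
  -- contraction 1 - a_k.
  have h5 : 1 / (k : ℝ) ≤ 2 / a₀ * a k := by
    calc 1 / (k : ℝ) = 2 / a₀ * (a₀ / 2 / k) := by field_simp
      _ ≤ _ := by gcongr
  have h6 := ha.nonneg k
  set t := (1 + 2 / a₀) * a k with ht
  have ht0 : 0 ≤ t := by positivity
  have ht1 : t ≤ 1 := by rw [ht]; linarith
  have h7 : (1 - t) ^ 2 ≤ 1 - t := by nlinarith
  have h8 : 1 / (k : ℝ) * (1 - t) ^ 2 ≤ 1 / (k : ℝ) * 1 := by
    gcongr; linarith
  have h9 : t = a k + 2 / a₀ * a k := by rw [ht]; ring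
  linarith

lemma IsStep.eventually_contraction_const {a₀ : ℝ} {a : ℕ → ℝ} (ha : IsStep γ a₀ a) (hγ : 0 < γ)
    (hlam : 0 ≤ lam) (hlam1 : lam < 1) :
    ∀ᶠ k : ℕ in atTop, (1 + 1 / (k : ℝ)) * lam ^ 2 ≤ 1 - a k := by
  have h1 : Tendsto (fun k : ℕ => (1 + 1 / (k : ℝ)) * lam ^ 2 + a k) atTop
      (𝓝 ((1 + 0) * lam ^ 2 + 0)) :=
    ((tendsto_const_nhds.add tendsto_one_div_atTop_nhds_zero_nat).mul_const _).add
      (ha.tendsto_zero hγ)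
  have h2 : (1 + 0) * lam ^ 2 + 0 < 1 := by nlinarith
  filter_upwards [h1.eventually_lt_const h2] with k hk
  linarith

end

section

variable {d : ℕ} {Ω : Type*} {f : Vec d → ℝ} {L lam nu : ℝ} {x0 : Vec d} {e x : ℕ → Ω → Vec d}

lemma liminfFinite_frequently {ω : Ω} (h : ω ∈ liminfFinite x) :
    ∃ B : ℝ, ∃ᶠ k in atTop, ‖x k ω‖ ≤ B := by
  obtain ⟨b, hb, hb'⟩ := exists_between (show liminf (fun k => ‖x k ω‖ₑ) atTop < ∞ from h)
  refine ⟨b.toReal, (frequently_lt_of_liminf_lt (by isBoundedDefault) hb).mono fun k hk => ?_⟩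
  rw [← toReal_enorm]
  exact ENNReal.toReal_mono hb'.ne hk.le

lemma measurableSet_liminfFinite [MeasurableSpace Ω] (hx : ∀ k, Measurable (x k)) :
    MeasurableSet (liminfFinite x) :=
  measurableSet_lt (.liminf fun k => (hx k).enorm) measurable_const

lemma IsSGDM.measurable [MeasurableSpace Ω] {a : ℕ → ℝ} (hf : SmoothObjective f L)
    (hx : IsSGDM f lam nu a x0 e x) (he : ∀ k, 1 ≤ k → Measurable (e k)) :
    ∀ k, Measurable (x k) := by
  have h : ∀ k, Measurable (x k) ∧ Measurable (x (k + 1)) := by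
    intro k
    induction k with
    | zero =>
      exact ⟨by simp [funext hx.init_zero],
        by simp [funext hx.init_one]⟩
    | succ k ih =>
      obtain ⟨h0, h1⟩ := ih
      refine ⟨h1, ?_⟩
      have h2 := he (k + 1) (by omega)
      have h3 := hf.continuous_gradient.measurable
      have h4 : Measurable fun ω => gradient f (x (k + 1) ω + nu • (x (k + 1) ω - x k ω)) :=
        h3.comp (h1.add ((h1.sub h0).const_smul nu))
      rw [funext (hx.step k)]
      exact (h1.sub ((h4.sub h2).const_smul (a (k + 1)))).add ((h1.sub h0).const_smul lam)
  exact fun k => (h k).1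

/-- The natural filtration of a process. -/
def naturalFiltration [mΩ : MeasurableSpace Ω] (hx : ∀ k, Measurable (x k)) :
    Filtration ℕ mΩ where
  seq := naturalSigma x
  mono' := fun _ _ hij => biSup_mono fun _ h => h.trans hij
  le' := fun _ => iSup₂_le fun j _ => (hx j).comap_le

/-- The error can be solved for in the recursion because the step is nonzero, so it is measurable at
the next time of the natural filtration. The unconstrained error of index 0 is replaced by zero. -/
lemma IsSGDM.isNoise [mΩ : MeasurableSpace Ω] {μ : Measure Ω} [IsProbabilityMeasure μ]
    {a : ℕ → ℝ} {σ : ℝ}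
    (hf : SmoothObjective f L) (hx : IsSGDM f lam nu a x0 e x) (ha : ∀ k, 1 ≤ k → 0 < a k)
    (he : NoiseCondition μ x e σ) (hxm : ∀ k, Measurable (x k)) :
    IsNoise (naturalFiltration hxm) μ (fun k ω => if k = 0 then 0 else e k ω) σ := by
  refine ⟨?_, ?_, ?_, ?_⟩ <;> rintro (_ | k)
  · simpa using stronglyMeasurable_const
  · have h0 : ∀ j ≤ k + 2, Measurable[naturalSigma x (k + 2)] (x j) := fun j hj =>
      measurable_iff_comap_le.2 (le_iSup₂_of_le j hj le_rfl)
    have hak := ha (k + 1) (by omega)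
    have h1 : (fun ω => if k + 1 = 0 then 0 else e (k + 1) ω) = fun ω =>
        (a (k + 1))⁻¹ • (x (k + 2) ω - x (k + 1) ω - lam • (x (k + 1) ω - x k ω)) +
          gradient f (x (k + 1) ω + nu • (x (k + 1) ω - x k ω)) := by
      funext ω
      rw [if_neg (by omega), hx.step k ω]
      have : (a (k + 1))⁻¹ * a (k + 1) = 1 := inv_mul_cancel₀ hak.ne'
      generalize gradient f _ = g
      linear_combination (norm := module) (-this) • (e (k + 1) ω - g)
    rw [h1]
    have h3 := hf.continuous_gradient.measurable
    have m0 := h0 k (by omega)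
    have m1 := h0 (k + 1) (by omega)
    have m2 := h0 (k + 2) le_rfl
    have h4 : Measurable[naturalSigma x (k + 2)] fun ω =>
        gradient f (x (k + 1) ω + nu • (x (k + 1) ω - x k ω)) :=
      h3.comp (m1.add ((m1.sub m0).const_smul nu))
    have h5 : Measurable[naturalSigma x (k + 2)] fun ω =>
        (a (k + 1))⁻¹ • (x (k + 2) ω - x (k + 1) ω - lam • (x (k + 1) ω - x k ω)) :=
      ((m2.sub m1).sub ((m1.sub m0).const_smul lam)).const_smul (a (k + 1))⁻¹
    exact (h5.add h4).stronglyMeasurable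
  · simp
  · simpa using he.square_integrable (k + 1) (by omega)
  · exact (condExp_zero (μ := μ) (E := Vec d)).eventuallyEq
  · exact he.condExp_zero (k + 1) (by omega)
  · have : (fun _ : Ω => (0 : ℝ)) = 0 := rfl
    simp only [if_true, norm_zero, ne_eq, OfNat.ofNat_ne_zero, not_false_eq_true, zero_pow]
    rw [this, condExp_zero]
    exact Eventually.of_forall fun ω => sq_nonneg σ
  · exact he.condVar_le (k + 1) (by omega)

/-- Along SGDM, subtracting the leaky sums of the errors from the extrapolated iterate and from the
momentum produces a deterministic-type perturbed trajectory. -/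
lemma IsSGDM.trajectory {a : ℕ → ℝ} (hlam1 : lam < 1)
    (hx : IsSGDM f lam nu (fun k => (1 - lam) * a k) x0 e x) (κ : ℝ) {ω : Ω} {n m : ℕ → Vec d}
    (hn : ∀ᶠ k in atTop, n (k + 1) = (1 - κ * a k) • n k + a k • e k ω)
    (hm : ∀ᶠ k in atTop, m (k + 1) = lam • m k + ((1 - lam) * a k) • e k ω) :
    Trajectory f lam (nu - lam / (1 - lam)) κ a
      (fun k => x k ω + (lam / (1 - lam)) • (x k ω - x (k - 1) ω) - n k) n m
      (fun k => x k ω - x (k - 1) ω - m k) := by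
  have h1 : 1 - lam ≠ 0 := by linarith
  set c' := lam / (1 - lam) with hc'
  -- This identity makes the momentum terms cancel in the recursion of the extrapolated iterate.
  have h2 : lam = c' * (1 - lam) := by rw [hc']; field_simp
  have h3 : ∀ k, x k ω + c' • (x k ω - x (k - 1) ω) - n k + n k +
      (nu - c') • (x k ω - x (k - 1) ω - m k + m k) = x k ω + nu • (x k ω - x (k - 1) ω) :=
    fun k => by module
  constructor
  · filter_upwards [hn, eventually_ge_atTop 1] with k hn hk
    obtain ⟨j, rfl⟩ : ∃ j, k = j + 1 := ⟨k - 1, by omega⟩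
    rw [h3, hn]
    simp only [Nat.add_sub_cancel]
    rw [hx.step j ω]
    generalize gradient f _ = g
    generalize e (j + 1) ω = v
    generalize a (j + 1) = b
    generalize x (j + 1) ω = X
    generalize x j ω = Y
    linear_combination (norm := module) (h2) • (X - Y) + (-h2 * b) • (v - g)
  · filter_upwards [hm, eventually_ge_atTop 1] with k hm hk
    obtain ⟨j, rfl⟩ : ∃ j, k = j + 1 := ⟨k - 1, by omega⟩
    rw [h3, hm]
    simp only [Nat.add_sub_cancel]
    rw [hx.step j ω]
    module

end

end SGDM
end

/-! ### Assembly: one event of full measure, then deterministic statements. -/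

theorem mainTheorem4 {d : ℕ} {Ω : Type*} [MeasurableSpace Ω] (μ : Measure Ω)
    [IsProbabilityMeasure μ]
    (f : SGDM.Vec d → ℝ) (L : ℝ) (hf : SGDM.SmoothObjective f L)
    (hLoj : SGDM.SatisfiesLojasiewicz f)
    (α β γ lam nu σ : ℝ) (hα : 0 < α) (hβ : 0 ≤ β) (hγ : 2 / 3 < γ) (hγ1 : γ ≤ 1)
    (hlam : 0 ≤ lam) (hlam1 : lam < 1) (hnu : 0 ≤ nu)
    (x0 : SGDM.Vec d) (e x : ℕ → Ω → SGDM.Vec d)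
    (hx : SGDM.IsSGDM f lam nu (fun k : ℕ => α / ((k : ℝ) + β) ^ γ) x0 e x)
    (he : SGDM.NoiseCondition μ x e σ) :
    ∃ xstar : Ω → SGDM.Vec d, Measurable xstar ∧
      ((SGDM.crit f).Nonempty → ∀ ω, xstar ω ∈ SGDM.crit f) ∧
      (∀ᵐ ω ∂μ, ω ∈ SGDM.liminfFinite x →
        xstar ω ∈ SGDM.crit f ∧ Tendsto (fun k => x k ω) atTop (𝓝 (xstar ω))) ∧
      ∃ R : Set Ω, MeasurableSet R ∧ R ⊆ SGDM.liminfFinite x ∧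
        μ R = μ (SGDM.liminfFinite x) ∧
        ∀ ω ∈ R,
          xstar ω ∈ SGDM.crit f ∧ Tendsto (fun k => x k ω) atTop (𝓝 (xstar ω)) ∧
          (γ < 1 → ∀ θ : ℝ, 1 / 2 ≤ θ → θ < 1 → SGDM.HasLojasiewiczAt f (xstar ω) θ →
            ∀ ε : ℝ, 0 < ε →
              ((fun k : ℕ => ‖x k ω - xstar ω‖) =o[atTop]
                fun k : ℕ => 1 / (k : ℝ) ^ (SGDM.ratePhi γ θ - ε)) ∧
              ((fun k : ℕ => |f (x k ω) - f (xstar ω)|) =o[atTop]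
                fun k : ℕ => 1 / (k : ℝ) ^ (SGDM.ratePsi γ θ - ε)) ∧
              ((fun k : ℕ => ‖gradient f (x k ω)‖ ^ 2) =o[atTop]
                fun k : ℕ => 1 / (k : ℝ) ^ (SGDM.ratePsi γ θ - ε))) ∧
          (γ = 1 → SGDM.HasLojasiewiczAt f (xstar ω) (1 / 2) →
            (∃ C : ℝ, 0 < C ∧ SGDM.MeritLojasiewiczAt f L lam (xstar ω) (1 / 2) C) ∧
            ∀ C : ℝ, 0 < C → SGDM.MeritLojasiewiczAt f L lam (xstar ω) (1 / 2) C →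
              200 / C ^ 2 < α → ∀ ε : ℝ, 0 < ε →
                ((fun k : ℕ => ‖x k ω - xstar ω‖) =o[atTop]
                  fun k : ℕ => Real.log k ^ (1 / 2 + ε) / Real.sqrt k) ∧
                ((fun k : ℕ => |f (x k ω) - f (xstar ω)|) =o[atTop]
                  fun k : ℕ => Real.log k ^ (1 + ε) / k) ∧
                ((fun k : ℕ => ‖gradient f (x k ω)‖ ^ 2) =o[atTop]
                  fun k : ℕ => Real.log k ^ (1 + ε) / k)) := by
  have h1lam : 0 < 1 - lam := by linarith
  have hγ0 : 0 < γ := by linarith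
  set a : ℕ → ℝ := fun k => α / ((k : ℝ) + β) ^ γ / (1 - lam) with ha_def
  set a₀ := α / (1 - lam) with ha₀
  set κ := 1 + 2 / a₀ with hκ
  have ha : SGDM.IsStep γ a₀ a := SGDM.isStep_polynomial hα hβ hγ0 hγ1 hlam1
  have hxm : ∀ k, Measurable (x k) := hx.measurable hf he.measurable
  -- Positivity is needed only for k ≥ 1: at k = 0 with β = 0 the step is a division by zero, hence
  -- 0.
  have hnoise := hx.isNoise hf (fun k hk => by
    have : (0 : ℝ) < k := by exact_mod_cast hk
    positivity) he hxm
  have haα : (fun k : ℕ => α / ((k : ℝ) + β) ^ γ) = fun k => (1 - lam) * a k := by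
    funext k
    simp only [ha_def]
    field_simp
  rw [haα] at hx
  set e' : ℕ → Ω → SGDM.Vec d := fun k ω => if k = 0 then 0 else e k ω with he'
  set n : Ω → ℕ → SGDM.Vec d :=
    fun ω => SGDM.leakySum (fun k => 1 - κ * a k) a (fun k => e' k ω) with hn
  set m : Ω → ℕ → SGDM.Vec d :=
    fun ω => SGDM.leakySum (fun _ => lam) (fun k => (1 - lam) * a k) (fun k => e' k ω) with hm
  set c' := lam / (1 - lam) with hc'
  have htraj : ∀ ω, SGDM.Trajectory f lam (nu - c') κ a
      (fun k => x k ω + c' • (x k ω - x (k - 1) ω) - n ω k) (n ω) (m ω)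
      (fun k => x k ω - x (k - 1) ω - m ω k) := by
    intro ω
    refine hx.trajectory hlam1 κ ?_ ?_ <;>
      filter_upwards [eventually_ge_atTop 1] with k hk <;>
      simp [hn, hm, he', SGDM.leakySum, show k ≠ 0 by omega]
  have hxy : ∀ ω k, x k ω = x k ω + c' • (x k ω - x (k - 1) ω) - n ω k + n ω k -
      c' • (x k ω - x (k - 1) ω - m ω k + m ω k) := fun ω k => by module
  have hrates : ∀ᵐ ω ∂μ, SGDM.NoiseRates γ a fun k => ‖n ω k‖ ^ 2 + ‖m ω k‖ ^ 2 := by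
    have h1 := SGDM.ae_noiseRates (q := fun k ω => n ω k) (by linarith) hγ1 hnoise
      (fun _ => rfl) (fun _ _ => rfl)
      (ha.le.mono fun k hk => by rwa [abs_of_nonneg (ha.nonneg k)]) ha.nonneg
      (ha.not_summable hγ1) (ha.eventually_contraction hγ0 hγ1)
    have h2 := SGDM.ae_noiseRates (q := fun k ω => m ω k) (by linarith) hγ1 hnoise
      (fun _ => rfl) (fun _ _ => rfl)
      (ha.le.mono fun k hk => by
        have := ha.nonneg k
        rw [abs_of_nonneg (by positivity)]
        exact (mul_le_of_le_one_left this (by linarith)).trans hk) ha.nonneg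
      (ha.not_summable hγ1) (ha.eventually_contraction_const hγ0 hlam hlam1)
    filter_upwards [h1, h2] with ω h1 h2 using h1.add h2
  -- One measurable event of full measure carries the noise rates for all exponents; it depends
  -- neither on the limit point nor on θ, C or ε.
  obtain ⟨Ω₀, hΩ₀, hΩ₀m, hΩ₀r⟩ := hrates.exists_measurable_mem
  set R := SGDM.liminfFinite x ∩ Ω₀ with hR
  have hRm : MeasurableSet R := (SGDM.measurableSet_liminfFinite hxm).inter hΩ₀m
  have hlim : ∀ ω ∈ R, ∃ p ∈ SGDM.crit f, Tendsto (fun k => x k ω) atTop (𝓝 p) ∧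
      Tendsto (fun k => x k ω + c' • (x k ω - x (k - 1) ω) - n ω k) atTop (𝓝 p) ∧
      Tendsto (fun k => ‖x k ω - x (k - 1) ω - m ω k‖ ^ 2) atTop (𝓝 0) := by
    rintro ω ⟨hω, hω₀⟩
    obtain ⟨B, hB⟩ := SGDM.liminfFinite_frequently hω
    exact (htraj ω).exists_tendsto hf hLoj hlam hlam1 hγ hγ1 ha (hΩ₀r ω hω₀)
      (Eventually.of_forall (hxy ω)) hB
  choose! p hp using hlim
  obtain ⟨p₀, hp₀⟩ : ∃ p₀ : SGDM.Vec d, (SGDM.crit f).Nonempty → p₀ ∈ SGDM.crit f := by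
    by_cases h : (SGDM.crit f).Nonempty
    · exact ⟨h.some, fun _ => h.some_mem⟩
    · exact ⟨0, fun h' => absurd h' h⟩
  classical
  have hxs : ∀ ω ∈ R, R.piecewise p (fun _ => p₀) ω = p ω := fun ω hω =>
    Set.piecewise_eq_of_mem _ _ _ hω
  refine ⟨R.piecewise p fun _ => p₀, ?_, fun h ω => ?_, ?_, R, hRm, Set.inter_subset_left, ?_, ?_⟩
  -- The chosen limits are measurable as the pointwise limit of the iterates on `R`, with the
  -- constant `p₀` elsewhere.
  · refine measurable_of_tendsto_metrizable
      (f := fun k => R.piecewise (x k) fun _ => p₀)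
      (fun k => (hxm k).piecewise hRm measurable_const) (tendsto_pi_nhds.2 fun ω => ?_)
    by_cases hω : ω ∈ R
    · simpa [hω] using (hp ω hω).2.1
    · simp [hω]
  · by_cases hω : ω ∈ R
    · simpa [hω] using (hp ω hω).1
    · simpa [hω] using hp₀ h
  · filter_upwards [hΩ₀] with ω hω₀ hω
    rw [hxs ω ⟨hω, hω₀⟩]
    exact ⟨(hp ω ⟨hω, hω₀⟩).1, (hp ω ⟨hω, hω₀⟩).2.1⟩
  · refine measure_congr ?_
    filter_upwards [hΩ₀] with ω hω₀
    exact propext ⟨fun h => h.1, fun h => ⟨h, hω₀⟩⟩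
  · intro ω hω
    obtain ⟨hpc, hpx, hpy, hpδ⟩ := hp ω hω
    have hxyω := Eventually.of_forall (f := atTop) (hxy ω)
    rw [hxs ω hω]
    refine ⟨hpc, hpx, fun hγ1 θ hθ hθ1 hLθ ε hε => ?_, fun hγ1 hLθ => ⟨?_, ?_⟩⟩
    · exact (htraj ω).isLittleO_of_lt_one hf hlam hlam1 hγ hγ1 ha hxyω (hΩ₀r ω hω.2) hpy hpδ
        hθ hθ1 hLθ hε
    · obtain ⟨C₀, hC₀, hb⟩ := hLθ.exists_bound (by norm_num)
      exact hb.exists_meritLojasiewiczAt hf hlam1 hC₀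
    · intro C hC hM hCα ε hε
      have h16 : 16 ≤ a₀ * C ^ 2 := by
        rw [div_lt_iff₀ (by positivity)] at hCα
        -- Since a₀ = α/(1-λ) ≥ α, the assumption gives a₀C² > 200, well above the 16 needed.
        have h1 : α ≤ a₀ := by rw [ha₀, le_div_iff₀ h1lam]; nlinarith
        nlinarith [sq_nonneg C]
      have hr := hΩ₀r ω hω.2
      rw [hγ1] at ha hr
      exact (htraj ω).isLittleO_of_eq_one hf hlam hlam1 ha hxyω hr hpy hpδ hC
        (hM.lojasiewiczBound hf) h16 hε
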